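/- Let $S\in\{\tfrac12,1,\tfrac32,\dots\}$ and let $\vec S=(S^1,S^2,S^3)$ be the generators of rotations in the $(2S+1)$-dimensional irreducible representation of $SU(2)$. For a finite set $\Lambda\subset\mathbb Z^2$ consider the nearest-neighbour ferromagnetic Heisenberg Hamiltonian $$H_\Lambda=\sum_{\langle x,y\rangle\subset\Lambda}\bigl(S^2-\vec S_x\cdot\vec S_y\bigr)\quad\text{on}\quad\bigotimes_{x\in\Lambda}\mathbb C^{2S+1},$$ where each unordered pair $\langle x,y\rangle$ of nearest neighbours in $\Lambda$ is counted once, and for $\beta>0$ let $$f^{\rm 2d}_\Lambda(\beta,S)=-\frac1{\beta|\Lambda|}\ln\operatorname{Tr}e^{-\beta H_\Lambda},\qquad f^{\rm 2d}(\beta,S)=\lim_{L\to\infty}f^{\rm 2d}_{[1,L]^2}(\beta,S).$$ The limit exists for all such $S$ and all $\beta>0$. Let $C_2=-\frac{\zeta(2)}{4\pi}=-\frac{\pi}{24}$. Then $$f^{\rm 2d}(\beta,S)\le C_2S^{-1}\beta^{-2}\Bigl(1-\mathcal O\bigl((\beta S)^{-1/3}(\ln\beta S)^{2/3}\bigr)\Bigr)\qquad\text{as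 }\beta S\to\infty,$$ uniformly in $S$; that is, there are universal constants $C>0$ and $R>1$ such that for all $S\in\{\tfrac12,1,\tfrac32,\dots\}$ and all $\beta>0$ with $\beta S\ge R$, $$f^{\rm 2d}(\beta,S)\le C_2S^{-1}\beta^{-2}\Bigl(1-C(\beta S)^{-1/3}(\ln\beta S)^{2/3}\Bigr).$$ -/

import Mathlib

open Filter Topology

noncomputable section

namespace Heisenberg2D

/-! Spin `S = N / 2` with `N ≥ 1` a natural number.  The one-site space `ℂ ^ (2S+1)` has the
orthonormal basis `|0⟩, …, |N⟩` of eigenvectors of the third spin component, where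
`S³ |n⟩ = (n - S) |n⟩`. -/

/-- The raising operator `S⁺` of the spin `N / 2` representation:
`S⁺ |n⟩ = √((n + 1) (N - n)) |n + 1⟩`. -/
def spinPlus (N : ℕ) : Matrix (Fin (N + 1)) (Fin (N + 1)) ℂ :=
  fun i j => if (i : ℕ) = j + 1 then ((Real.sqrt (((j : ℝ) + 1) * ((N : ℝ) - j)) : ℝ) : ℂ) else 0

/-- The lowering operator `S⁻`, the adjoint of `S⁺`. -/
def spinMinus (N : ℕ) : Matrix (Fin (N + 1)) (Fin (N + 1)) ℂ :=
  (spinPlus N).conjTranspose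

/-- The spin components `S¹`, `S²`, `S³` (for the indices `0`, `1`, `2`), with
`S^± = S¹ ± i S²`. -/
def spin (N : ℕ) : Fin 3 → Matrix (Fin (N + 1)) (Fin (N + 1)) ℂ :=
  ![(1 / 2 : ℂ) • (spinPlus N + spinMinus N),
    (1 / (2 * Complex.I) : ℂ) • (spinPlus N - spinMinus N),
    Matrix.diagonal fun n => (n : ℂ) - (N : ℂ) / 2]

/-- Basis configurations of the Hilbert space `⨂_{x ∈ Λ} ℂ ^ (2S+1)`. -/
abbrev Config (N : ℕ) (Λ : Finset (ℤ × ℤ)) : Type :=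
  Λ → Fin (N + 1)

/-- The operator on `⨂_{x ∈ Λ} ℂ ^ (2S+1)` that acts as `A` on the factor at `x` and as the
identity on all the others, in the product basis. -/
def siteOp (N : ℕ) (Λ : Finset (ℤ × ℤ)) (x : Λ) (A : Matrix (Fin (N + 1)) (Fin (N + 1)) ℂ) :
    Matrix (Config N Λ) (Config N Λ) ℂ :=
  fun σ τ => ∏ y : Λ, (if y = x then A else 1) (σ y) (τ y)

/-- The scalar product `S_x · S_y` of the spins at `x` and `y`. -/
def spinDot (N : ℕ) (Λ : Finset (ℤ × ℤ)) (x y : Λ) : Matrix (Config N Λ) (Config N Λ) ℂ :=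
  ∑ k : Fin 3, siteOp N Λ x (spin N k) * siteOp N Λ y (spin N k)

/-- The Hamiltonian `H_Λ = ∑_{⟨x,y⟩ ⊂ Λ} (S² - S_x · S_y)`.  Every unordered pair of nearest
neighbours in `ℤ²` occurs exactly once, as `(x, y)` with `y = x + (1,0)` or `y = x + (0,1)`. -/
def hamiltonian (N : ℕ) (Λ : Finset (ℤ × ℤ)) : Matrix (Config N Λ) (Config N Λ) ℂ :=
  ∑ x : Λ, ∑ y : Λ,
    if (y : ℤ × ℤ) = (x : ℤ × ℤ) + (1, 0) ∨ (y : ℤ × ℤ) = (x : ℤ × ℤ) + (0, 1) then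
      (((N : ℂ) / 2) ^ 2) • (1 : Matrix (Config N Λ) (Config N Λ) ℂ) - spinDot N Λ x y
    else 0

/-- The partition function `Tr e^{-β H_Λ}` (a positive real number, as `H_Λ` is Hermitian). -/
def partitionFunction (N : ℕ) (Λ : Finset (ℤ × ℤ)) (β : ℝ) : ℝ :=
  (Matrix.trace (NormedSpace.exp ((-(β : ℂ)) • hamiltonian N Λ))).re

/-- The specific free energy `f_Λ(β, S) = - (β |Λ|)⁻¹ ln Tr e^{-β H_Λ}`. -/
def finiteFreeEnergy (N : ℕ) (Λ : Finset (ℤ × ℤ)) (β : ℝ) : ℝ :=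
  -(1 / (β * (Λ.card : ℝ))) * Real.log (partitionFunction N Λ β)

/-- The square `[1, L]²` in `ℤ²`. -/
def square (L : ℕ) : Finset (ℤ × ℤ) :=
  Finset.Icc (1 : ℤ) L ×ˢ Finset.Icc (1 : ℤ) L

/-- The thermodynamic limit of the specific free energy, along squares of side length `L → ∞`. -/
def freeEnergy (N : ℕ) (β : ℝ) : ℝ :=
  limUnder atTop fun L : ℕ => finiteFreeEnergy N (square L) β

/-- The constant `C₂ = - ζ(2) / (4π)`; the value `ζ(2)` is real. -/
def C₂ : ℝ := -(riemannZeta 2).re / (4 * Real.pi)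

end Heisenberg2D

end

/-! Write b = βS. At low temperature the excitations of the ferromagnet are magnons, almost free
bosons with energy about S|k|². The ideal Bose gas on the plane has free energy density β⁻¹ ∫ log(1
- exp(-b|k|²)) d²k/(2π)² = -ζ(2)/(4πbβ), which is the claimed leading term. An upper bound on f is a
lower bound on Tr exp(-βH), so trial states suffice.

Localization. Every bond operator is positive and annihilates the vacuum (all spins down). Dropping
bonds therefore raises the partition function, which makes log Z subadditive over blocks and gives
the thermodynamic limit. In the other direction, compressing to states with vacuum on the walls of a
grid lowers the partition function and turns each bond into a wall into a field S n_x. Hence f is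
bounded by the free energy of a single box with Dirichlet boundary (`freeEnergy_le`).

Trial states. Bosons are modelled by real polynomials with the Fock inner product, and z^α is sent
to ∏ (S⁺_x/√(2S))^(α_x) applied to the vacuum. This map is a contraction, and the bond operator,
written as T*T/2, acts on its image through ∂_x F - ∂_y F times a factor that only lowers the energy
(`bondOp_energy_le`). So the energy of a trial state is at most that of free bosons. A Peierls
inequality for families that merely satisfy Bessel's inequality (`peierls`, `spinVec_bessel`) makes
the lack of orthogonality harmless. The only price is the loss of norm, controlled by the two-body
density (`le_vecNormSq_fockState`): if it is at most δ, then β is replaced by β/(1 - δ). Markov's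
inequality allows a cap on the total boson number at the cost of a factor 2 (`bose_partition_le`).

Counting. In a box of side ℓ the mean number of bosons is at most of order ℓ² log ℓ / b, the
logarithm being that of two dimensions, so δ is of order (ℓ log ℓ / b)². Comparison with Gaussian
integrals evaluates the ideal gas with relative boundary error √b/ℓ (`le_sum_neg_log`). Taking ℓ of
order √b / r with r = b^(-1/3) (log b)^(2/3) makes both errors of order r. Uniformity in S holds
because the factor 1/(2S) in the norm loss is simply bounded by 1. -/

set_option linter.unusedSectionVars false

noncomputable section

namespace Heisenberg2D

open Matrix
open scoped Kronecker ComplexOrder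

/-! ### Peierls inequality and comparison of traces of exponentials -/

section TraceExp

variable {n n' : Type*} [Fintype n] [DecidableEq n] [Fintype n'] [DecidableEq n']

/-- The real part of `Tr e^A`. -/
def trExp (A : Matrix n n ℂ) : ℝ := (trace (NormedSpace.exp A)).re

lemma exists_diagonalization {A : Matrix n n ℂ} (hA : A.IsHermitian) :
    ∃ U : Matrix n n ℂ, IsUnit U ∧
      A = U * diagonal (fun k => (hA.eigenvalues k : ℂ)) * U⁻¹ := by
  have h := hA.spectral_theorem
  rw [Unitary.conjStarAlgAut_apply] at h
  set U := hA.eigenvectorUnitary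
  have hinv : (star (U : Matrix n n ℂ)) = (U : Matrix n n ℂ)⁻¹ := by
    symm; apply Matrix.inv_eq_left_inv; simp
  refine ⟨U, ?_, by rw [← hinv]; exact h⟩
  rw [Matrix.isUnit_iff_isUnit_det]
  apply Matrix.isUnit_det_of_left_inverse (B := star (U : Matrix n n ℂ)); simp

lemma trExp_conj_diagonal {U : Matrix n n ℂ} (hU : IsUnit U) (d : n → ℝ) :
    trExp (U * diagonal (fun k => (d k : ℂ)) * U⁻¹) = ∑ k, Real.exp (d k) := by
  unfold trExp
  rw [Matrix.exp_conj _ _ hU, Matrix.trace_mul_comm, ← mul_assoc, Matrix.nonsing_inv_mul _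
    ((Matrix.isUnit_iff_isUnit_det _).mp hU), one_mul, Matrix.exp_diagonal,
    Matrix.trace_diagonal, Complex.re_sum]
  refine Finset.sum_congr rfl fun k _ => ?_
  rw [Pi.coe_exp]
  simp [← Complex.exp_eq_exp_ℂ, ← Complex.ofReal_exp]

lemma trExp_eq_sum_eigenvalues {A : Matrix n n ℂ} (hA : A.IsHermitian) :
    trExp A = ∑ k, Real.exp (hA.eigenvalues k) := by
  obtain ⟨U, hU, h⟩ := exists_diagonalization hA
  conv_lhs => rw [h]
  exact trExp_conj_diagonal hU _

lemma star_dotProduct_star' (v w : n → ℂ) : star v ⬝ᵥ star w = star (v ⬝ᵥ w) := by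
  simp [dotProduct]

/-- The squared norm of a vector. -/
def vecNormSq (v : n → ℂ) : ℝ := ∑ k, ‖v k‖ ^ 2

lemma vecNormSq_eq (v : n → ℂ) : ((vecNormSq v : ℝ) : ℂ) = star v ⬝ᵥ v := by
  simp [vecNormSq, dotProduct, ← Complex.conj_mul', mul_comm]

/-- The `k`-th eigenvector of a Hermitian matrix. -/
def eigvec {A : Matrix n n ℂ} (hA : A.IsHermitian) (k : n) : n → ℂ := (hA.eigenvectorBasis k).ofLp

lemma eigvec_ortho {A : Matrix n n ℂ} (hA : A.IsHermitian) (j k : n) :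
    star (eigvec hA j) ⬝ᵥ eigvec hA k = if j = k then 1 else 0 := by
  have := orthonormal_iff_ite.mp hA.eigenvectorBasis.orthonormal j k
  rw [EuclideanSpace.inner_eq_star_dotProduct, dotProduct_comm] at this
  exact this

lemma vecNormSq_eigvec {A : Matrix n n ℂ} (hA : A.IsHermitian) (k : n) :
    vecNormSq (eigvec hA k) = 1 := by
  have := vecNormSq_eq (eigvec hA k)
  rw [eigvec_ortho, if_pos rfl] at this
  exact_mod_cast this

lemma mulVec_eigvec {A : Matrix n n ℂ} (hA : A.IsHermitian) (k : n) :
    A *ᵥ eigvec hA k = (hA.eigenvalues k : ℂ) • eigvec hA k := by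
  have := hA.mulVec_eigenvectorBasis k
  simpa [eigvec] using this

lemma sum_eigvec_coeff {A : Matrix n n ℂ} (hA : A.IsHermitian) (v : n → ℂ) :
    ∑ k, ‖star (eigvec hA k) ⬝ᵥ v‖ ^ 2 = vecNormSq v := by
  have := hA.eigenvectorBasis.sum_sq_norm_inner_right (WithLp.toLp 2 v)
  rw [EuclideanSpace.norm_sq_eq] at this
  rw [vecNormSq, ← this]
  refine Finset.sum_congr rfl fun k _ => ?_
  rw [EuclideanSpace.inner_eq_star_dotProduct, dotProduct_comm]; rfl

lemma expand_eigvec {A : Matrix n n ℂ} (hA : A.IsHermitian) (v : n → ℂ) :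
    v = ∑ k, (star (eigvec hA k) ⬝ᵥ v) • eigvec hA k := by
  have := hA.eigenvectorBasis.sum_repr' (WithLp.toLp 2 v)
  have h2 := congrArg WithLp.ofLp this
  rw [WithLp.ofLp_sum] at h2
  refine h2.symm.trans (Finset.sum_congr rfl fun k _ => ?_)
  rw [EuclideanSpace.inner_eq_star_dotProduct, dotProduct_comm]; rfl

lemma quadratic_eigvec {A : Matrix n n ℂ} (hA : A.IsHermitian) (v : n → ℂ) :
    (star v ⬝ᵥ A *ᵥ v).re = ∑ k, ‖star (eigvec hA k) ⬝ᵥ v‖ ^ 2 * hA.eigenvalues k := by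
  have h1 : A *ᵥ v = ∑ k, (star (eigvec hA k) ⬝ᵥ v) • (hA.eigenvalues k : ℂ) • eigvec hA k := by
    conv_lhs => rw [expand_eigvec hA v]
    rw [mulVec_sum]
    simp only [mulVec_smul, mulVec_eigvec]
  rw [h1, dotProduct_sum, Complex.re_sum]
  refine Finset.sum_congr rfl fun k _ => ?_
  have h2 : star v ⬝ᵥ eigvec hA k = star (star (eigvec hA k) ⬝ᵥ v) := by
    rw [← star_dotProduct_star', star_star]
    exact dotProduct_comm _ _
  rw [dotProduct_smul, dotProduct_smul, h2, smul_eq_mul, smul_eq_mul, mul_left_comm]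
  generalize star (eigvec hA k) ⬝ᵥ v = z
  rw [← starRingEnd_apply, Complex.mul_conj', mul_comm]
  norm_cast

/-- Jensen's inequality for exp, with the spectral weights of Ψ i as probabilities after division by
the squared norm, bounds each term by ⟨Ψ i, e^A Ψ i⟩. Summing over i and using Bessel at each
eigenvector bounds the total weight at every eigenvalue by 1. Neither orthogonality nor
normalization is needed, which is what the Holstein–Primakoff states require. -/
lemma peierls {I : Type*} {A : Matrix n n ℂ} (hA : A.IsHermitian) (s : Finset I) (Ψ : I → n → ℂ)
    (hΨ : ∀ χ : n → ℂ, ∑ i ∈ s, ‖star χ ⬝ᵥ Ψ i‖ ^ 2 ≤ vecNormSq χ) :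
    ∑ i ∈ s, vecNormSq (Ψ i) * Real.exp ((star (Ψ i) ⬝ᵥ A *ᵥ Ψ i).re / vecNormSq (Ψ i)) ≤
      trExp A := by
  rw [trExp_eq_sum_eigenvalues hA]
  calc _ ≤ ∑ i ∈ s, ∑ k, ‖star (eigvec hA k) ⬝ᵥ Ψ i‖ ^ 2 * Real.exp (hA.eigenvalues k) := by
        refine Finset.sum_le_sum fun i _ => ?_
        rw [quadratic_eigvec hA, ← sum_eigvec_coeff hA (Ψ i)]
        set c : n → ℝ := fun k => ‖star (eigvec hA k) ⬝ᵥ Ψ i‖ ^ 2 with hc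
        change (∑ k, c k) * Real.exp ((∑ k, c k * hA.eigenvalues k) / ∑ k, c k) ≤
          ∑ k, c k * Real.exp (hA.eigenvalues k)
        have hc0 : ∀ k, 0 ≤ c k := fun k => by positivity
        -- A null vector contributes 0: its weight vanishes, whatever value the division by zero
        -- takes.
        rcases (Finset.sum_nonneg fun k (_ : k ∈ Finset.univ) => hc0 k).eq_or_lt with h0 | h0
        · rw [← h0, zero_mul]
          exact Finset.sum_nonneg fun k _ => mul_nonneg (hc0 k) (Real.exp_pos _).le
        · have := convexOn_exp.map_centerMass_le (t := Finset.univ) (w := c)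
            (p := hA.eigenvalues) (fun k _ => hc0 k) h0 (fun _ _ => Set.mem_univ _)
          simp only [Finset.centerMass, smul_eq_mul] at this
          rw [inv_mul_eq_div, inv_mul_eq_div, le_div_iff₀ h0] at this
          simpa [mul_comm] using this
    _ = ∑ k, (∑ i ∈ s, ‖star (eigvec hA k) ⬝ᵥ Ψ i‖ ^ 2) * Real.exp (hA.eigenvalues k) := by
        rw [Finset.sum_comm]; simp [Finset.sum_mul]
    _ ≤ ∑ k, 1 * Real.exp (hA.eigenvalues k) := by
        gcongr with k
        simpa [vecNormSq_eigvec] using hΨ (eigvec hA k)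
    _ = _ := by simp

/-- The eigenvectors of `A'`, extended by zero, are trial states for `A` whose energies are at least
the eigenvalues of `A'`. One statement covers restriction to a coordinate subspace, relabelling of
the basis and operator monotonicity. -/
lemma trExp_le_of_submatrix {A : Matrix n n ℂ} {A' : Matrix n' n' ℂ} (hA : A.IsHermitian)
    (hA' : A'.IsHermitian) (e : n' → n) (he : Function.Injective e)
    (h : (A.submatrix e e - A').PosSemidef) : trExp A' ≤ trExp A := by
  classical
  set Ψ : n' → n → ℂ := fun k => Function.extend e (eigvec hA' k) 0 with hΨ
  have hdot : ∀ (χ : n → ℂ) (v : n' → ℂ),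
      χ ⬝ᵥ Function.extend e v 0 = (fun j => χ (e j)) ⬝ᵥ v := by
    intro χ v
    simp only [dotProduct]
    symm
    refine Fintype.sum_of_injective e he _ _ (fun x hx => ?_) (fun j => by rw [he.extend_apply])
    rw [Function.extend_apply' _ _ _ (by simpa using hx), Pi.zero_apply, mul_zero]
  have hn : ∀ v : n' → ℂ, vecNormSq (Function.extend e v 0) = vecNormSq v := by
    intro v
    have : ((vecNormSq (Function.extend e v 0) : ℝ) : ℂ) = (vecNormSq v : ℝ) := by
      rw [vecNormSq_eq, vecNormSq_eq, hdot]
      congr 1; ext j; simp [he.extend_apply]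
    exact_mod_cast this
  have hq : ∀ v : n' → ℂ, star (Function.extend e v 0) ⬝ᵥ A *ᵥ (Function.extend e v 0) =
      star v ⬝ᵥ (A.submatrix e e) *ᵥ v := by
    intro v
    rw [Matrix.dotProduct_mulVec, hdot]
    rw [Matrix.dotProduct_mulVec]
    congr 1; ext j
    simp only [vecMul]
    rw [dotProduct_comm]
    have : star (Function.extend e v 0) = Function.extend e (star v) 0 := by
      ext i
      by_cases hi : ∃ a, e a = i
      · obtain ⟨a, rfl⟩ := hi; simp [he.extend_apply]
      · simp [Function.extend_apply' _ _ _ hi]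
    rw [this, hdot, dotProduct_comm]; rfl
  have hP := peierls hA Finset.univ Ψ (fun χ => by
    have : ∀ k, star χ ⬝ᵥ Ψ k = star (star (eigvec hA' k) ⬝ᵥ (fun j => χ (e j))) := by
      intro k
      rw [hΨ, hdot, ← star_dotProduct_star', star_star]; exact dotProduct_comm _ _
    simp only [this, norm_star]
    rw [sum_eigvec_coeff]
    unfold vecNormSq
    rw [← Finset.sum_image (s := Finset.univ) (g := e) (f := fun i => ‖χ i‖ ^ 2) he.injOn]
    exact Finset.sum_le_sum_of_subset_of_nonneg (Finset.subset_univ _) fun _ _ _ => by positivity)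
  refine le_trans ?_ hP
  rw [trExp_eq_sum_eigenvalues hA']
  refine Finset.sum_le_sum fun k _ => ?_
  simp only [hΨ]
  rw [hn, vecNormSq_eigvec, one_mul, div_one, hq]
  apply Real.exp_le_exp.mpr
  have h1 := h.dotProduct_mulVec_nonneg (eigvec hA' k)
  rw [sub_mulVec, dotProduct_sub, mulVec_eigvec, dotProduct_smul, eigvec_ortho] at h1
  have := (Complex.le_def.mp h1).1
  simp at this
  linarith

/-- Simultaneous diagonalization by U ⊗ V: eigenvalues of non-interacting parts add. -/
lemma trExp_kronecker {A : Matrix n n ℂ} {B : Matrix n' n' ℂ} (hA : A.IsHermitian)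
    (hB : B.IsHermitian) :
    trExp (A ⊗ₖ (1 : Matrix n' n' ℂ) + (1 : Matrix n n ℂ) ⊗ₖ B) = trExp A * trExp B := by
  obtain ⟨U, hU, h⟩ := exists_diagonalization hA
  obtain ⟨V, hV, h'⟩ := exists_diagonalization hB
  have hU' := (Matrix.isUnit_iff_isUnit_det _).mp hU
  have hV' := (Matrix.isUnit_iff_isUnit_det _).mp hV
  have hinv : (U ⊗ₖ V) * (U⁻¹ ⊗ₖ V⁻¹) = 1 := by
    rw [← mul_kronecker_mul, Matrix.mul_nonsing_inv _ hU', Matrix.mul_nonsing_inv _ hV',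
      one_kronecker_one]
  have hW : IsUnit (U ⊗ₖ V) := by
    rw [Matrix.isUnit_iff_isUnit_det]
    exact Matrix.isUnit_det_of_right_inverse hinv
  have key : A ⊗ₖ (1 : Matrix n' n' ℂ) + (1 : Matrix n n ℂ) ⊗ₖ B = (U ⊗ₖ V) *
      diagonal (fun k : n × n' => ((hA.eigenvalues k.1 + hB.eigenvalues k.2 : ℝ) : ℂ)) *
        (U ⊗ₖ V)⁻¹ := by
    rw [Matrix.inv_eq_right_inv hinv]
    have hd : diagonal (fun k : n × n' => ((hA.eigenvalues k.1 + hB.eigenvalues k.2 : ℝ) : ℂ)) =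
        diagonal (fun k => (hA.eigenvalues k : ℂ)) ⊗ₖ (1 : Matrix n' n' ℂ) +
        (1 : Matrix n n ℂ) ⊗ₖ diagonal (fun k => (hB.eigenvalues k : ℂ)) := by
      rw [← diagonal_one, ← diagonal_one, diagonal_kronecker_diagonal,
        diagonal_kronecker_diagonal, diagonal_add]
      simp
    rw [hd, mul_add, add_mul, ← mul_kronecker_mul, ← mul_kronecker_mul, ← mul_kronecker_mul,
      ← mul_kronecker_mul, ← h, ← h', mul_one, mul_one, Matrix.mul_nonsing_inv _ hU',
      Matrix.mul_nonsing_inv _ hV']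
  rw [key, trExp_conj_diagonal hW, trExp_eq_sum_eigenvalues hA, trExp_eq_sum_eigenvalues hB,
    Finset.sum_mul_sum, Fintype.sum_prod_type]
  simp [Real.exp_add]

lemma trExp_submatrix_equiv {A : Matrix n n ℂ} (hA : A.IsHermitian) (e : n' ≃ n) :
    trExp (A.submatrix e e) = trExp A := by
  apply le_antisymm
  · exact trExp_le_of_submatrix hA (hA.submatrix e) e e.injective (by simp [PosSemidef.zero])
  · exact trExp_le_of_submatrix (hA.submatrix e) hA e.symm e.symm.injective
      (by simp [PosSemidef.zero])

lemma trExp_mono {A B : Matrix n n ℂ} (hA : A.IsHermitian) (hB : B.IsHermitian)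
    (h : (B - A).PosSemidef) : trExp A ≤ trExp B :=
  trExp_le_of_submatrix hB hA id Function.injective_id (by simpa using h)

end TraceExp

end Heisenberg2D

end

noncomputable section

namespace Heisenberg2D

open Matrix
open scoped Kronecker ComplexOrder

/-! ### Operators acting on one or two factors of a tensor power -/

section LocalOperators

variable {ι : Type*} [Fintype ι] [DecidableEq ι] {X : Type*} [Fintype X] [DecidableEq X]

/-- The operator `⨂ A_y` on a product of copies of `ℂ ^ X`. -/
def productOp (A : ι → Matrix X X ℂ) : Matrix (ι → X) (ι → X) ℂ :=
  fun σ τ => ∏ y, A y (σ y) (τ y)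

/-- The operator acting as `A` on the factor at `x`. -/
def localOp (x : ι) (A : Matrix X X ℂ) : Matrix (ι → X) (ι → X) ℂ :=
  fun σ τ => ∏ y, (if y = x then A else 1) (σ y) (τ y)

lemma localOp_eq_productOp (x : ι) (A : Matrix X X ℂ) :
    localOp x A = productOp fun y => if y = x then A else 1 := rfl

lemma productOp_mul (A B : ι → Matrix X X ℂ) :
    productOp A * productOp B = productOp fun y => A y * B y := by
  ext σ τ
  simp only [mul_apply, productOp, ← Finset.prod_mul_distrib]
  rw [Finset.prod_univ_sum, Fintype.piFinset_univ]

lemma productOp_one : productOp (fun _ : ι => (1 : Matrix X X ℂ)) = 1 := by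
  ext σ τ
  simp only [productOp, one_apply]
  rw [Finset.prod_ite_zero]
  simp [funext_iff]

lemma productOp_conjTranspose (A : ι → Matrix X X ℂ) :
    (productOp A)ᴴ = productOp fun y => (A y)ᴴ := by
  ext σ τ
  simp [productOp, conjTranspose_apply]

lemma localOp_apply (x : ι) (A : Matrix X X ℂ) (σ τ : ι → X) :
    localOp x A σ τ =
      A (σ x) (τ x) * ∏ y ∈ Finset.univ.erase x, (1 : Matrix X X ℂ) (σ y) (τ y) := by
  rw [localOp, ← Finset.mul_prod_erase _ _ (Finset.mem_univ x), if_pos rfl]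
  congr 1
  exact Finset.prod_congr rfl fun y hy => by rw [if_neg (Finset.ne_of_mem_erase hy)]

lemma localOp_add (x : ι) (A B : Matrix X X ℂ) : localOp x (A + B) = localOp x A + localOp x B := by
  ext σ τ; simp [localOp_apply, add_mul]

lemma localOp_sub (x : ι) (A B : Matrix X X ℂ) : localOp x (A - B) = localOp x A - localOp x B := by
  ext σ τ; simp [localOp_apply, sub_mul]

lemma localOp_smul (x : ι) (c : ℂ) (A : Matrix X X ℂ) : localOp x (c • A) = c • localOp x A := by
  ext σ τ; simp [localOp_apply, mul_assoc]

lemma localOp_one (x : ι) : localOp x (1 : Matrix X X ℂ) = 1 := by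
  rw [localOp_eq_productOp, ← productOp_one]; simp

lemma localOp_mul (x : ι) (A B : Matrix X X ℂ) : localOp x A * localOp x B = localOp x (A * B) := by
  rw [localOp_eq_productOp, localOp_eq_productOp, productOp_mul, localOp_eq_productOp]
  congr 1; ext1 y; split_ifs <;> simp

lemma localOp_comm {x y : ι} (hxy : x ≠ y) (A B : Matrix X X ℂ) :
    localOp x A * localOp y B = localOp y B * localOp x A := by
  simp only [localOp_eq_productOp, productOp_mul]
  congr 1; ext1 z
  by_cases hx : z = x
  · have : z ≠ y := fun h => hxy (hx ▸ h)
    simp [this]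
  · simp [hx]

lemma localOp_conjTranspose (x : ι) (A : Matrix X X ℂ) : (localOp x A)ᴴ = localOp x Aᴴ := by
  rw [localOp_eq_productOp, productOp_conjTranspose, localOp_eq_productOp]
  congr 1; ext1 y; split_ifs <;> simp

lemma localOp_mulVec (x : ι) (A : Matrix X X ℂ) (v : (ι → X) → ℂ) (σ : ι → X) :
    (localOp x A *ᵥ v) σ = ∑ b, A (σ x) b * v (Function.update σ x b) := by
  simp only [mulVec, dotProduct]
  symm
  refine Fintype.sum_of_injective (fun b => Function.update σ x b)
    (Function.update_injective σ x) _ _ (fun τ hτ => ?_) (fun b => ?_)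
  · rw [localOp_apply]
    have : ∃ y ∈ Finset.univ.erase x, σ y ≠ τ y := by
      by_contra! h
      refine hτ ⟨τ x, ?_⟩
      ext1 y
      by_cases hy : y = x
      · subst hy; simp
      · simpa [hy] using h y (by simp [hy])
    obtain ⟨y, hy, hne⟩ := this
    have h0 : ∏ y ∈ Finset.univ.erase x, (1 : Matrix X X ℂ) (σ y) (τ y) = 0 :=
      Finset.prod_eq_zero hy (one_apply_ne hne)
    rw [h0]; simp
  · rw [localOp_apply, Finset.prod_eq_one]
    · simp
    · intro y hy
      rw [Function.update_of_ne (Finset.ne_of_mem_erase hy), one_apply_eq]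

/-- The operator `A ⊗ B` on the factors at `x` and `y`. -/
def pairOp (x y : ι) (A B : Matrix X X ℂ) : Matrix (ι → X) (ι → X) ℂ := localOp x A * localOp y B

lemma pairOp_mul {x y : ι} (hxy : x ≠ y) (A B A' B' : Matrix X X ℂ) :
    pairOp x y A B * pairOp x y A' B' = pairOp x y (A * A') (B * B') := by
  simp only [pairOp]
  rw [← localOp_mul, ← localOp_mul, mul_assoc, ← mul_assoc (localOp y B),
    ← localOp_comm hxy A' B]
  simp only [mul_assoc]

lemma pairOp_conjTranspose {x y : ι} (hxy : x ≠ y) (A B : Matrix X X ℂ) :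
    (pairOp x y A B)ᴴ = pairOp x y Aᴴ Bᴴ := by
  simp only [pairOp, conjTranspose_mul, localOp_conjTranspose]
  exact (localOp_comm hxy _ _).symm

end LocalOperators

/-! ### One spin in bosonic notation: S⁺ = a* √(N - n), S⁻ = √(N - n) a -/

section SingleSite

variable (N : ℕ)

/-- The particle number `diag (0, …, N)` on one site. -/
def numberMat : Matrix (Fin (N + 1)) (Fin (N + 1)) ℂ := diagonal fun n => ((n : ℕ) : ℂ)

/-- The truncated bosonic annihilation operator `|n⟩ ↦ √n |n - 1⟩`. -/
def annihMat : Matrix (Fin (N + 1)) (Fin (N + 1)) ℂ :=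
  fun i j => if (j : ℕ) = i + 1 then ((Real.sqrt ((i : ℝ) + 1) : ℝ) : ℂ) else 0

/-- The diagonal operator `√(N - n)`. -/
def holeMat : Matrix (Fin (N + 1)) (Fin (N + 1)) ℂ :=
  diagonal fun n => ((Real.sqrt ((N : ℝ) - (n : ℕ)) : ℝ) : ℂ)

lemma holeMat_conjTranspose : (holeMat N)ᴴ = holeMat N := by
  simp only [holeMat, diagonal_conjTranspose]
  congr 1; ext n; simp

lemma holeMat_mul_self : holeMat N * holeMat N = (N : ℂ) • 1 - numberMat N := by
  rw [holeMat, diagonal_mul_diagonal, numberMat, smul_one_eq_diagonal, diagonal_sub]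
  congr 1; ext n
  rw [← Complex.ofReal_mul, Real.mul_self_sqrt]
  · simp
  · have := n.is_le
    have : ((n : ℕ) : ℝ) ≤ N := by exact_mod_cast this
    linarith

lemma annihMat_conjTranspose_mul_self : (annihMat N)ᴴ * annihMat N = numberMat N := by
  ext i j
  simp only [mul_apply, conjTranspose_apply, annihMat, numberMat, diagonal_apply]
  rcases Nat.eq_zero_or_pos (i : ℕ) with hi | hi
  · rw [Finset.sum_eq_zero]
    · split_ifs <;> simp [hi]
    · intro k _
      rw [if_neg (by omega)]; simp
  · have hk : (i : ℕ) - 1 < N + 1 := by have := i.is_lt; omega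
    rw [Finset.sum_eq_single ⟨(i : ℕ) - 1, hk⟩]
    · have h1 : (i : ℕ) = ((i : ℕ) - 1) + 1 := by omega
      simp only
      rw [if_pos h1]
      by_cases hij : i = j
      · subst hij
        rw [if_pos h1, if_pos rfl]
        have h2 : (((i : ℕ) - 1 : ℕ) : ℝ) + 1 = (i : ℕ) := by exact_mod_cast h1.symm
        rw [h2, ← starRingEnd_apply, Complex.conj_ofReal, ← Complex.ofReal_mul,
          Real.mul_self_sqrt (by positivity)]
        simp
      · rw [if_neg hij, if_neg, mul_zero]
        intro h; apply hij; ext; omega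
    · intro k _ hk'
      rw [if_neg, star_zero, zero_mul]
      intro h; apply hk'; ext; simp; omega
    · simp

lemma annihMat_conjTranspose_mul_holeMat : (annihMat N)ᴴ * holeMat N = spinPlus N := by
  ext i j
  rw [holeMat, mul_diagonal, conjTranspose_apply, annihMat, spinPlus]
  split_ifs
  · rw [Real.sqrt_mul (by positivity), ← starRingEnd_apply, Complex.conj_ofReal, Complex.ofReal_mul]
  · simp

lemma holeMat_mul_annihMat : holeMat N * annihMat N = spinMinus N := by
  rw [spinMinus, ← annihMat_conjTranspose_mul_holeMat, conjTranspose_mul,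
    conjTranspose_conjTranspose, holeMat_conjTranspose]

lemma spin_two : spin N 2 = numberMat N - ((N : ℂ) / 2) • 1 := by
  rw [numberMat, smul_one_eq_diagonal, diagonal_sub]; rfl

end SingleSite

/-! ### Bond operators and general spin Hamiltonians -/

section SpinSystem

variable {ι : Type*} [Fintype ι] [DecidableEq ι] (N : ℕ)

/-- The ferromagnetic interaction `S² - S_x · S_y`. -/
def bondOp (x y : ι) : Matrix (ι → Fin (N + 1)) (ι → Fin (N + 1)) ℂ :=
  (((N : ℂ) / 2) ^ 2) • 1 - ∑ k : Fin 3, pairOp x y (spin N k) (spin N k)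

/-- The singlet annihilator `√(N - n_x) a_y - a_x √(N - n_y)`. -/
def singletOp (x y : ι) : Matrix (ι → Fin (N + 1)) (ι → Fin (N + 1)) ℂ :=
  pairOp x y (holeMat N) (annihMat N) - pairOp x y (annihMat N) (holeMat N)

/-- Expanding T*T gives (N - n_x) n_y + n_x (N - n_y) minus the two spin-flip terms. The diagonal
part is twice S² - S³_x S³_y because S³ = n - N/2. The factorization gives positivity here and,
later, the energy of the trial states. -/
lemma bondOp_eq {x y : ι} (hxy : x ≠ y) :
    bondOp N x y = (1 / 2 : ℂ) • ((singletOp N x y)ᴴ * singletOp N x y) := by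
  have h1 : (singletOp N x y)ᴴ * singletOp N x y =
      pairOp x y ((N : ℂ) • 1 - numberMat N) (numberMat N) -
        pairOp x y (spinMinus N) (spinPlus N) - pairOp x y (spinPlus N) (spinMinus N) +
        pairOp x y (numberMat N) ((N : ℂ) • 1 - numberMat N) := by
    simp only [singletOp, conjTranspose_sub, pairOp_conjTranspose hxy, sub_mul, mul_sub,
      pairOp_mul hxy, holeMat_conjTranspose, holeMat_mul_self, annihMat_conjTranspose_mul_self,
      holeMat_mul_annihMat, annihMat_conjTranspose_mul_holeMat]
    abel
  have h2 : (1 / (2 * Complex.I)) * (1 / (2 * Complex.I)) = -(1 / 4 : ℂ) := by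
    rw [div_mul_div_comm, mul_mul_mul_comm, Complex.I_mul_I]; norm_num
  rw [h1, bondOp, Fin.sum_univ_three, spin_two]
  have h3 : spin N 0 = (1 / 2 : ℂ) • (spinPlus N + spinMinus N) := rfl
  have h4 : spin N 1 = (1 / (2 * Complex.I) : ℂ) • (spinPlus N - spinMinus N) := rfl
  have h5 : pairOp x y (spin N 1) (spin N 1) =
      (-(1 / 4 : ℂ)) • pairOp x y (spinPlus N - spinMinus N) (spinPlus N - spinMinus N) := by
    rw [h4, pairOp, localOp_smul, localOp_smul, smul_mul_smul_comm, h2, pairOp]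
  rw [h5, h3]
  simp only [pairOp, localOp_smul, localOp_sub, localOp_add, localOp_one, smul_mul_assoc,
    mul_smul_comm, sub_mul, mul_sub, add_mul, mul_add, one_mul, mul_one]
  module

lemma bondOp_posSemidef {x y : ι} (hxy : x ≠ y) : (bondOp N x y).PosSemidef := by
  rw [bondOp_eq N hxy]
  exact (posSemidef_conjTranspose_mul_self _).smul (by positivity)

/-- The number operator at `x`. -/
def numberOp (x : ι) : Matrix (ι → Fin (N + 1)) (ι → Fin (N + 1)) ℂ := localOp x (numberMat N)

lemma numberOp_eq (x : ι) :
    numberOp N x = (localOp x (annihMat N))ᴴ * localOp x (annihMat N) := by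
  rw [localOp_conjTranspose, localOp_mul, annihMat_conjTranspose_mul_self, numberOp]

lemma numberOp_posSemidef (x : ι) : (numberOp N x).PosSemidef := by
  rw [numberOp_eq]
  exact posSemidef_conjTranspose_mul_self _

/-- The Hamiltonian with bond weights `w` and local fields `d`. -/
def systemHam (w : ι → ι → ℝ) (d : ι → ℝ) : Matrix (ι → Fin (N + 1)) (ι → Fin (N + 1)) ℂ :=
  ∑ x, ∑ y, (w x y : ℂ) • bondOp N x y + ∑ x, (d x : ℂ) • numberOp N x

lemma systemHam_posSemidef {w : ι → ι → ℝ} {d : ι → ℝ} (hw : ∀ x y, 0 ≤ w x y)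
    (hw' : ∀ x, w x x = 0) (hd : ∀ x, 0 ≤ d x) : (systemHam N w d).PosSemidef := by
  refine PosSemidef.add (posSemidef_sum _ fun x _ => posSemidef_sum _ fun y _ => ?_)
    (posSemidef_sum _ fun x _ => ?_)
  · by_cases hxy : x = y
    · subst hxy; rw [hw']; simpa using PosSemidef.zero
    · exact (bondOp_posSemidef N hxy).smul (by exact_mod_cast hw x y)
  · exact (numberOp_posSemidef N x).smul (by exact_mod_cast hd x)

lemma systemHam_sub (w w' : ι → ι → ℝ) (d d' : ι → ℝ) :
    systemHam N w d - systemHam N w' d' =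
      systemHam N (fun x y => w x y - w' x y) (fun x => d x - d' x) := by
  simp only [systemHam, Complex.ofReal_sub, sub_smul, Finset.sum_sub_distrib]
  abel

/-- The partition function `Tr e^{-β H}` of the system with bond weights `w` and fields `d`. -/
def systemZ (w : ι → ι → ℝ) (d : ι → ℝ) (β : ℝ) : ℝ := trExp ((-(β : ℂ)) • systemHam N w d)

lemma hamiltonian_eq (Λ : Finset (ℤ × ℤ)) :
    hamiltonian N Λ = systemHam N (fun x y : Λ =>
      if (y : ℤ × ℤ) = (x : ℤ × ℤ) + (1, 0) ∨ (y : ℤ × ℤ) = (x : ℤ × ℤ) + (0, 1) then 1 else 0)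
      (fun _ => 0) := by
  simp only [systemHam, Complex.ofReal_zero, zero_smul, Finset.sum_const_zero, add_zero,
    hamiltonian]
  refine Finset.sum_congr rfl fun x _ => Finset.sum_congr rfl fun y _ => ?_
  split_ifs
  · simp only [Complex.ofReal_one, one_smul]; rfl
  · simp

lemma neg_smul_isHermitian {n : Type*} {A : Matrix n n ℂ} (hA : A.IsHermitian) (β : ℝ) :
    ((-(β : ℂ)) • A).IsHermitian := by
  rw [IsHermitian, conjTranspose_smul, hA.eq]; simp

end SpinSystem

end Heisenberg2D

end

noncomputable section

namespace Heisenberg2D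

open Matrix
open scoped Kronecker ComplexOrder

/-! ### Linearity of submatrices and Kronecker products -/

section MatrixAux

lemma submatrix_sum {m n l o κ : Type*} (s : Finset κ) (f : κ → Matrix m n ℂ) (e : l → m)
    (e' : o → n) : (∑ k ∈ s, f k).submatrix e e' = ∑ k ∈ s, (f k).submatrix e e' := by
  ext i j; simp [Matrix.sum_apply]

lemma sub_kronecker {l m n o : Type*} (A B : Matrix l m ℂ) (C : Matrix n o ℂ) :
    (A - B) ⊗ₖ C = A ⊗ₖ C - B ⊗ₖ C := by
  ext i j; simp [sub_mul]

lemma kronecker_sub {l m n o : Type*} (A B : Matrix l m ℂ) (C : Matrix n o ℂ) :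
    C ⊗ₖ (A - B) = C ⊗ₖ A - C ⊗ₖ B := by
  ext i j; simp [mul_sub]

lemma sum_kronecker {l m n o κ : Type*} (s : Finset κ) (f : κ → Matrix l m ℂ) (C : Matrix n o ℂ) :
    (∑ k ∈ s, f k) ⊗ₖ C = ∑ k ∈ s, f k ⊗ₖ C := by
  ext i j; simp [Matrix.sum_apply, Finset.sum_mul]

lemma kronecker_sum {l m n o κ : Type*} (s : Finset κ) (f : κ → Matrix l m ℂ) (C : Matrix n o ℂ) :
    C ⊗ₖ (∑ k ∈ s, f k) = ∑ k ∈ s, C ⊗ₖ f k := by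
  ext i j; simp [Matrix.sum_apply, Finset.mul_sum]

end MatrixAux

/-! ### Monotonicity in the couplings and invariance under relabelling -/

section Comparison

variable {ι ι' : Type*} [Fintype ι] [DecidableEq ι] [Fintype ι'] [DecidableEq ι'] {N : ℕ}

/-- Nonnegative couplings without self-interaction. -/
structure Admissible (w : ι → ι → ℝ) (d : ι → ℝ) : Prop where
  bond_nonneg : ∀ x y, 0 ≤ w x y
  bond_self : ∀ x, w x x = 0
  field_nonneg : ∀ x, 0 ≤ d x

lemma Admissible.isHermitian {w : ι → ι → ℝ} {d : ι → ℝ} (h : Admissible w d) (β : ℝ) :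
    ((-(β : ℂ)) • systemHam N w d).IsHermitian :=
  neg_smul_isHermitian (systemHam_posSemidef N h.1 h.2 h.3).isHermitian β

lemma systemZ_antitone {w w' : ι → ι → ℝ} {d d' : ι → ℝ} (h : Admissible w d)
    (h' : Admissible w' d') (hw : ∀ x y, w' x y ≤ w x y) (hd : ∀ x, d' x ≤ d x) {β : ℝ}
    (hβ : 0 ≤ β) : systemZ N w d β ≤ systemZ N w' d' β := by
  refine trExp_mono (h.isHermitian β) (h'.isHermitian β) ?_
  have : (-(β : ℂ)) • systemHam N w' d' - (-(β : ℂ)) • systemHam N w d =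
      (β : ℂ) • (systemHam N w d - systemHam N w' d') := by module
  rw [this, systemHam_sub]
  refine (systemHam_posSemidef N (fun x y => sub_nonneg.mpr (hw x y)) (fun x => ?_)
    (fun x => sub_nonneg.mpr (hd x))).smul (by exact_mod_cast hβ)
  rw [h.2, h'.2, sub_zero]

lemma systemZ_zero (β : ℝ) :
    systemZ N (fun _ _ : ι => 0) (fun _ => 0) β = ((N : ℝ) + 1) ^ Fintype.card ι := by
  simp [systemZ, systemHam, trExp, NormedSpace.exp_zero, trace_one]
  norm_cast

lemma localOp_submatrix_equiv {X : Type*} [Fintype X] [DecidableEq X] (e : ι' ≃ ι) (x : ι')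
    (A : Matrix X X ℂ) :
    (localOp (e x) A).submatrix (e.arrowCongr (Equiv.refl X)) (e.arrowCongr (Equiv.refl X)) =
      localOp x A := by
  ext σ τ
  simp only [submatrix_apply, localOp]
  rw [← e.prod_comp]
  refine Finset.prod_congr rfl fun y _ => ?_
  simp

lemma systemHam_submatrix_equiv (e : ι' ≃ ι) (w : ι → ι → ℝ) (d : ι → ℝ) :
    (systemHam N w d).submatrix (e.arrowCongr (Equiv.refl _)) (e.arrowCongr (Equiv.refl _)) =
      systemHam N (fun x y => w (e x) (e y)) (fun x => d (e x)) := by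
  simp only [systemHam]
  rw [← e.sum_comp, ← e.sum_comp (fun x => (d x : ℂ) • numberOp N x)]
  simp only [submatrix_add, submatrix_sum, Pi.add_apply, submatrix_smul,
    Pi.smul_apply, numberOp, localOp_submatrix_equiv]
  congr 1
  refine Finset.sum_congr rfl fun x _ => ?_
  rw [← e.sum_comp]
  refine Finset.sum_congr rfl fun y _ => ?_
  simp only [bondOp, submatrix_sub, Pi.sub_apply, submatrix_smul, Pi.smul_apply, submatrix_sum,
    pairOp, submatrix_one_equiv, ← localOp_submatrix_equiv e,
    submatrix_mul_equiv]

lemma systemZ_equiv (e : ι' ≃ ι) {w : ι → ι → ℝ} {d : ι → ℝ} (h : Admissible w d) (β : ℝ) :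
    systemZ N (fun x y => w (e x) (e y)) (fun x => d (e x)) β = systemZ N w d β := by
  rw [systemZ, systemZ, ← trExp_submatrix_equiv (h.isHermitian β) (e.arrowCongr (Equiv.refl _)),
    submatrix_smul, Pi.smul_apply, Pi.smul_apply, systemHam_submatrix_equiv]

end Comparison

/-! ### Two subsystems: decoupling, and vacuum in one of them -/

section Sum

variable {ι₁ ι₂ : Type*} [Fintype ι₁] [DecidableEq ι₁] [Fintype ι₂] [DecidableEq ι₂] {N : ℕ}
  {X : Type*} [Fintype X] [DecidableEq X]

/-- Configurations on a disjoint union. -/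
abbrev sumConfig (ι₁ ι₂ X : Type*) : (ι₁ → X) × (ι₂ → X) ≃ (ι₁ ⊕ ι₂ → X) :=
  (Equiv.sumArrowEquivProdArrow ι₁ ι₂ X).symm

lemma productOp_one_apply (σ τ : ι₁ → X) :
    ∏ y, (1 : Matrix X X ℂ) (σ y) (τ y) = (1 : Matrix (ι₁ → X) (ι₁ → X) ℂ) σ τ := by
  rw [← productOp_one]; rfl

lemma localOp_inl (x : ι₁) (A : Matrix X X ℂ) :
    (localOp (Sum.inl x : ι₁ ⊕ ι₂) A).submatrix (sumConfig ι₁ ι₂ X) (sumConfig ι₁ ι₂ X) =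
      localOp x A ⊗ₖ 1 := by
  ext σ τ
  rw [kroneckerMap_apply, ← productOp_one_apply]
  simp only [submatrix_apply, localOp, Fintype.prod_sum_type]
  simp only [Sum.inl.injEq, reduceCtorEq, if_false]
  rfl

lemma localOp_inr (x : ι₂) (A : Matrix X X ℂ) :
    (localOp (Sum.inr x : ι₁ ⊕ ι₂) A).submatrix (sumConfig ι₁ ι₂ X) (sumConfig ι₁ ι₂ X) =
      1 ⊗ₖ localOp x A := by
  ext σ τ
  rw [kroneckerMap_apply, ← productOp_one_apply]
  simp only [submatrix_apply, localOp, Fintype.prod_sum_type]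
  simp only [Sum.inr.injEq, reduceCtorEq, if_false]
  rfl

lemma pairOp_submatrix {ι : Type*} [Fintype ι] [DecidableEq ι] {m : Type*} [Fintype m]
    [DecidableEq m] (E : m ≃ (ι → X)) (x y : ι) (A B : Matrix X X ℂ) :
    (pairOp x y A B).submatrix E E = (localOp x A).submatrix E E * (localOp y B).submatrix E E := by
  rw [pairOp, submatrix_mul_equiv]

lemma bondOp_inl (x y : ι₁) :
    (bondOp N (Sum.inl x : ι₁ ⊕ ι₂) (Sum.inl y)).submatrix (sumConfig ι₁ ι₂ _)
      (sumConfig ι₁ ι₂ _) = bondOp N x y ⊗ₖ 1 := by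
  simp only [bondOp, submatrix_sub, Pi.sub_apply, submatrix_smul, Pi.smul_apply, submatrix_sum,
    pairOp_submatrix, localOp_inl, ← mul_kronecker_mul, submatrix_one_equiv,
    mul_one, sub_kronecker, smul_kronecker, one_kronecker_one, sum_kronecker]
  simp only [pairOp]

lemma bondOp_inr (x y : ι₂) :
    (bondOp N (Sum.inr x : ι₁ ⊕ ι₂) (Sum.inr y)).submatrix (sumConfig ι₁ ι₂ _)
      (sumConfig ι₁ ι₂ _) = 1 ⊗ₖ bondOp N x y := by
  simp only [bondOp, submatrix_sub, Pi.sub_apply, submatrix_smul, Pi.smul_apply, submatrix_sum,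
    pairOp_submatrix, localOp_inr, ← mul_kronecker_mul, submatrix_one_equiv,
    mul_one, kronecker_sub, kronecker_smul, one_kronecker_one, kronecker_sum]
  simp only [pairOp]

lemma systemHam_sum (w : ι₁ ⊕ ι₂ → ι₁ ⊕ ι₂ → ℝ) (d : ι₁ ⊕ ι₂ → ℝ) :
    (systemHam N w d).submatrix (sumConfig ι₁ ι₂ _) (sumConfig ι₁ ι₂ _) =
      systemHam N (fun x y => w (Sum.inl x) (Sum.inl y)) (fun x => d (Sum.inl x)) ⊗ₖ 1 +
      1 ⊗ₖ systemHam N (fun x y => w (Sum.inr x) (Sum.inr y)) (fun x => d (Sum.inr x)) +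
      ((∑ x, ∑ y, (w (Sum.inl x) (Sum.inr y) : ℂ) •
        (bondOp N (Sum.inl x : ι₁ ⊕ ι₂) (Sum.inr y)).submatrix (sumConfig ι₁ ι₂ _)
          (sumConfig ι₁ ι₂ _)) +
      ∑ y, ∑ x, (w (Sum.inr y) (Sum.inl x) : ℂ) •
        (bondOp N (Sum.inr y : ι₁ ⊕ ι₂) (Sum.inl x)).submatrix (sumConfig ι₁ ι₂ _)
          (sumConfig ι₁ ι₂ _)) := by
  simp only [systemHam, numberOp, Fintype.sum_sum_type, submatrix_add, Pi.add_apply, submatrix_sum,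
    submatrix_smul, Pi.smul_apply, bondOp_inl, bondOp_inr, localOp_inl,
    localOp_inr, add_kronecker, kronecker_add, sum_kronecker, kronecker_sum, smul_kronecker, kronecker_smul,
    Finset.sum_add_distrib]
  abel

lemma Admissible.comp {ι κ : Type*} {w : ι → ι → ℝ} {d : ι → ℝ} (h : Admissible w d) (f : κ → ι) :
    Admissible (fun x y => w (f x) (f y)) (fun x => d (f x)) :=
  ⟨fun _ _ => h.1 _ _, fun _ => h.2 _, fun _ => h.3 _⟩

lemma systemZ_sum_of_disconnected {w : ι₁ ⊕ ι₂ → ι₁ ⊕ ι₂ → ℝ} {d : ι₁ ⊕ ι₂ → ℝ}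
    (h : Admissible w d) (h₁ : ∀ x y, w (Sum.inl x) (Sum.inr y) = 0)
    (h₂ : ∀ x y, w (Sum.inr x) (Sum.inl y) = 0) (β : ℝ) :
    systemZ N w d β =
      systemZ N (fun x y => w (Sum.inl x) (Sum.inl y)) (fun x => d (Sum.inl x)) β *
      systemZ N (fun x y => w (Sum.inr x) (Sum.inr y)) (fun x => d (Sum.inr x)) β := by
  rw [systemZ, systemZ, systemZ, ← trExp_kronecker ((h.comp Sum.inl).isHermitian β)
    ((h.comp Sum.inr).isHermitian β), ← trExp_submatrix_equiv (h.isHermitian β)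
      (sumConfig ι₁ ι₂ _), submatrix_smul, Pi.smul_apply, Pi.smul_apply, systemHam_sum]
  simp only [h₁, h₂, smul_kronecker, kronecker_smul, Complex.ofReal_zero, zero_smul,
    Finset.sum_const_zero, add_zero, smul_add]

/-- The cross bonds are positive operators, so deleting them can only raise the partition function,
which then factorizes. -/
lemma systemZ_sum_le {w : ι₁ ⊕ ι₂ → ι₁ ⊕ ι₂ → ℝ} {d : ι₁ ⊕ ι₂ → ℝ}
    (h : Admissible w d) {β : ℝ} (hβ : 0 ≤ β) :
    systemZ N w d β ≤
      systemZ N (fun x y => w (Sum.inl x) (Sum.inl y)) (fun x => d (Sum.inl x)) β *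
      systemZ N (fun x y => w (Sum.inr x) (Sum.inr y)) (fun x => d (Sum.inr x)) β := by
  set w' : ι₁ ⊕ ι₂ → ι₁ ⊕ ι₂ → ℝ := fun x y => if x.isLeft = y.isLeft then w x y else 0 with hw'
  have h' : Admissible w' d := by
    refine ⟨fun x y => ?_, fun x => ?_, h.3⟩
    · simp only [hw']; split_ifs
      · exact h.1 x y
      · exact le_rfl
    · simp [hw', h.2]
  refine (systemZ_antitone h h' (fun x y => ?_) (fun _ => le_rfl) hβ).trans
    (systemZ_sum_of_disconnected h' (by simp [hw']) (by simp [hw']) β).le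
  simp only [hw']; split_ifs
  · exact le_rfl
  · exact h.1 x y

lemma localOp_zero_zero {ι : Type*} [Fintype ι] [DecidableEq ι] (x : ι)
    (A : Matrix (Fin (N + 1)) (Fin (N + 1)) ℂ) : localOp x A 0 0 = A 0 0 := by
  rw [localOp_apply, Finset.prod_eq_one]
  · simp
  · intros; simp

lemma pairOp_zero_zero {ι : Type*} [Fintype ι] [DecidableEq ι] {x y : ι} (hxy : x ≠ y)
    (A B : Matrix (Fin (N + 1)) (Fin (N + 1)) ℂ) : pairOp x y A B 0 0 = A 0 0 * B 0 0 := by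
  rw [pairOp, localOp_eq_productOp, localOp_eq_productOp, productOp_mul, productOp]
  rw [Finset.prod_eq_mul (a := x) (b := y) hxy]
  · simp [hxy, hxy.symm]
  · intro c _ hc; simp [hc.1, hc.2]
  · simp
  · simp

lemma spin_zero_zero : spin N 0 0 0 = 0 ∧ spin N 1 0 0 = 0 ∧ spin N 2 0 0 = -((N : ℂ) / 2) := by
  have h1 : spinPlus N 0 0 = 0 := by simp [spinPlus]
  have h2 : spinMinus N 0 0 = 0 := by simp [spinMinus, h1]
  have h3 : spin N 0 = (1 / 2 : ℂ) • (spinPlus N + spinMinus N) := rfl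
  have h4 : spin N 1 = (1 / (2 * Complex.I) : ℂ) • (spinPlus N - spinMinus N) := rfl
  refine ⟨by simp [h3, h1, h2], by simp [h4, h1, h2], ?_⟩
  simp [spin_two, numberMat]

/-- Extension of a configuration by the vacuum. -/
def vacuumExtend (ι₁ ι₂ : Type*) (N : ℕ) (σ : ι₁ → Fin (N + 1)) :
    (ι₁ → Fin (N + 1)) × (ι₂ → Fin (N + 1)) := (σ, 0)

lemma kronecker_vacuum (A : Matrix (ι₁ → Fin (N + 1)) (ι₁ → Fin (N + 1)) ℂ)
    (B : Matrix (ι₂ → Fin (N + 1)) (ι₂ → Fin (N + 1)) ℂ) :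
    (A ⊗ₖ B).submatrix (vacuumExtend ι₁ ι₂ N) (vacuumExtend ι₁ ι₂ N) = B 0 0 • A := by
  ext σ τ; simp [vacuumExtend, mul_comm]

/-- In the vacuum at y the components S¹ and S² have mean 0 and S³ has mean -S, which leaves S² + S
(n_x - S) = S n_x. -/
lemma bondOp_cross_vacuum (x : ι₁) (y : ι₂) :
    ((bondOp N (Sum.inl x : ι₁ ⊕ ι₂) (Sum.inr y)).submatrix (sumConfig ι₁ ι₂ _)
      (sumConfig ι₁ ι₂ _)).submatrix (vacuumExtend ι₁ ι₂ N) (vacuumExtend ι₁ ι₂ N) =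
      ((N : ℂ) / 2) • numberOp N x := by
  obtain ⟨h0, h1, h2⟩ := spin_zero_zero (N := N)
  simp only [bondOp, submatrix_sub, Pi.sub_apply, submatrix_smul, Pi.smul_apply,
    pairOp_submatrix, localOp_inl, localOp_inr, ← mul_kronecker_mul,
    mul_one, one_mul, kronecker_vacuum, localOp_zero_zero, Fin.sum_univ_three, submatrix_add,
    Pi.add_apply]
  rw [submatrix_one_equiv, ← one_kronecker_one, kronecker_vacuum, h0, h1, h2, spin_two, localOp_sub,
    localOp_smul, localOp_one, numberOp]
  simp only [one_apply_eq]
  module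

lemma bondOp_comm {ι : Type*} [Fintype ι] [DecidableEq ι] {x y : ι} (hxy : x ≠ y) :
    bondOp N x y = bondOp N y x := by
  simp only [bondOp, pairOp, localOp_comm hxy]

lemma bondOp_zero_zero {ι : Type*} [Fintype ι] [DecidableEq ι] {x y : ι} (hxy : x ≠ y) :
    bondOp N x y 0 0 = 0 := by
  obtain ⟨h0, h1, h2⟩ := spin_zero_zero (N := N)
  simp only [bondOp, Matrix.sub_apply, Matrix.smul_apply, Matrix.sum_apply, pairOp_zero_zero hxy,
    one_apply_eq, smul_eq_mul]
  rw [Fin.sum_univ_three, h0, h1, h2]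
  ring

lemma systemHam_zero_zero {ι : Type*} [Fintype ι] [DecidableEq ι] {w : ι → ι → ℝ} {d : ι → ℝ}
    (hw : ∀ x, w x x = 0) : systemHam N w d 0 0 = 0 := by
  simp only [systemHam, Matrix.add_apply, Matrix.sum_apply, Matrix.smul_apply, numberOp, localOp_zero_zero]
  rw [Finset.sum_eq_zero, Finset.sum_eq_zero, add_zero]
  · intro x _; simp [numberMat]
  · intro x _
    refine Finset.sum_eq_zero fun y _ => ?_
    by_cases h : x = y
    · subst h; simp [hw]
    · simp [bondOp_zero_zero h]

lemma systemHam_vacuum {w : ι₁ ⊕ ι₂ → ι₁ ⊕ ι₂ → ℝ} (d : ι₁ ⊕ ι₂ → ℝ) (hw : ∀ x, w x x = 0) :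
    ((systemHam N w d).submatrix (sumConfig ι₁ ι₂ _) (sumConfig ι₁ ι₂ _)).submatrix
      (vacuumExtend ι₁ ι₂ N) (vacuumExtend ι₁ ι₂ N) =
      systemHam N (fun x y => w (Sum.inl x) (Sum.inl y)) (fun x => d (Sum.inl x) +
        (N : ℝ) / 2 * ∑ y, (w (Sum.inl x) (Sum.inr y) + w (Sum.inr y) (Sum.inl x))) := by
  rw [systemHam_sum]
  simp only [submatrix_add, Pi.add_apply, kronecker_vacuum, submatrix_sum,
    submatrix_smul, Pi.smul_apply, bondOp_comm (Sum.inr_ne_inl), bondOp_cross_vacuum]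
  rw [systemHam_zero_zero (fun x => hw (Sum.inr x)), zero_smul, add_zero, one_apply_eq, one_smul]
  simp only [systemHam]
  rw [add_assoc]
  congr 1
  rw [Finset.sum_comm (f := fun (y : ι₂) (x : ι₁) => _), ← Finset.sum_add_distrib,
    ← Finset.sum_add_distrib]
  refine Finset.sum_congr rfl fun x _ => ?_
  rw [← Finset.sum_add_distrib]
  push_cast
  rw [add_smul, Finset.mul_sum, Finset.sum_smul]
  congr 1
  refine Finset.sum_congr rfl fun y _ => ?_
  module

/-- Compression to configurations with vacuum on the second part lowers the trace, and the cross
bonds survive as fields. An even larger field `d'` lowers it further; this slack lets one periodic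
field serve all boxes, including those at the edge. -/
lemma le_systemZ_sum {w : ι₁ ⊕ ι₂ → ι₁ ⊕ ι₂ → ℝ} {d : ι₁ ⊕ ι₂ → ℝ} {d' : ι₁ → ℝ}
    (h : Admissible w d) (hd : ∀ x, d (Sum.inl x) +
      (N : ℝ) / 2 * ∑ y, (w (Sum.inl x) (Sum.inr y) + w (Sum.inr y) (Sum.inl x)) ≤ d' x)
    {β : ℝ} (hβ : 0 ≤ β) :
    systemZ N (fun x y => w (Sum.inl x) (Sum.inl y)) d' β ≤ systemZ N w d β := by
  have hnn : ∀ x, 0 ≤ d (Sum.inl x) +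
      (N : ℝ) / 2 * ∑ y, (w (Sum.inl x) (Sum.inr y) + w (Sum.inr y) (Sum.inl x)) := fun x =>
    add_nonneg (h.3 _) (mul_nonneg (by positivity)
      (Finset.sum_nonneg fun y _ => add_nonneg (h.1 _ _) (h.1 _ _)))
  have h1 : Admissible (fun x y => w (Sum.inl x) (Sum.inl y)) (fun x => d (Sum.inl x) +
        (N : ℝ) / 2 * ∑ y, (w (Sum.inl x) (Sum.inr y) + w (Sum.inr y) (Sum.inl x))) :=
    ⟨fun _ _ => h.1 _ _, fun _ => h.2 _, hnn⟩
  have h2 : Admissible (fun x y => w (Sum.inl x) (Sum.inl y)) d' :=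
    ⟨fun _ _ => h.1 _ _, fun _ => h.2 _, fun x => (hnn x).trans (hd x)⟩
  refine (systemZ_antitone h2 h1 (fun _ _ => le_rfl) hd hβ).trans ?_
  refine trExp_le_of_submatrix (h.isHermitian β) (h1.isHermitian β)
    (fun σ => sumConfig ι₁ ι₂ _ (vacuumExtend ι₁ ι₂ N σ)) (fun σ τ hστ => ?_) ?_
  · have := (sumConfig ι₁ ι₂ _).injective hστ
    exact congrArg Prod.fst this
  · have : ((-(β : ℂ)) • systemHam N w d).submatrix
        (fun σ => sumConfig ι₁ ι₂ _ (vacuumExtend ι₁ ι₂ N σ))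
        (fun σ => sumConfig ι₁ ι₂ _ (vacuumExtend ι₁ ι₂ N σ)) =
        (-(β : ℂ)) • ((systemHam N w d).submatrix (sumConfig ι₁ ι₂ _)
          (sumConfig ι₁ ι₂ _)).submatrix (vacuumExtend ι₁ ι₂ N) (vacuumExtend ι₁ ι₂ N) := by
      ext σ τ; rfl
    rw [this, systemHam_vacuum d h.2, sub_self]
    exact PosSemidef.zero

end Sum

end Heisenberg2D

end

noncomputable section

namespace Heisenberg2D

open Matrix
open scoped Kronecker ComplexOrder

/-! ### Partition functions of finite regions -/

section Region

/-- The vacuum has energy zero, so compression to its one-dimensional span already gives 1.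
Consequently all logarithms of partition functions are nonnegative. -/
lemma one_le_systemZ {ι : Type*} [Fintype ι] [DecidableEq ι] {N : ℕ} {w : ι → ι → ℝ} {d : ι → ℝ}
    (h : Admissible w d) (β : ℝ) : 1 ≤ systemZ N w d β := by
  have h0 : trExp (0 : Matrix Unit Unit ℂ) = 1 := by
    simp [trExp, NormedSpace.exp_zero]
  rw [← h0]
  refine trExp_le_of_submatrix (h.isHermitian β) isHermitian_zero (fun _ => 0)
    (fun _ _ _ => rfl) ?_
  have : ((-(β : ℂ)) • systemHam N w d).submatrix (fun _ : Unit => 0) (fun _ : Unit => 0) = 0 := by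
    ext i j; simp [systemHam_zero_zero h.2]
  rw [this, sub_zero]
  exact PosSemidef.zero

variable {α : Type*} [DecidableEq α] {N : ℕ} {w : α → α → ℝ} {d : α → ℝ} {β : ℝ}

/-- The partition function of the region `Λ` with bond weights `w` and local fields `d`. -/
def regionZ (N : ℕ) (Λ : Finset α) (w : α → α → ℝ) (d : α → ℝ) (β : ℝ) : ℝ :=
  systemZ N (fun x y : Λ => w x y) (fun x : Λ => d x) β

lemma one_le_regionZ (h : Admissible w d) (Λ : Finset α) (β : ℝ) : 1 ≤ regionZ N Λ w d β :=
  one_le_systemZ (h.comp _) β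

lemma regionZ_pos (h : Admissible w d) (Λ : Finset α) (β : ℝ) : 0 < regionZ N Λ w d β :=
  one_pos.trans_le (one_le_regionZ h Λ β)

lemma regionZ_union_le (h : Admissible w d) (hβ : 0 ≤ β) {Λ₁ Λ₂ : Finset α}
    (hd : Disjoint Λ₁ Λ₂) :
    regionZ N (Λ₁ ∪ Λ₂) w d β ≤ regionZ N Λ₁ w d β * regionZ N Λ₂ w d β := by
  rw [regionZ, ← systemZ_equiv (Equiv.Finset.union Λ₁ Λ₂ hd) (h.comp _)]
  exact systemZ_sum_le (h.comp fun x => (Equiv.Finset.union Λ₁ Λ₂ hd x : α)) hβ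

lemma regionZ_union_of_disconnected (h : Admissible w d) {Λ₁ Λ₂ : Finset α}
    (hd : Disjoint Λ₁ Λ₂) (hw : ∀ x ∈ Λ₁, ∀ y ∈ Λ₂, w x y = 0 ∧ w y x = 0) :
    regionZ N (Λ₁ ∪ Λ₂) w d β = regionZ N Λ₁ w d β * regionZ N Λ₂ w d β := by
  rw [regionZ, ← systemZ_equiv (Equiv.Finset.union Λ₁ Λ₂ hd) (h.comp _)]
  exact systemZ_sum_of_disconnected (h.comp fun x => (Equiv.Finset.union Λ₁ Λ₂ hd x : α))
    (fun x y => (hw x x.2 y y.2).1) (fun x y => (hw y y.2 x x.2).2) β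

lemma regionZ_le (h : Admissible w d) (hβ : 0 ≤ β) (Λ : Finset α) :
    regionZ N Λ w d β ≤ ((N : ℝ) + 1) ^ Λ.card := by
  have := systemZ_antitone (N := N) (h.comp (fun x : Λ => (x : α))) (w' := fun _ _ => 0)
    (d' := fun _ => 0) ⟨fun _ _ => le_rfl, fun _ => rfl, fun _ => le_rfl⟩
    (fun _ _ => h.1 _ _) (fun _ => h.3 _) hβ
  rw [systemZ_zero, Fintype.card_coe] at this
  exact this

lemma regionZ_empty (h : Admissible w d) (hβ : 0 ≤ β) : regionZ N (∅ : Finset α) w d β = 1 :=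
  le_antisymm (by simpa using regionZ_le (N := N) h hβ ∅) (one_le_regionZ h _ _)

lemma regionZ_biUnion_le (h : Admissible w d) (hβ : 0 ≤ β) {J : Type*} [DecidableEq J]
    (s : Finset J) (B : J → Finset α)
    (hB : ∀ i j, i ≠ j → Disjoint (B i) (B j)) :
    regionZ N (s.biUnion B) w d β ≤ ∏ j ∈ s, regionZ N (B j) w d β := by
  induction s using Finset.induction_on with
  | empty => simp [regionZ_empty h hβ]
  | insert a s ha ih =>
    rw [Finset.biUnion_insert, Finset.prod_insert ha]
    refine (regionZ_union_le h hβ ?_).trans (mul_le_mul_of_nonneg_left ih (regionZ_pos h _ _).le)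
    rw [Finset.disjoint_biUnion_right]
    exact fun i hi => hB a i fun hai => ha (hai ▸ hi)

lemma regionZ_biUnion_of_disconnected (h : Admissible w d) (hβ : 0 ≤ β) {J : Type*} [DecidableEq J]
    (s : Finset J) (B : J → Finset α) (hB : ∀ i j, i ≠ j → Disjoint (B i) (B j))
    (hw : ∀ i j, i ≠ j → ∀ x ∈ B i, ∀ y ∈ B j, w x y = 0) :
    regionZ N (s.biUnion B) w d β = ∏ j ∈ s, regionZ N (B j) w d β := by
  induction s using Finset.induction_on with
  | empty => simp [regionZ_empty h hβ]
  | insert a s ha ih =>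
    rw [Finset.biUnion_insert, Finset.prod_insert ha, ← ih]
    refine regionZ_union_of_disconnected h ?_ ?_
    · rw [Finset.disjoint_biUnion_right]
      exact fun i hi => hB a i fun hai => ha (hai ▸ hi)
    · intro x hx y hy
      obtain ⟨i, hi, hy⟩ := Finset.mem_biUnion.mp hy
      have hai : a ≠ i := fun hai => ha (hai ▸ hi)
      exact ⟨hw a i hai x hx y hy, hw i a hai.symm y hy x hx⟩

lemma regionZ_map {α' : Type*} [DecidableEq α'] (h : Admissible w d) (Λ : Finset α') (f : α' ↪ α) :
    regionZ N (Λ.map f) w d β = regionZ N Λ (fun x y => w (f x) (f y)) (fun x => d (f x)) β := by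
  have hbij : Function.Bijective
      (fun x : Λ => (⟨f x, Finset.mem_map_of_mem f x.2⟩ : (Λ.map f : Finset α))) := by
    refine ⟨fun x y hxy => Subtype.ext (f.injective (congrArg Subtype.val hxy)), fun y => ?_⟩
    obtain ⟨x, hx, hxy⟩ := Finset.mem_map.mp y.2
    exact ⟨⟨x, hx⟩, Subtype.ext hxy⟩
  rw [regionZ, ← systemZ_equiv (Equiv.ofBijective _ hbij) (h.comp _)]
  rfl

lemma regionZ_le_of_subset (h : Admissible w d) (hβ : 0 ≤ β) {d' : α → ℝ} {Λ' Λ : Finset α}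
    (hΛ : Λ' ⊆ Λ)
    (hd : ∀ x ∈ Λ', d x + (N : ℝ) / 2 * ∑ y ∈ Λ \ Λ', (w x y + w y x) ≤ d' x) :
    regionZ N Λ' w d' β ≤ regionZ N Λ w d β := by
  obtain ⟨Λ'', rfl, hdis⟩ : ∃ Λ'', Λ' ∪ Λ'' = Λ ∧ Disjoint Λ' Λ'' :=
    ⟨Λ \ Λ', Finset.union_sdiff_of_subset hΛ, Finset.disjoint_sdiff⟩
  rw [Finset.union_sdiff_cancel_left hdis] at hd
  rw [regionZ, regionZ, ← systemZ_equiv (Equiv.Finset.union Λ' Λ'' hdis) (h.comp _)]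
  refine le_systemZ_sum (h.comp fun x => (Equiv.Finset.union Λ' Λ'' hdis x : α)) (fun x => ?_) hβ
  refine le_trans (le_of_eq ?_) (hd x x.2)
  rw [← Finset.sum_coe_sort Λ'']
  rfl

end Region

/-! ### Square lattice: tilings by blocks and Dirichlet walls -/

section Lattice

variable {N : ℕ} {β : ℝ}

/-- The bond weights of the square lattice; every bond has exactly one orientation. -/
def latticeBond (x y : ℤ × ℤ) : ℝ := if y = x + (1, 0) ∨ y = x + (0, 1) then 1 else 0

lemma latticeBond_admissible {d : ℤ × ℤ → ℝ} (hd : ∀ x, 0 ≤ d x) : Admissible latticeBond d := by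
  refine ⟨fun x y => ?_, fun x => ?_, hd⟩
  · unfold latticeBond; split_ifs <;> norm_num
  · simp [latticeBond]

lemma latticeBond_translate (t x y : ℤ × ℤ) : latticeBond (t + x) (t + y) = latticeBond x y := by
  simp [latticeBond, add_assoc]

lemma partitionFunction_eq (Λ : Finset (ℤ × ℤ)) :
    partitionFunction N Λ β = regionZ N Λ latticeBond (fun _ => 0) β := by
  rw [partitionFunction, hamiltonian_eq]; rfl

/-- The translate of `[1, M]²` by `s j`. -/
def block (s M : ℕ) (j : ℕ × ℕ) : Finset (ℤ × ℤ) :=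
  (square M).map (addLeftEmbedding ((s * j.1 : ℤ), (s * j.2 : ℤ)))

lemma mem_square {L : ℕ} {x : ℤ × ℤ} :
    x ∈ square L ↔ (1 ≤ x.1 ∧ x.1 ≤ L) ∧ 1 ≤ x.2 ∧ x.2 ≤ L := by
  simp [square, Finset.mem_product]

lemma card_square (L : ℕ) : (square L).card = L ^ 2 := by
  simp [square, sq]

lemma mem_block {s M : ℕ} {j : ℕ × ℕ} {x : ℤ × ℤ} :
    x ∈ block s M j ↔ ((s * j.1 : ℤ) + 1 ≤ x.1 ∧ x.1 ≤ s * j.1 + M) ∧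
      (s * j.2 : ℤ) + 1 ≤ x.2 ∧ x.2 ≤ s * j.2 + M := by
  simp only [block, Finset.mem_map, addLeftEmbedding_apply]
  constructor
  · rintro ⟨y, hy, rfl⟩
    rw [mem_square] at hy
    simp only [Prod.fst_add, Prod.snd_add]
    omega
  · intro h
    refine ⟨(x.1 - s * j.1, x.2 - s * j.2), ?_, ?_⟩
    · rw [mem_square]; simp only; omega
    · ext <;> simp

lemma interval_separated {s M : ℕ} {j j' : ℕ} (hj : j < j') {a b : ℤ} (ha : a ≤ s * j + M)
    (hb : (s * j' : ℤ) + 1 ≤ b) : a + (s - M) + 1 ≤ b := by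
  have h1 : (j : ℤ) + 1 ≤ j' := by exact_mod_cast hj
  have h2 : (0 : ℤ) ≤ s := Int.natCast_nonneg s
  nlinarith [mul_le_mul_of_nonneg_left h1 h2]

/-- Used with M = s for a tiling by disjoint blocks, and with M < s for blocks separated by walls,
between which no bond runs. -/
lemma block_separated {s M : ℕ} {i j : ℕ × ℕ} (hij : i ≠ j) {x y : ℤ × ℤ}
    (hx : x ∈ block s M i) (hy : y ∈ block s M j) :
    x.1 + (s - M) + 1 ≤ y.1 ∨ y.1 + (s - M) + 1 ≤ x.1 ∨ x.2 + (s - M) + 1 ≤ y.2 ∨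
      y.2 + (s - M) + 1 ≤ x.2 := by
  rw [mem_block] at hx hy
  by_cases h1 : i.1 = j.1
  · have h2 : i.2 ≠ j.2 := fun h => hij (Prod.ext h1 h)
    rcases lt_or_gt_of_ne h2 with h | h
    · exact Or.inr (Or.inr (Or.inl (interval_separated h hx.2.2 hy.2.1)))
    · exact Or.inr (Or.inr (Or.inr (interval_separated h hy.2.2 hx.2.1)))
  · rcases lt_or_gt_of_ne h1 with h | h
    · exact Or.inl (interval_separated h hx.1.2 hy.1.1)
    · exact Or.inr (Or.inl (interval_separated h hy.1.2 hx.1.1))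

lemma block_disjoint {s M : ℕ} (hM : M ≤ s) (i j : ℕ × ℕ) (hij : i ≠ j) :
    Disjoint (block s M i) (block s M j) := by
  rw [Finset.disjoint_left]
  intro x hx hy
  have := block_separated hij hx hy
  omega

lemma block_disconnected {s M : ℕ} (hM : M < s) (i j : ℕ × ℕ) (hij : i ≠ j) :
    ∀ x ∈ block s M i, ∀ y ∈ block s M j, latticeBond x y = 0 := by
  intro x hx y hy
  have := block_separated hij hx hy
  rw [latticeBond, if_neg]
  rintro (rfl | rfl) <;> simp at this <;> omega

/-- The index set of a `k × k` array of blocks. -/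
def blockIndex (k : ℕ) : Finset (ℕ × ℕ) := Finset.range k ×ˢ Finset.range k

lemma block_subset {s M k L : ℕ} (hM : M ≤ s) (hL : k * s ≤ L) {j : ℕ × ℕ}
    (hj : j ∈ blockIndex k) : block s M j ⊆ square L := by
  intro x hx
  rw [mem_block] at hx
  simp only [blockIndex, Finset.mem_product, Finset.mem_range] at hj
  have h1 : s * j.1 + s ≤ L := (by nlinarith [hj.1] : s * j.1 + s ≤ k * s).trans hL
  have h2 : s * j.2 + s ≤ L := (by nlinarith [hj.2] : s * j.2 + s ≤ k * s).trans hL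
  have h1' : (s * j.1 : ℤ) + s ≤ L := by exact_mod_cast h1
  have h2' : (s * j.2 : ℤ) + s ≤ L := by exact_mod_cast h2
  have h3 : (0 : ℤ) ≤ s * j.1 := by positivity
  have h4 : (0 : ℤ) ≤ s * j.2 := by positivity
  rw [mem_square]; omega

lemma regionZ_block {d : ℤ × ℤ → ℝ} (hd : ∀ x, 0 ≤ d x) {s M : ℕ} (j : ℕ × ℕ)
    (hper : ∀ x, d (((s * j.1 : ℤ), (s * j.2 : ℤ)) + x) = d x) :
    regionZ N (block s M j) latticeBond d β = regionZ N (square M) latticeBond d β := by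
  rw [block, regionZ_map (latticeBond_admissible hd)]
  simp only [addLeftEmbedding_apply, latticeBond_translate, hper]

lemma card_biUnion_block {M k : ℕ} : ((blockIndex k).biUnion (block M M)).card = (k * M) ^ 2 := by
  rw [Finset.card_biUnion fun i _ j _ hij => block_disjoint le_rfl i j hij]
  simp [block, card_square, blockIndex]
  ring

/-- Dropping the bonds between blocks. -/
lemma partitionFunction_le (hβ : 0 ≤ β) {M k L : ℕ} (hL : k * M ≤ L) :
    partitionFunction N (square L) β ≤
      partitionFunction N (square M) β ^ (k ^ 2) * ((N : ℝ) + 1) ^ (L ^ 2 - (k * M) ^ 2) := by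
  have hadm := latticeBond_admissible (d := fun _ => 0) (fun _ => le_rfl)
  have hsub : (blockIndex k).biUnion (block M M) ⊆ square L :=
    Finset.biUnion_subset.mpr fun j hj => block_subset le_rfl hL hj
  simp only [partitionFunction_eq]
  rw [← Finset.union_sdiff_of_subset hsub]
  refine (regionZ_union_le hadm hβ Finset.disjoint_sdiff).trans ?_
  refine mul_le_mul ?_ ?_ (regionZ_pos hadm _ _).le (pow_nonneg (regionZ_pos hadm _ _).le _)
  · refine (regionZ_biUnion_le hadm hβ _ _ (block_disjoint le_rfl)).trans (le_of_eq ?_)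
    rw [Finset.prod_congr rfl fun j _ => regionZ_block (fun _ => le_rfl) j fun _ => rfl]
    simp [blockIndex, sq]
  · refine (regionZ_le hadm hβ _).trans (le_of_eq ?_)
    rw [Finset.card_sdiff_of_subset hsub, card_biUnion_block, card_square]

/-- The field that replaces the bonds between a box of side `ℓ` and the vacuum outside. -/
def dirichletField (N ℓ : ℕ) (x : ℤ × ℤ) : ℝ :=
  (N : ℝ) / 2 * (((if x.1 % (ℓ + 1) = 1 then 1 else 0) + (if (x.1 + 1) % (ℓ + 1) = 0 then 1 else 0)) +
    ((if x.2 % (ℓ + 1) = 1 then 1 else 0) + (if (x.2 + 1) % (ℓ + 1) = 0 then 1 else 0)))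

lemma dirichletField_nonneg (N ℓ : ℕ) (x : ℤ × ℤ) : 0 ≤ dirichletField N ℓ x := by
  unfold dirichletField
  positivity

/-- The field is written through residues modulo ℓ + 1, so that a single function on the lattice
restricts to the same field on every box. -/
lemma dirichletField_periodic (N ℓ : ℕ) (j : ℕ × ℕ) (x : ℤ × ℤ) :
    dirichletField N ℓ ((((ℓ + 1 : ℕ) * j.1 : ℤ), ((ℓ + 1 : ℕ) * j.2 : ℤ)) + x) =
      dirichletField N ℓ x := by
  simp only [dirichletField, Prod.fst_add, Prod.snd_add]
  push_cast
  simp only [add_assoc, Int.mul_add_emod_self_left]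

lemma sum_latticeBond_right (s : Finset (ℤ × ℤ)) (x : ℤ × ℤ) :
    ∑ y ∈ s, latticeBond x y =
      (if x + (1, 0) ∈ s then 1 else 0) + (if x + (0, 1) ∈ s then 1 else 0) := by
  have : ∀ y, latticeBond x y = (if y = x + (1, 0) then 1 else 0) +
      (if y = x + (0, 1) then 1 else 0) := by
    intro y
    unfold latticeBond
    by_cases h : y = x + (1, 0)
    · subst h; simp
    · simp [h]
  simp only [this, Finset.sum_add_distrib, Finset.sum_ite_eq']

lemma sum_latticeBond_left (s : Finset (ℤ × ℤ)) (x : ℤ × ℤ) :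
    ∑ y ∈ s, latticeBond y x =
      (if x - (1, 0) ∈ s then 1 else 0) + (if x - (0, 1) ∈ s then 1 else 0) := by
  have : ∀ y, latticeBond y x = (if y = x - (1, 0) then 1 else 0) +
      (if y = x - (0, 1) then 1 else 0) := by
    intro y
    unfold latticeBond
    have e1 : x = y + (1, 0) ↔ y = x - (1, 0) := by
      rw [eq_sub_iff_add_eq, eq_comm]
    have e2 : x = y + (0, 1) ↔ y = x - (0, 1) := by
      rw [eq_sub_iff_add_eq, eq_comm]
    simp only [e1, e2]
    by_cases h : y = x - (1, 0)
    · subst h; simp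
    · simp [h]
  simp only [this, Finset.sum_add_distrib, Finset.sum_ite_eq']

/-- The walls are exactly the sites with a coordinate divisible by ℓ + 1; any other coordinate lies
in the box numbered by its quotient. -/
lemma mem_biUnion_block {ℓ k : ℕ} {x : ℤ × ℤ} (hx : x ∈ square (k * (ℓ + 1)))
    (h1 : x.1 % (ℓ + 1 : ℕ) ≠ 0) (h2 : x.2 % (ℓ + 1 : ℕ) ≠ 0) :
    x ∈ (blockIndex k).biUnion (block (ℓ + 1) ℓ) := by
  rw [mem_square] at hx
  have aux : ∀ a : ℤ, 1 ≤ a → a ≤ (k * (ℓ + 1) : ℕ) → a % (ℓ + 1 : ℕ) ≠ 0 → ∃ j < k,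
      ((ℓ + 1 : ℕ) * j : ℤ) + 1 ≤ a ∧ a ≤ (ℓ + 1 : ℕ) * j + ℓ := by
    intro a ha1 ha2 ha3
    obtain ⟨m, rfl⟩ : ∃ m : ℕ, a = m := ⟨a.toNat, by omega⟩
    have hm := Nat.div_add_mod m (ℓ + 1)
    have hlt := Nat.mod_lt m (y := ℓ + 1) (Nat.succ_pos ℓ)
    have h3 : m % (ℓ + 1) ≠ 0 := by exact_mod_cast ha3
    refine ⟨m / (ℓ + 1), ?_, ?_, ?_⟩
    · have h4 : m ≤ k * (ℓ + 1) := by exact_mod_cast ha2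
      rw [Nat.div_lt_iff_lt_mul (Nat.succ_pos ℓ)]
      refine lt_of_le_of_ne h4 fun h => h3 ?_
      rw [h]; simp
    · have : (ℓ + 1) * (m / (ℓ + 1)) + 1 ≤ m := by omega
      exact_mod_cast this
    · have : m ≤ (ℓ + 1) * (m / (ℓ + 1)) + ℓ := by omega
      exact_mod_cast this
  obtain ⟨j₁, hj₁, h₁⟩ := aux x.1 hx.1.1 hx.1.2 h1
  obtain ⟨j₂, hj₂, h₂⟩ := aux x.2 hx.2.1 hx.2.2 h2
  rw [Finset.mem_biUnion]
  exact ⟨(j₁, j₂), by simp [blockIndex, hj₁, hj₂], mem_block.mpr ⟨h₁, h₂⟩⟩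

lemma emod_ne_zero_of_mem_biUnion_block {ℓ k : ℕ} {x : ℤ × ℤ}
    (hx : x ∈ (blockIndex k).biUnion (block (ℓ + 1) ℓ)) :
    x.1 % (ℓ + 1 : ℕ) ≠ 0 ∧ x.2 % (ℓ + 1 : ℕ) ≠ 0 := by
  obtain ⟨j, _, hj⟩ := Finset.mem_biUnion.mp hx
  rw [mem_block] at hj
  have aux : ∀ (a : ℤ) (i : ℕ), ((ℓ + 1 : ℕ) * i : ℤ) + 1 ≤ a → a ≤ (ℓ + 1 : ℕ) * i + ℓ →
      a % (ℓ + 1 : ℕ) ≠ 0 := by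
    intro a i h1 h2
    obtain ⟨b, rfl⟩ : ∃ b, a = b + (ℓ + 1 : ℕ) * i := ⟨a - (ℓ + 1 : ℕ) * i, by ring⟩
    rw [Int.add_mul_emod_self_left, Int.emod_eq_of_lt (by omega) (by push_cast; omega)]
    omega
  exact ⟨aux _ _ hj.1.1 hj.1.2, aux _ _ hj.2.1 hj.2.2⟩

/-- Filling the walls between boxes of side `ℓ` with the vacuum. -/
lemma le_partitionFunction (hβ : 0 ≤ β) (k ℓ : ℕ) :
    regionZ N (square ℓ) latticeBond (dirichletField N ℓ) β ^ (k ^ 2) ≤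
      partitionFunction N (square (k * (ℓ + 1))) β := by
  have hadm := latticeBond_admissible (d := fun _ => 0) (fun _ => le_rfl)
  have hadm' := latticeBond_admissible (dirichletField_nonneg N ℓ)
  set Λ' := (blockIndex k).biUnion (block (ℓ + 1) ℓ) with hΛ'
  have hsub : Λ' ⊆ square (k * (ℓ + 1)) :=
    Finset.biUnion_subset.mpr fun j hj => block_subset (Nat.le_succ ℓ) le_rfl hj
  rw [partitionFunction_eq]
  refine le_trans (le_of_eq ?_) (regionZ_le_of_subset hadm hβ hsub (d' := dirichletField N ℓ) ?_)
  · rw [hΛ', regionZ_biUnion_of_disconnected hadm' hβ _ _ (block_disjoint (Nat.le_succ ℓ))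
      (block_disconnected (Nat.lt_succ_self ℓ)), Finset.prod_congr rfl fun j _ =>
      regionZ_block (dirichletField_nonneg N ℓ) j (dirichletField_periodic N ℓ j)]
    simp [blockIndex, sq]
  · intro x hx
    obtain ⟨h1, h2⟩ := emod_ne_zero_of_mem_biUnion_block hx
    rw [Finset.sum_add_distrib, sum_latticeBond_right, sum_latticeBond_left, zero_add,
      dirichletField]
    refine mul_le_mul_of_nonneg_left ?_ (by positivity)
    have hout : ∀ y, y ∈ square (k * (ℓ + 1)) \ Λ' →
        y.1 % (ℓ + 1 : ℕ) = 0 ∨ y.2 % (ℓ + 1 : ℕ) = 0 := by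
      intro y hy
      rw [Finset.mem_sdiff] at hy
      by_contra! hne
      exact hy.2 (mem_biUnion_block hy.1 hne.1 hne.2)
    have hsubone : ∀ a : ℤ, a % (ℓ + 1 : ℕ) ≠ 0 → (a - 1) % (ℓ + 1 : ℕ) = 0 → 
        a % (ℓ + 1 : ℕ) = 1 := by
      intro a ha hb
      have h3 : a % (ℓ + 1 : ℕ) = 1 % (ℓ + 1 : ℕ) := by
        have := Int.emod_emod_of_dvd (a - 1) (dvd_refl ((ℓ + 1 : ℕ) : ℤ))
        rw [Int.emod_eq_emod_iff_emod_sub_eq_zero]; exact hb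
      -- For ℓ = 0 every residue is 0 and the assumption fails; otherwise 1 is its own residue.
      rcases Nat.eq_zero_or_pos ℓ with rfl | hℓ
      · simp at ha
      · rw [h3, Int.emod_eq_of_lt (by norm_num)]; push_cast; omega
    have imp : ∀ {p q : Prop} [Decidable p] [Decidable q], (p → q) →
        (if p then (1 : ℝ) else 0) ≤ if q then 1 else 0 := by
      intro p q _ _ h
      by_cases hp : p
      · simp [hp, h hp]
      · rw [if_neg hp]; split_ifs <;> norm_num
    -- A step changes only one coordinate, and the other is not on a wall. Hence a neighbour outside
    -- the boxes lies on a wall through the changed coordinate, and the field of the same direction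
    -- pays for it. Only an inequality holds: at the low edge of the square the field is charged
    -- without a neighbour.
    have a1 := imp (p := x + (1, 0) ∈ square (k * (ℓ + 1)) \ Λ')
      (q := (x.1 + 1) % ((ℓ : ℤ) + 1) = 0) (fun h => by
        rcases hout _ h with h' | h'
        · exact_mod_cast h'
        · simp only [Prod.snd_add, add_zero] at h'; exact absurd h' h2)
    have a2 := imp (p := x + (0, 1) ∈ square (k * (ℓ + 1)) \ Λ')
      (q := (x.2 + 1) % ((ℓ : ℤ) + 1) = 0) (fun h => by
        rcases hout _ h with h' | h'
        · simp only [Prod.fst_add, add_zero] at h'; exact absurd h' h1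
        · exact_mod_cast h')
    have a3 := imp (p := x - (1, 0) ∈ square (k * (ℓ + 1)) \ Λ')
      (q := x.1 % ((ℓ : ℤ) + 1) = 1) (fun h => by
        rcases hout _ h with h' | h'
        · exact_mod_cast hsubone _ h1 h'
        · simp only [Prod.snd_sub, sub_zero] at h'; exact absurd h' h2)
    have a4 := imp (p := x - (0, 1) ∈ square (k * (ℓ + 1)) \ Λ')
      (q := x.2 % ((ℓ : ℤ) + 1) = 1) (fun h => by
        rcases hout _ h with h' | h'
        · simp only [Prod.fst_sub, sub_zero] at h'; exact absurd h' h1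
        · exact_mod_cast hsubone _ h2 h')
    linarith

end Lattice

end Heisenberg2D

end

noncomputable section

namespace Heisenberg2D

/-! ### Existence of the limit and reduction to one Dirichlet box -/

section ThermodynamicLimit

variable {N : ℕ} {β : ℝ}

lemma one_le_partitionFunction (N : ℕ) (Λ : Finset (ℤ × ℤ)) (β : ℝ) :
    1 ≤ partitionFunction N Λ β := by
  rw [partitionFunction_eq]
  exact one_le_regionZ (latticeBond_admissible fun _ => le_rfl) _ _

lemma tendsto_floor_mul_div (M : ℕ) (hM : 1 ≤ M) :
    Tendsto (fun L : ℕ => ((L / M * M : ℕ) : ℝ) / L) atTop (𝓝 1) := by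
  have h1 : Tendsto (fun L : ℕ => 1 - (M : ℝ) / L) atTop (𝓝 1) := by
    simpa using tendsto_const_nhds.sub (tendsto_const_div_atTop_nhds_zero_nat (M : ℝ))
  refine tendsto_of_tendsto_of_tendsto_of_le_of_le' h1 tendsto_const_nhds ?_ ?_
  · filter_upwards [eventually_gt_atTop 0] with L hL
    have hL' : (0 : ℝ) < L := by exact_mod_cast hL
    rw [le_div_iff₀ hL', sub_mul, one_mul, div_mul_cancel₀ _ hL'.ne']
    have h2 : L ≤ L / M * M + M := by
      have := Nat.div_add_mod' L M
      have := Nat.mod_lt L hM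
      omega
    have h3 : (L : ℝ) ≤ ((L / M * M : ℕ) : ℝ) + M := by exact_mod_cast h2
    linarith
  · filter_upwards with L
    exact div_le_one_of_le₀ (by exact_mod_cast Nat.div_mul_le_self L M) (Nat.cast_nonneg L)

lemma log_partitionFunction_le (hβ : 0 ≤ β) {M k L : ℕ} (hL : k * M ≤ L) :
    Real.log (partitionFunction N (square L) β) ≤
      (k : ℝ) ^ 2 * Real.log (partitionFunction N (square M) β) +
        ((L : ℝ) ^ 2 - ((k * M : ℕ) : ℝ) ^ 2) * Real.log ((N : ℝ) + 1) := by
  have h1 := one_le_partitionFunction N (square M) β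
  have h2 := one_le_partitionFunction N (square L) β
  have h3 := partitionFunction_le (N := N) hβ hL
  generalize partitionFunction N (square M) β = ZM at *
  generalize partitionFunction N (square L) β = ZL at *
  have hM : 0 < ZM := by linarith
  refine (Real.log_le_log (by linarith) h3).trans (le_of_eq ?_)
  rw [Real.log_mul (by positivity) (by positivity), Real.log_pow, Real.log_pow, Nat.cast_sub
    (Nat.pow_le_pow_left hL 2)]
  push_cast
  ring

/-- A Fekete argument: the limit is the infimum over L ≥ 1. A near-optimal block of side M tiles a
large square, and the remaining strip costs at most log(N + 1) per site on a vanishing fraction of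
the area. -/
lemma tendsto_log_partitionFunction (N : ℕ) (hβ : 0 ≤ β) :
    ∃ p, Tendsto (fun L : ℕ => Real.log (partitionFunction N (square L) β) / (L : ℝ) ^ 2)
      atTop (𝓝 p) := by
  set u : ℕ → ℝ := fun L => Real.log (partitionFunction N (square L) β) / (L : ℝ) ^ 2 with hu
  have hu0 : ∀ L, 0 ≤ u L := fun L =>
    div_nonneg (Real.log_nonneg (one_le_partitionFunction N _ β)) (by positivity)
  have hbdd : BddBelow (u '' Set.Ici 1) := ⟨0, by rintro _ ⟨L, _, rfl⟩; exact hu0 L⟩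
  refine ⟨sInf (u '' Set.Ici 1), tendsto_order.mpr ⟨fun a ha => ?_, fun a ha => ?_⟩⟩
  · filter_upwards [eventually_ge_atTop 1] with L hL
    exact ha.trans_le (csInf_le hbdd ⟨L, hL, rfl⟩)
  · obtain ⟨_, ⟨M, hM, rfl⟩, hMa⟩ := exists_lt_of_csInf_lt
      ⟨u 1, Set.mem_image_of_mem u (Set.mem_Ici.mpr le_rfl)⟩ ha
    have hM' : (0 : ℝ) < M := by exact_mod_cast (show 0 < M from hM)
    set c := Real.log ((N : ℝ) + 1)
    have hlim : Tendsto (fun L : ℕ => (((L / M * M : ℕ) : ℝ) / L) ^ 2 * u M +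
        (1 - (((L / M * M : ℕ) : ℝ) / L) ^ 2) * c) atTop (𝓝 (1 ^ 2 * u M + (1 - 1 ^ 2) * c)) := by
      have h := (tendsto_floor_mul_div M hM).pow 2
      exact (h.mul_const _).add ((tendsto_const_nhds.sub h).mul_const _)
    rw [one_pow, sub_self, zero_mul, one_mul, add_zero] at hlim
    filter_upwards [hlim.eventually_lt_const hMa, eventually_gt_atTop 0] with L hL hL0
    refine lt_of_le_of_lt ?_ hL
    have hL' : (0 : ℝ) < L := by exact_mod_cast hL0
    rw [hu]
    simp only
    rw [div_le_iff₀ (by positivity)]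
    refine (log_partitionFunction_le hβ (Nat.div_mul_le_self L M)).trans (le_of_eq ?_)
    push_cast
    field_simp
    rfl

lemma finiteFreeEnergy_square (N L : ℕ) (β : ℝ) :
    finiteFreeEnergy N (square L) β =
      -(1 / β) * (Real.log (partitionFunction N (square L) β) / (L : ℝ) ^ 2) := by
  rw [finiteFreeEnergy, card_square]
  push_cast
  rw [one_div, mul_inv]
  ring

lemma tendsto_finiteFreeEnergy (N : ℕ) (hβ : 0 ≤ β) :
    Tendsto (fun L : ℕ => finiteFreeEnergy N (square L) β) atTop (𝓝 (freeEnergy N β)) := by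
  obtain ⟨p, hp⟩ := tendsto_log_partitionFunction N hβ
  have h : Tendsto (fun L : ℕ => finiteFreeEnergy N (square L) β) atTop (𝓝 (-(1 / β) * p)) := by
    simp only [finiteFreeEnergy_square]
    exact hp.const_mul _
  rw [freeEnergy, h.limUnder_eq]
  exact h

/-- The free energy is bounded by that of a box with Dirichlet boundary conditions. -/
lemma freeEnergy_le (N : ℕ) (hβ : 0 < β) (ℓ : ℕ) :
    freeEnergy N β ≤ -(1 / β) *
      (Real.log (regionZ N (square ℓ) latticeBond (dirichletField N ℓ) β) / ((ℓ : ℝ) + 1) ^ 2) := by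
  have hmul : Tendsto (fun k : ℕ => k * (ℓ + 1)) atTop atTop :=
    tendsto_id.atTop_mul_const' (Nat.succ_pos ℓ)
  -- As the limit exists, it may be computed along the sides k(ℓ + 1) that boxes with walls fill
  -- exactly.
  refine le_of_tendsto ((tendsto_finiteFreeEnergy N hβ.le).comp hmul) ?_
  filter_upwards [eventually_gt_atTop 0] with k hk
  have hk' : (0 : ℝ) < k := by exact_mod_cast hk
  have hZ := regionZ_pos (N := N) (latticeBond_admissible (dirichletField_nonneg N ℓ)) (square ℓ) β
  have h' := le_partitionFunction (N := N) hβ.le k ℓ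
  simp only [Function.comp, finiteFreeEnergy_square]
  generalize regionZ N (square ℓ) latticeBond (dirichletField N ℓ) β = Z at *
  generalize partitionFunction N (square (k * (ℓ + 1))) β = ZL at *
  have h := Real.log_le_log (by positivity) h'
  rw [Real.log_pow] at h
  refine mul_le_mul_of_nonpos_left ?_ (by simp [hβ.le])
  rw [div_le_div_iff₀ (by positivity) (by positivity)]
  push_cast at h ⊢
  calc _ = (k ^ 2 * Real.log Z) *
        ((ℓ : ℝ) + 1) ^ 2 := by ring
    _ ≤ _ := by gcongr

end ThermodynamicLimit

end Heisenberg2D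

end

noncomputable section

namespace Heisenberg2D

open MvPolynomial

/-! ### Bosonic Fock space as polynomials -/

section Fock

variable {ι : Type*} [Fintype ι] [DecidableEq ι]

/-- The product of the factorials of the exponents. -/
def multiFact (α : ι →₀ ℕ) : ℝ := ∏ x, (Nat.factorial (α x) : ℝ)

lemma multiFact_pos (α : ι →₀ ℕ) : 0 < multiFact α :=
  Finset.prod_pos fun _ _ => by positivity

lemma multiFact_add_single (α : ι →₀ ℕ) (x : ι) :
    multiFact (α + Finsupp.single x 1) = (α x + 1) * multiFact α := by
  rw [multiFact, multiFact, ← Finset.mul_prod_erase _ _ (Finset.mem_univ x),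
    ← Finset.mul_prod_erase _ (fun y => (Nat.factorial (α y) : ℝ)) (Finset.mem_univ x), ← mul_assoc]
  congr 1
  · simp [Nat.factorial_succ]
  · refine Finset.prod_congr rfl fun y hy => ?_
    simp [Finsupp.single_eq_of_ne (Finset.ne_of_mem_erase hy)]

lemma sum_support_mul (F G : MvPolynomial ι ℝ) (c : (ι →₀ ℕ) → ℝ) (s : Finset (ι →₀ ℕ))
    (hs : F.support ⊆ s) :
    ∑ α ∈ F.support, c α * coeff α F * coeff α G = ∑ α ∈ s, c α * coeff α F * coeff α G := by
  refine Finset.sum_subset hs fun α _ hα => ?_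
  rw [notMem_support_iff.mp hα]; ring

/-- The inner product of the bosonic Fock space, in which the monomial `z ^ α` has squared norm
`α!` and multiplication by `z_x` is adjoint to `∂_x`. -/
def fock : LinearMap.BilinForm ℝ (MvPolynomial ι ℝ) :=
  LinearMap.mk₂ ℝ (fun F G => ∑ α ∈ F.support, multiFact α * coeff α F * coeff α G)
    (fun F F' G => by
      rw [sum_support_mul _ _ _ _ (Finset.subset_union_right (s₁ := F.support ∪ F'.support)),
        sum_support_mul F _ _ (F.support ∪ F'.support ∪ (F + F').support)
          (fun x hx => by simp [Finset.mem_union, hx]),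
        sum_support_mul F' _ _ (F.support ∪ F'.support ∪ (F + F').support)
          (fun x hx => by simp [Finset.mem_union, hx]), ← Finset.sum_add_distrib]
      refine Finset.sum_congr rfl fun α _ => ?_
      rw [coeff_add]; ring)
    (fun c F G => by
      rw [sum_support_mul _ _ _ _ (Finset.subset_union_right (s₁ := F.support)),
        sum_support_mul F _ _ (F.support ∪ (c • F).support) Finset.subset_union_left,
        smul_eq_mul, Finset.mul_sum]
      refine Finset.sum_congr rfl fun α _ => ?_
      rw [coeff_smul, smul_eq_mul]; ring)
    (fun F G G' => by
      rw [← Finset.sum_add_distrib]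
      refine Finset.sum_congr rfl fun α _ => ?_
      rw [coeff_add]; ring)
    (fun c F G => by
      rw [smul_eq_mul, Finset.mul_sum]
      refine Finset.sum_congr rfl fun α _ => ?_
      rw [coeff_smul, smul_eq_mul]; ring)

lemma fock_apply (F G : MvPolynomial ι ℝ) :
    fock F G = ∑ α ∈ F.support, multiFact α * coeff α F * coeff α G := rfl

lemma fock_eq_sum (F G : MvPolynomial ι ℝ) (s : Finset (ι →₀ ℕ)) (hs : F.support ⊆ s) :
    fock F G = ∑ α ∈ s, multiFact α * coeff α F * coeff α G :=
  sum_support_mul F G _ s hs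

lemma fock_comm (F G : MvPolynomial ι ℝ) : fock F G = fock G F := by
  rw [fock_eq_sum F G _ (Finset.subset_union_left (s₂ := G.support)),
    fock_eq_sum G F _ (Finset.subset_union_right (s₁ := F.support))]
  exact Finset.sum_congr rfl fun α _ => by ring

lemma fock_self_nonneg (F : MvPolynomial ι ℝ) : 0 ≤ fock F F := by
  rw [fock_apply]
  refine Finset.sum_nonneg fun α _ => ?_
  rw [mul_assoc]
  exact mul_nonneg (multiFact_pos α).le (mul_self_nonneg _)

lemma fock_monomial_left (α : ι →₀ ℕ) (a : ℝ) (G : MvPolynomial ι ℝ) :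
    fock (monomial α a) G = multiFact α * a * coeff α G := by
  rw [fock_eq_sum _ _ {α} support_monomial_subset]
  simp

/-- Creation is adjoint to annihilation because (α + e_x)! = (α_x + 1) α!. -/
lemma fock_X_mul (x : ι) (F G : MvPolynomial ι ℝ) : fock (X x * F) G = fock F (pderiv x G) := by
  induction F using MvPolynomial.induction_on' with
  | add p q hp hq => rw [mul_add, map_add, map_add, LinearMap.add_apply, LinearMap.add_apply, hp, hq]
  | monomial α a =>
    rw [X, monomial_mul, fock_monomial_left, fock_monomial_left, coeff_pderiv, add_comm,
      multiFact_add_single]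
    ring

lemma coeff_X_mul_pderiv (x : ι) (F : MvPolynomial ι ℝ) (α : ι →₀ ℕ) :
    coeff α (X x * pderiv x F) = α x * coeff α F := by
  induction F using MvPolynomial.induction_on' with
  | add p q hp hq => rw [map_add, mul_add, coeff_add, coeff_add, hp, hq]; ring
  | monomial β a =>
    rw [X_mul_pderiv_monomial, coeff_smul, coeff_monomial]
    split_ifs with h
    · subst h; simp
    · simp

/-- Moving both derivatives across gives the pair operator a*a*aa = n(n - 1), diagonal on monomials.
-/
lemma fock_pderiv_pderiv (x : ι) (F : MvPolynomial ι ℝ) :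
    fock (pderiv x (pderiv x F)) (pderiv x (pderiv x F)) =
      ∑ α ∈ F.support, multiFact α * coeff α F ^ 2 * ((α x : ℝ) * (α x - 1)) := by
  rw [← fock_X_mul, fock_comm, fock_comm (pderiv x F), ← fock_X_mul, fock_comm, fock_apply]
  refine Finset.sum_congr rfl fun α _ => ?_
  have h : X x * (X x * pderiv x (pderiv x F)) =
      X x * pderiv x (X x * pderiv x F) - X x * pderiv x F := by
    rw [pderiv_mul, pderiv_X_self]; ring
  rw [h, coeff_sub, coeff_X_mul_pderiv, coeff_X_mul_pderiv]
  ring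

/-- Bessel's inequality in the Fock space. -/
lemma fock_bessel {I : Type*} (s : Finset I) (Ψ : I → MvPolynomial ι ℝ)
    (hΨ : ∀ i ∈ s, fock (Ψ i) (Ψ i) = 1) (hΨ' : ∀ i ∈ s, ∀ j ∈ s, i ≠ j → fock (Ψ i) (Ψ j) = 0)
    (F : MvPolynomial ι ℝ) : ∑ i ∈ s, fock F (Ψ i) ^ 2 ≤ fock F F := by
  have h := fock_self_nonneg (F - ∑ i ∈ s, fock F (Ψ i) • Ψ i)
  have h1 : fock F (∑ i ∈ s, fock F (Ψ i) • Ψ i) = ∑ i ∈ s, fock F (Ψ i) ^ 2 := by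
    rw [map_sum]
    exact Finset.sum_congr rfl fun i _ => by rw [map_smul, smul_eq_mul, sq]
  have h2 : fock (∑ i ∈ s, fock F (Ψ i) • Ψ i) (∑ i ∈ s, fock F (Ψ i) • Ψ i) =
      ∑ i ∈ s, fock F (Ψ i) ^ 2 := by
    rw [LinearMap.map_sum₂]
    refine Finset.sum_congr rfl fun i hi => ?_
    rw [map_smul, LinearMap.smul_apply, map_sum, Finset.sum_eq_single i, map_smul, hΨ i hi]
    · simp only [smul_eq_mul]; ring
    · intro j hj hji
      rw [map_smul, hΨ' i hi j hj hji.symm, smul_zero]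
    · exact fun h => absurd hi h
  rw [map_sub, map_sub, LinearMap.sub_apply, LinearMap.sub_apply, h1, h2,
    fock_comm (∑ i ∈ s, _) F, h1] at h
  linarith

end Fock

/-! ### Occupation number states in orthonormal modes -/

section Modes

variable {ι μ : Type*} [Fintype ι] [DecidableEq ι] [Fintype μ] [DecidableEq μ]

/-- Orthonormal real modes. -/
def OrthonormalModes (φ : μ → ι → ℝ) : Prop :=
  ∀ p q, ∑ x, φ p x * φ q x = if p = q then 1 else 0

/-- The second quantization of the map from modes to sites. -/
def modeMap (φ : μ → ι → ℝ) : MvPolynomial μ ℝ →ₐ[ℝ] MvPolynomial ι ℝ :=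
  aeval fun p => ∑ x, φ p x • X x

lemma modeMap_X (φ : μ → ι → ℝ) (p : μ) : modeMap φ (X p) = ∑ x, φ p x • X x := by
  simp [modeMap]

lemma pderiv_modeMap (φ : μ → ι → ℝ) (x : ι) (f : MvPolynomial μ ℝ) :
    pderiv x (modeMap φ f) = modeMap φ (∑ p, φ p x • pderiv p f) := by
  induction f using MvPolynomial.induction_on with
  | C a =>
    have : modeMap φ (C a) = C a := (modeMap φ).commutes a
    rw [this]; simp
  | add f g hf hg =>
    simp only [map_add, hf, hg, smul_add, Finset.sum_add_distrib]
  | mul_X f p hf =>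
    have h1 : pderiv x (modeMap φ (X p)) = C (φ p x) := by
      rw [modeMap_X, map_sum, Finset.sum_eq_single x]
      · rw [Derivation.map_smul, pderiv_X_self, smul_eq_C_mul, mul_one]
      · intro y _ hy; rw [Derivation.map_smul, pderiv_X_of_ne hy, smul_zero]
      · simp
    have h2 : modeMap φ (C (φ p x)) = C (φ p x) := (modeMap φ).commutes _
    have h3 : ∑ q, φ q x • pderiv q (f * X p) = (∑ q, φ q x • pderiv q f) * X p + f * C (φ p x) := by
      simp only [pderiv_mul, smul_add, Finset.sum_add_distrib]
      congr 1
      · rw [Finset.sum_mul]; exact Finset.sum_congr rfl fun q _ => by rw [smul_mul_assoc]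
      · rw [Finset.sum_eq_single p]
        · rw [pderiv_X_self, mul_one, smul_eq_C_mul, mul_comm]
        · intro q _ hq; rw [pderiv_X_of_ne hq.symm, mul_zero, smul_zero]
        · simp
    rw [map_mul, pderiv_mul, hf, h1, h3, map_add, map_mul, map_mul, h2]

lemma constantCoeff_modeMap (φ : μ → ι → ℝ) (f : MvPolynomial μ ℝ) :
    coeff 0 (modeMap φ f) = coeff 0 f := by
  rw [← constantCoeff_eq, ← constantCoeff_eq]
  induction f using MvPolynomial.induction_on with
  | C a => 
    have : modeMap φ (C a) = C a := (modeMap φ).commutes a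
    rw [this]; simp
  | add f g hf hg => rw [map_add, map_add, map_add, hf, hg]
  | mul_X f p hf => rw [map_mul, map_mul, map_mul, hf, modeMap_X]; simp [constantCoeff_X, constantCoeff_eq]

/-- Induction on f: moving a mode variable across as a derivative produces, by the chain rule, ∑_x
φ_p(x) φ_q(x) ∂_q g, and orthonormality leaves ∂_p g. The right argument must therefore be general.
-/
lemma fock_modeMap {φ : μ → ι → ℝ} (hφ : OrthonormalModes φ) (f g : MvPolynomial μ ℝ) :
    fock (modeMap φ f) (modeMap φ g) = fock f g := by
  induction f using MvPolynomial.induction_on generalizing g with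
  | C a =>
    have : modeMap φ (C a) = C a := (modeMap φ).commutes a
    rw [this, C_apply, C_apply, fock_monomial_left, fock_monomial_left, constantCoeff_modeMap]
    simp [multiFact]
  | add f f' hf hf' => simp only [map_add, LinearMap.add_apply, hf, hf']
  | mul_X f p hf =>
    rw [map_mul, modeMap_X, mul_comm, Finset.sum_mul, LinearMap.map_sum₂, mul_comm f, fock_X_mul,
      ← hf]
    have : ∀ x, fock (φ p x • X x * modeMap φ f) (modeMap φ g) =
        ∑ q, (φ p x * φ q x) * fock (modeMap φ f) (modeMap φ (pderiv q g)) := by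
      intro x
      rw [smul_mul_assoc, map_smul, LinearMap.smul_apply, fock_X_mul, pderiv_modeMap, map_sum,
        map_sum, smul_eq_mul, Finset.mul_sum]
      refine Finset.sum_congr rfl fun q _ => ?_
      rw [map_smul, map_smul, smul_eq_mul, mul_assoc]
    simp only [this]
    rw [Finset.sum_comm]
    simp only [← Finset.sum_mul, hφ p]
    simp

/-- The unnormalized occupation number states. -/
abbrev occ (m : μ →₀ ℕ) : MvPolynomial μ ℝ := monomial m 1

lemma fock_occ_self (m : μ →₀ ℕ) : fock (occ m) (occ m) = multiFact m := by
  simp [occ, fock_monomial_left]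

lemma fock_occ_of_ne {m m' : μ →₀ ℕ} (h : m ≠ m') : fock (occ m) (occ m') = 0 := by
  simp [occ, fock_monomial_left, coeff_monomial, h.symm]

lemma fock_pderiv_occ (m : μ →₀ ℕ) (p q : μ) :
    fock (pderiv p (occ m)) (pderiv q (occ m)) = if p = q then m p * multiFact m else 0 := by
  split_ifs with h
  · subst h
    rw [← fock_X_mul, X_mul_pderiv_monomial, map_nsmul, LinearMap.smul_apply, fock_occ_self,
      nsmul_eq_mul]
  · rw [pderiv_monomial, pderiv_monomial, fock_monomial_left, coeff_monomial]
    split_ifs with h2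
    · by_cases hp : m p = 0
      · simp [hp]
      by_cases hq : m q = 0
      · simp [hq]
      exfalso
      have h3 := DFunLike.congr_fun h2 p
      simp [Ne.symm h] at h3
      omega
    · simp

lemma pderiv_pderiv_comm (p q : μ) (f : MvPolynomial μ ℝ) :
    pderiv p (pderiv q f) = pderiv q (pderiv p f) := by
  ext α
  simp only [coeff_pderiv]
  rw [add_right_comm]
  by_cases h : p = q
  · subst h; rfl
  · simp [h, Ne.symm h]; ring

lemma fock_pderiv_pderiv_occ_self_le (m : μ →₀ ℕ) (p q : μ) :
    fock (pderiv p (pderiv q (occ m))) (pderiv p (pderiv q (occ m))) ≤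
      m p * m q * multiFact m := by
  rw [← fock_X_mul, pderiv_monomial (i := q), X_mul_pderiv_monomial, map_nsmul,
    LinearMap.smul_apply, ← pderiv_monomial, fock_pderiv_occ, if_pos rfl, nsmul_eq_mul, ← mul_assoc]
  have : (m - Finsupp.single q 1 : μ →₀ ℕ) p ≤ m p := by simp
  have h0 := (multiFact_pos m).le
  gcongr

/-- Both sides are multiples of monomials. If the exponents agree, restoring the removed quanta
shows that the two unordered pairs of modes agree, unless a coefficient already vanishes. -/
lemma fock_pderiv_pderiv_occ_of_ne (m : μ →₀ ℕ) {p q p' q' : μ}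
    (h : (p', q') ≠ (p, q) ∧ (p', q') ≠ (q, p)) :
    fock (pderiv p (pderiv q (occ m))) (pderiv p' (pderiv q' (occ m))) = 0 := by
  simp only [pderiv_monomial, fock_monomial_left, coeff_monomial]
  split_ifs with h2
  · by_contra hne
    simp only [one_mul, mul_eq_zero, not_or, Nat.cast_eq_zero] at hne
    obtain ⟨⟨_, hq, hp⟩, hq', hp'⟩ := hne
    have key : ∀ {a b : μ}, m b ≠ 0 → (m - Finsupp.single b 1 : μ →₀ ℕ) a ≠ 0 →
        m - Finsupp.single b 1 - Finsupp.single a 1 + (Finsupp.single a 1 + Finsupp.single b 1) =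
          m := by
      intro a b hb ha
      rw [← add_assoc, Finsupp.sub_add_single_one_cancel ha, Finsupp.sub_add_single_one_cancel hb]
    have e1 := key hq hp
    have e2 := key hq' hp'
    rw [h2] at e2
    have e3 := add_left_cancel (e2.trans e1.symm)
    rw [Finsupp.single_add_single_eq_single_add_single one_ne_zero one_ne_zero] at e3
    rcases e3 with ⟨r1, r2⟩ | ⟨_, r1, r2⟩ | ⟨r, _⟩
    · exact h.1 (by rw [r1, r2])
    · exact h.2 (by rw [r1, r2])
    · exact absurd r (by norm_num)
  · simp

/-- The two-body density at a site is at most twice the square of the one-body density. -/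
lemma fock_pderiv_pderiv_modeMap_occ_le {φ : μ → ι → ℝ} (hφ : OrthonormalModes φ) (m : μ →₀ ℕ)
    (x : ι) :
    fock (pderiv x (pderiv x (modeMap φ (occ m)))) (pderiv x (pderiv x (modeMap φ (occ m)))) ≤
      2 * (∑ p, φ p x ^ 2 * m p) ^ 2 * multiFact m := by
  set v : μ × μ → MvPolynomial μ ℝ := fun i =>
    (φ i.1 x * φ i.2 x) • pderiv i.1 (pderiv i.2 (occ m)) with hv
  have h1 : pderiv x (pderiv x (modeMap φ (occ m))) = modeMap φ (∑ i, v i) := by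
    rw [pderiv_modeMap, pderiv_modeMap, Fintype.sum_prod_type]
    congr 1
    refine Finset.sum_congr rfl fun p _ => ?_
    rw [map_sum, Finset.smul_sum]
    refine Finset.sum_congr rfl fun q _ => ?_
    rw [Derivation.map_smul, smul_smul]
  have hswap : ∀ i, v i.swap = v i := by
    intro i
    simp only [hv, Prod.fst_swap, Prod.snd_swap]
    rw [pderiv_pderiv_comm, mul_comm]
  -- Only the direct term j = i and the exchange term j = i.swap survive. When they coincide the
  -- term is counted twice, which is harmless for an upper bound. This is the origin of the factor
  -- 2.
  have hle : ∀ i j, fock (v i) (v j) ≤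
      (if j = i then fock (v i) (v i) else 0) + if j = i.swap then fock (v i) (v i) else 0 := by
    intro i j
    have h0 := fock_self_nonneg (v i)
    by_cases hj : j = i
    · rw [hj, if_pos rfl]; split_ifs <;> linarith
    · by_cases hj' : j = i.swap
      · rw [hj', hswap, if_pos rfl]; split_ifs <;> linarith
      · rw [if_neg hj, if_neg hj']
        simp only [hv, map_smul, LinearMap.smul_apply]
        rw [fock_pderiv_pderiv_occ_of_ne m ⟨hj, hj'⟩]; simp
  rw [h1, fock_modeMap hφ, LinearMap.map_sum₂]
  calc ∑ i, fock (v i) (∑ j, v j) ≤ ∑ i, 2 * fock (v i) (v i) := by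
        refine Finset.sum_le_sum fun i _ => ?_
        rw [map_sum]
        refine (Finset.sum_le_sum fun j _ => hle i j).trans (le_of_eq ?_)
        rw [Finset.sum_add_distrib, Finset.sum_ite_eq', Finset.sum_ite_eq']
        simp; ring
    _ ≤ ∑ i : μ × μ, 2 * ((φ i.1 x ^ 2 * m i.1) * (φ i.2 x ^ 2 * m i.2) * multiFact m) := by
        refine Finset.sum_le_sum fun i _ => ?_
        simp only [hv, map_smul, LinearMap.smul_apply, smul_eq_mul]
        have := fock_pderiv_pderiv_occ_self_le m i.1 i.2
        calc _ = 2 * ((φ i.1 x * φ i.2 x) ^ 2 * _) := by rw [sq, mul_assoc (φ i.1 x * φ i.2 x)]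
          _ ≤ 2 * ((φ i.1 x * φ i.2 x) ^ 2 * (m i.1 * m i.2 * multiFact m)) := by gcongr
          _ = _ := by ring
    _ = _ := by
        rw [Fintype.sum_prod_type, sq (∑ p, _), Finset.sum_mul_sum, Finset.mul_sum, Finset.sum_mul]
        refine Finset.sum_congr rfl fun p _ => ?_
        rw [Finset.mul_sum, Finset.sum_mul]
        exact Finset.sum_congr rfl fun q _ => by ring

/-- The expectation of a one-body quadratic form in an occupation number state. -/
lemma fock_modeMap_form {φ : μ → ι → ℝ} (hφ : OrthonormalModes φ) (m : μ →₀ ℕ) (c : ι → ℝ) :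
    fock (∑ x, c x • pderiv x (modeMap φ (occ m))) (∑ x, c x • pderiv x (modeMap φ (occ m))) =
      (∑ p, m p * (∑ x, c x * φ p x) ^ 2) * multiFact m := by
  have h1 : ∑ x, c x • pderiv x (modeMap φ (occ m)) =
      modeMap φ (∑ p, (∑ x, c x * φ p x) • pderiv p (occ m)) := by
    simp only [pderiv_modeMap, map_sum, map_smul, Finset.smul_sum, smul_smul, Finset.sum_smul]
    rw [Finset.sum_comm]
  rw [h1, fock_modeMap hφ, LinearMap.map_sum₂, Finset.sum_mul]
  refine Finset.sum_congr rfl fun p _ => ?_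
  rw [map_smul, LinearMap.smul_apply, map_sum, Finset.sum_eq_single p]
  · rw [map_smul, fock_pderiv_occ, if_pos rfl, smul_eq_mul, smul_eq_mul]; ring
  · intro q _ hq
    rw [map_smul, fock_pderiv_occ, if_neg hq.symm, smul_zero]
  · simp

end Modes

end Heisenberg2D

end

noncomputable section

namespace Heisenberg2D

open MvPolynomial Matrix
open scoped ComplexOrder

/-! ### From bosons to spins: z^α becomes ∏ (S⁺_x/√N)^(α_x) on the vacuum -/

section HolsteinPrimakoff

variable {ι : Type*} [Fintype ι] [DecidableEq ι] {N : ℕ}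

/-- The squared norm `n! ∏_{j < n} (1 - j / N)` of the spin state that represents `z ^ n`. -/
def siteWeight (N n : ℕ) : ℝ := (Nat.factorial n : ℝ) * (N.descFactorial n : ℝ) / (N : ℝ) ^ n

lemma siteWeight_nonneg (N n : ℕ) : 0 ≤ siteWeight N n := by unfold siteWeight; positivity

lemma siteWeight_succ (hN : 1 ≤ N) {n : ℕ} (hn : n ≤ N) :
    siteWeight N (n + 1) = siteWeight N n * ((n + 1) * ((N - n) / N)) := by
  have hN' : (N : ℝ) ≠ 0 := by positivity
  rw [siteWeight, siteWeight, Nat.factorial_succ, Nat.descFactorial_succ, pow_succ]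
  push_cast [Nat.cast_sub hn]
  field_simp

lemma siteWeight_le (hN : 1 ≤ N) (n : ℕ) : siteWeight N n ≤ Nat.factorial n := by
  have hN' : (0 : ℝ) < N := by exact_mod_cast hN
  rw [siteWeight, div_le_iff₀ (by positivity)]
  have : (N.descFactorial n : ℝ) ≤ (N : ℝ) ^ n := by exact_mod_cast Nat.descFactorial_le_pow N n
  gcongr

/-- The product ∏_{j<n} (1 - j/N) is at least 1 - ∑_{j<n} j/N; the induction discards a nonnegative
remainder at each step. -/
lemma le_siteWeight (hN : 1 ≤ N) {n : ℕ} (hn : n ≤ N) :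
    (Nat.factorial n : ℝ) * (1 - (n : ℝ) * (n - 1) / (2 * N)) ≤ siteWeight N n := by
  have hN' : (0 : ℝ) < N := by exact_mod_cast hN
  induction n with
  | zero => simp [siteWeight]
  | succ n ih =>
    have hn' : n ≤ N := by omega
    have hnN : (n : ℝ) + 1 ≤ N := by exact_mod_cast hn
    rw [siteWeight_succ hN hn']
    have h1 := mul_le_mul_of_nonneg_right (ih hn')
      (show (0 : ℝ) ≤ (n + 1) * ((N - n) / N) by
        have : (0 : ℝ) ≤ N - n := by linarith
        positivity)
    refine le_trans ?_ h1
    rw [Nat.factorial_succ]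
    push_cast
    have h2 : (1 - ((n : ℝ) + 1) * (n + 1 - 1) / (2 * N)) ≤
        (1 - (n : ℝ) * (n - 1) / (2 * N)) * ((N - n) / N) := by
      have h3 : (1 - (n : ℝ) * (n - 1) / (2 * N)) * ((N - n) / N) -
          (1 - ((n : ℝ) + 1) * (n + 1 - 1) / (2 * N)) = n * (n * (n - 1)) / (2 * N * N) := by
        field_simp; ring
      have h4 : (0 : ℝ) ≤ n * (n - 1) := by
        rcases Nat.eq_zero_or_pos n with rfl | h
        · simp
        · have : (1 : ℝ) ≤ n := by exact_mod_cast h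
          nlinarith
      have : 0 ≤ n * ((n : ℝ) * (n - 1)) / (2 * N * N) := by positivity
      linarith
    calc _ = ((n : ℝ) + 1) * Nat.factorial n * (1 - ((n : ℝ) + 1) * (n + 1 - 1) / (2 * N)) := by ring
      _ ≤ ((n : ℝ) + 1) * Nat.factorial n *
          ((1 - (n : ℝ) * (n - 1) / (2 * N)) * ((N - n) / N)) := by gcongr
      _ = _ := by ring

/-- The exponent of the monomial that corresponds to a spin configuration. -/
def expo (σ : ι → Fin (N + 1)) : ι →₀ ℕ := Finsupp.equivFunOnFinite.symm fun x => (σ x : ℕ)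

lemma expo_apply (σ : ι → Fin (N + 1)) (x : ι) : expo σ x = σ x := rfl

lemma expo_injective : Function.Injective (expo : (ι → Fin (N + 1)) → ι →₀ ℕ) := by
  intro σ τ h
  ext x
  exact DFunLike.congr_fun h x

/-- The product of the site weights. -/
def configWeight (N : ℕ) (α : ι →₀ ℕ) : ℝ := ∏ x, siteWeight N (α x)

lemma configWeight_nonneg (α : ι →₀ ℕ) : 0 ≤ configWeight N α :=
  Finset.prod_nonneg fun _ _ => siteWeight_nonneg _ _

lemma configWeight_le (hN : 1 ≤ N) (α : ι →₀ ℕ) : configWeight N α ≤ multiFact α :=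
  Finset.prod_le_prod (fun _ _ => siteWeight_nonneg _ _) fun _ _ => siteWeight_le hN _

lemma configWeight_add_single (hN : 1 ≤ N) (α : ι →₀ ℕ) (x : ι) (hx : α x ≤ N) :
    configWeight N (α + Finsupp.single x 1) =
      configWeight N α * ((α x + 1) * ((N - α x) / N)) := by
  rw [configWeight, configWeight, ← Finset.mul_prod_erase _ _ (Finset.mem_univ x),
    ← Finset.mul_prod_erase _ (fun y => siteWeight N (α y)) (Finset.mem_univ x)]
  have h1 : ∏ y ∈ Finset.univ.erase x, siteWeight N ((α + Finsupp.single x 1 : ι →₀ ℕ) y) =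
      ∏ y ∈ Finset.univ.erase x, siteWeight N (α y) := by
    refine Finset.prod_congr rfl fun y hy => ?_
    simp [Finsupp.single_eq_of_ne (Finset.ne_of_mem_erase hy)]
  rw [h1]
  simp only [Finsupp.add_apply, Finsupp.single_eq_same, siteWeight_succ hN hx]
  ring

lemma one_sub_sum_le_prod {κ : Type*} (s : Finset κ) (a : κ → ℝ) (h0 : ∀ i ∈ s, 0 ≤ a i)
    (h1 : ∀ i ∈ s, a i ≤ 1) : 1 - ∑ i ∈ s, (1 - a i) ≤ ∏ i ∈ s, a i := by
  classical
  induction s using Finset.induction_on with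
  | empty => simp
  | insert j s hj ih =>
    rw [Finset.sum_insert hj, Finset.prod_insert hj]
    have ih' := ih (fun i hi => h0 i (Finset.mem_insert_of_mem hi))
      fun i hi => h1 i (Finset.mem_insert_of_mem hi)
    have ha0 := h0 j (Finset.mem_insert_self _ _)
    have ha1 := h1 j (Finset.mem_insert_self _ _)
    have hs : 0 ≤ ∑ i ∈ s, (1 - a i) :=
      Finset.sum_nonneg fun i hi => sub_nonneg.mpr (h1 i (Finset.mem_insert_of_mem hi))
    nlinarith [mul_le_mul_of_nonneg_left ih' ha0]

lemma le_configWeight (hN : 1 ≤ N) (α : ι →₀ ℕ) :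
    multiFact α * (1 - ∑ x, (α x : ℝ) * (α x - 1) / (2 * N)) ≤ configWeight N α := by
  have hN' : (0 : ℝ) < N := by exact_mod_cast hN
  have hterm : ∀ n : ℕ, (0 : ℝ) ≤ n * (n - 1) / (2 * N) := by
    intro n
    rcases Nat.eq_zero_or_pos n with rfl | h
    · simp
    · have : (0 : ℝ) ≤ n - 1 := by
        have : (1 : ℝ) ≤ n := by exact_mod_cast h
        linarith
      positivity
  by_cases hα : ∀ x, α x ≤ N
  · have hcw : configWeight N α = multiFact α * ∏ x, (siteWeight N (α x) / Nat.factorial (α x)) := by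
      rw [multiFact, configWeight, ← Finset.prod_mul_distrib]
      refine Finset.prod_congr rfl fun x _ => ?_
      field_simp
    rw [hcw]
    refine mul_le_mul_of_nonneg_left ?_ (multiFact_pos α).le
    refine le_trans ?_ (one_sub_sum_le_prod Finset.univ _ (fun x _ => ?_) (fun x _ => ?_))
    · refine sub_le_sub_left (Finset.sum_le_sum fun x _ => ?_) _
      have := le_siteWeight hN (hα x)
      rw [sub_le_comm, le_div_iff₀ (by positivity)]
      linarith
    · exact div_nonneg (siteWeight_nonneg _ _) (by positivity)
    · exact div_le_one_of_le₀ (siteWeight_le hN _) (by positivity)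
  -- An occupation above N makes the left side nonpositive, since α_x(α_x - 1) ≥ (N + 1)N ≥ 2N.
  · push Not at hα
    obtain ⟨x, hx⟩ := hα
    refine le_trans ?_ (configWeight_nonneg α)
    refine mul_nonpos_of_nonneg_of_nonpos (multiFact_pos α).le ?_
    have h1 := Finset.single_le_sum (f := fun x => (α x : ℝ) * (α x - 1) / (2 * N))
      (fun x _ => hterm _) (Finset.mem_univ x)
    have h2 : (1 : ℝ) ≤ (α x : ℝ) * (α x - 1) / (2 * N) := by
      rw [le_div_iff₀ (by positivity)]
      have h3 : (N : ℝ) + 1 ≤ α x := by exact_mod_cast hx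
      have h4 : (1 : ℝ) ≤ N := by exact_mod_cast hN
      nlinarith
    linarith

/-- The spin state represented by a polynomial (a truncated Holstein–Primakoff map). -/
def spinVec (N : ℕ) (F : MvPolynomial ι ℝ) (σ : ι → Fin (N + 1)) : ℂ :=
  ((Real.sqrt (configWeight N (expo σ)) * coeff (expo σ) F : ℝ) : ℂ)

lemma sum_config_le_fock (F : MvPolynomial ι ℝ) (b : (ι → Fin (N + 1)) → ℝ)
    (hb : ∀ σ, b σ ≤ multiFact (expo σ)) :
    ∑ σ : ι → Fin (N + 1), b σ * coeff (expo σ) F ^ 2 ≤ fock F F := by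
  classical
  rw [fock_eq_sum F F _ (Finset.subset_union_left (s₂ := Finset.univ.image
    (expo : (ι → Fin (N + 1)) → ι →₀ ℕ)))]
  calc _ ≤ ∑ σ : ι → Fin (N + 1), multiFact (expo σ) * coeff (expo σ) F * coeff (expo σ) F := by
        refine Finset.sum_le_sum fun σ _ => ?_
        rw [mul_assoc, ← sq]
        exact mul_le_mul_of_nonneg_right (hb σ) (sq_nonneg _)
    _ = ∑ α ∈ Finset.univ.image (expo : (ι → Fin (N + 1)) → ι →₀ ℕ),
        multiFact α * coeff α F * coeff α F := by
        rw [Finset.sum_image expo_injective.injOn]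
    _ ≤ _ := by
        refine Finset.sum_le_sum_of_subset_of_nonneg Finset.subset_union_right fun α _ _ => ?_
        rw [mul_assoc]
        exact mul_nonneg (multiFact_pos α).le (mul_self_nonneg _)

lemma vecNormSq_spinVec (F : MvPolynomial ι ℝ) :
    vecNormSq (spinVec N F) = ∑ σ : ι → Fin (N + 1), configWeight N (expo σ) * coeff (expo σ) F ^ 2 := by
  refine Finset.sum_congr rfl fun σ _ => ?_
  rw [spinVec, Complex.norm_real, Real.norm_eq_abs, sq_abs, mul_pow,
    Real.sq_sqrt (configWeight_nonneg _)]

/-- The squared norm lost is at most the expected number of ordered pairs on a common site, divided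
by 2N. -/
lemma le_vecNormSq_spinVec (hN : 1 ≤ N) (F : MvPolynomial ι ℝ) :
    fock F F - 1 / (2 * N) * ∑ x, fock (pderiv x (pderiv x F)) (pderiv x (pderiv x F)) ≤
      vecNormSq (spinVec N F) := by
  classical
  have h1 : fock F F - 1 / (2 * N) * ∑ x, fock (pderiv x (pderiv x F)) (pderiv x (pderiv x F)) =
      ∑ α ∈ F.support, multiFact α * (1 - ∑ x, (α x : ℝ) * (α x - 1) / (2 * N)) *
        coeff α F ^ 2 := by
    simp only [fock_pderiv_pderiv]
    rw [fock_apply, Finset.sum_comm, Finset.mul_sum, ← Finset.sum_sub_distrib]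
    refine Finset.sum_congr rfl fun α _ => ?_
    rw [← Finset.sum_div, ← Finset.mul_sum]
    ring
  rw [h1, vecNormSq_spinVec, ← Finset.sum_image (f := fun α => configWeight N α * coeff α F ^ 2)
    expo_injective.injOn]
  calc _ ≤ ∑ α ∈ F.support, configWeight N α * coeff α F ^ 2 :=
        Finset.sum_le_sum fun α _ => mul_le_mul_of_nonneg_right (le_configWeight hN α) (sq_nonneg _)
    _ = ∑ α ∈ F.support ∩ Finset.univ.image (expo : (ι → Fin (N + 1)) → ι →₀ ℕ),
        configWeight N α * coeff α F ^ 2 := by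
        symm
        -- Exponents that are not spin configurations exceed N somewhere, and there the falling
        -- factorial vanishes.
        refine Finset.sum_subset Finset.inter_subset_left fun α hα hα' => ?_
        have h2 : ∃ x, N < α x := by
          by_contra! h
          refine hα' (Finset.mem_inter.mpr ⟨hα, Finset.mem_image.mpr
            ⟨fun x => ⟨α x, Nat.lt_succ_of_le (h x)⟩, Finset.mem_univ _, ?_⟩⟩)
          ext x; rfl
        obtain ⟨x, hx⟩ := h2
        rw [configWeight, Finset.prod_eq_zero (Finset.mem_univ x), zero_mul]
        rw [siteWeight, Nat.descFactorial_of_lt hx]; simp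
    _ ≤ _ := Finset.sum_le_sum_of_subset_of_nonneg Finset.inter_subset_right fun α _ _ =>
        mul_nonneg (configWeight_nonneg α) (sq_nonneg _)

/-- The weight recursion turns √(n + 1) into (n + 1) √((N - n)/N), and the factor n + 1 is the one
that differentiation produces. At n = N both sides vanish, so the truncation causes no error. -/
lemma annihMat_mulVec_spinVec (hN : 1 ≤ N) (F : MvPolynomial ι ℝ) (x : ι)
    (σ : ι → Fin (N + 1)) :
    (localOp x (annihMat N) *ᵥ spinVec N F) σ =
      ((Real.sqrt (((N : ℝ) - σ x) / N) * (Real.sqrt (configWeight N (expo σ)) *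
        coeff (expo σ) (pderiv x F)) : ℝ) : ℂ) := by
  have hσ := (σ x).is_le
  have hσ' : ((σ x : ℕ) : ℝ) ≤ N := by exact_mod_cast hσ
  rw [localOp_mulVec]
  rcases hσ.lt_or_eq with h | h
  · rw [Finset.sum_eq_single ⟨(σ x : ℕ) + 1, by omega⟩]
    · rw [annihMat, if_pos rfl, spinVec, ← Complex.ofReal_mul, coeff_pderiv]
      have he : expo (Function.update σ x ⟨(σ x : ℕ) + 1, by omega⟩) =
          expo σ + Finsupp.single x 1 := by
        ext y
        by_cases hy : y = x
        · subst hy; simp [expo_apply]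
        · simp [expo_apply, hy]
      rw [he, configWeight_add_single hN _ _ (by rw [expo_apply]; exact hσ), expo_apply,
        Real.sqrt_mul (configWeight_nonneg _), Real.sqrt_mul (by positivity)]
      congr 1
      have : Real.sqrt (((σ x : ℕ) : ℝ) + 1) * Real.sqrt (((σ x : ℕ) : ℝ) + 1) = (σ x : ℕ) + 1 :=
        Real.mul_self_sqrt (by positivity)
      linear_combination (Real.sqrt (configWeight N (expo σ)) * Real.sqrt ((N - ((σ x : ℕ) : ℝ)) / N)
        * coeff (expo σ + Finsupp.single x 1) F) * this
    · intro b _ hb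
      rw [annihMat, if_neg, zero_mul]
      intro h'; apply hb; ext; exact h'
    · simp
  · rw [Finset.sum_eq_zero]
    · simp [h]
    · intro b _
      rw [annihMat, if_neg, zero_mul]
      have := b.is_lt
      omega

lemma holeMat_mulVec (x : ι) (v : (ι → Fin (N + 1)) → ℂ) (σ : ι → Fin (N + 1)) :
    (localOp x (holeMat N) *ᵥ v) σ = ((Real.sqrt ((N : ℝ) - σ x) : ℝ) : ℂ) * v σ := by
  rw [localOp_mulVec, Finset.sum_eq_single (σ x)]
  · simp [holeMat]
  · intro b _ hb; simp [holeMat, diagonal_apply_ne _ hb.symm]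
  · simp

/-- The point of the weights: √(N - n_x) from one site and √((N - n_y)/N) from the other combine
into a factor symmetric in x and y. Both terms share it, and only the difference of derivatives
remains. -/
lemma singletOp_mulVec_spinVec (hN : 1 ≤ N) (F : MvPolynomial ι ℝ) {x y : ι} (hxy : x ≠ y)
    (σ : ι → Fin (N + 1)) :
    (singletOp N x y *ᵥ spinVec N F) σ =
      ((Real.sqrt (((N : ℝ) - σ x) * ((N - σ y) / N)) * (Real.sqrt (configWeight N (expo σ)) *
        coeff (expo σ) (pderiv y F - pderiv x F)) : ℝ) : ℂ) := by
  have hσx : ((σ x : ℕ) : ℝ) ≤ N := by exact_mod_cast (σ x).is_le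
  have hσy : ((σ y : ℕ) : ℝ) ≤ N := by exact_mod_cast (σ y).is_le
  rw [singletOp, sub_mulVec, Pi.sub_apply, pairOp, pairOp, localOp_comm hxy (annihMat N),
    ← mulVec_mulVec, ← mulVec_mulVec, holeMat_mulVec, holeMat_mulVec,
    annihMat_mulVec_spinVec hN, annihMat_mulVec_spinVec hN, ← Complex.ofReal_mul,
    ← Complex.ofReal_mul, ← Complex.ofReal_sub]
  congr 1
  have e1 : Real.sqrt (((N : ℝ) - (σ x : ℕ)) * ((N - (σ y : ℕ)) / N)) =
      Real.sqrt ((N : ℝ) - (σ x : ℕ)) * Real.sqrt ((N - (σ y : ℕ)) / N) :=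
    Real.sqrt_mul (by linarith) _
  have e2 : Real.sqrt (((N : ℝ) - (σ x : ℕ)) * ((N - (σ y : ℕ)) / N)) =
      Real.sqrt ((N : ℝ) - (σ y : ℕ)) * Real.sqrt ((N - (σ x : ℕ)) / N) := by
    rw [← Real.sqrt_mul (by linarith)]
    congr 1; ring
  rw [coeff_sub, mul_sub, mul_sub]
  nth_rw 2 [e2]
  rw [e1]
  ring

lemma quadratic_conjTranspose_mul_self {n : Type*} [Fintype n] [DecidableEq n] (A : Matrix n n ℂ) (v : n → ℂ) :
    (star v ⬝ᵥ (Aᴴ * A) *ᵥ v) = (vecNormSq (A *ᵥ v) : ℝ) := by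
  rw [vecNormSq_eq, ← mulVec_mulVec, dotProduct_mulVec, ← star_mulVec]

lemma vecNormSq_ofReal {n : Type*} [Fintype n] [DecidableEq n] (v : n → ℝ) :
    vecNormSq (fun k => (v k : ℂ)) = ∑ k, v k ^ 2 := by
  simp [vecNormSq]

/-- Both (N - n_x)(N - n_y)/N² ≤ 1 and the weight bounded by α! go in the favourable direction, so
the interaction between magnons is dropped at no cost. -/
lemma bondOp_energy_le (hN : 1 ≤ N) (F : MvPolynomial ι ℝ) {x y : ι} (hxy : x ≠ y) :
    (star (spinVec N F) ⬝ᵥ bondOp N x y *ᵥ spinVec N F).re ≤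
      (N : ℝ) / 2 * fock (pderiv x F - pderiv y F) (pderiv x F - pderiv y F) := by
  have hN' : (0 : ℝ) < N := by exact_mod_cast hN
  rw [bondOp_eq N hxy, smul_mulVec, dotProduct_smul, quadratic_conjTranspose_mul_self,
    funext (singletOp_mulVec_spinVec hN F hxy), vecNormSq_ofReal]
  have h1 : ((1 / 2 : ℂ) • ((∑ σ : ι → Fin (N + 1), (Real.sqrt (((N : ℝ) - σ x) * ((N - σ y) / N)) *
      (Real.sqrt (configWeight N (expo σ)) * coeff (expo σ) (pderiv y F - pderiv x F))) ^ 2 : ℝ) : ℂ)).re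
      = (N : ℝ) / 2 * ∑ σ : ι → Fin (N + 1), ((((N : ℝ) - σ x) * ((N - σ y) / N)) / N *
        configWeight N (expo σ)) * coeff (expo σ) (pderiv x F - pderiv y F) ^ 2 := by
    rw [smul_eq_mul, show (1 / 2 : ℂ) = ((1 / 2 : ℝ) : ℂ) by norm_num, ← Complex.ofReal_mul,
      Complex.ofReal_re, Finset.mul_sum, Finset.mul_sum]
    refine Finset.sum_congr rfl fun σ _ => ?_
    have hσx : ((σ x : ℕ) : ℝ) ≤ N := by exact_mod_cast (σ x).is_le
    have hσy : ((σ y : ℕ) : ℝ) ≤ N := by exact_mod_cast (σ y).is_le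
    rw [mul_pow, mul_pow, Real.sq_sqrt (configWeight_nonneg _), Real.sq_sqrt (mul_nonneg
      (by linarith) (div_nonneg (by linarith) hN'.le)), coeff_sub, coeff_sub]
    field_simp
    ring
  rw [h1]
  refine mul_le_mul_of_nonneg_left (sum_config_le_fock _ _ fun σ => ?_) (by positivity)
  have hσx : ((σ x : ℕ) : ℝ) ≤ N := by exact_mod_cast (σ x).is_le
  have hσy : ((σ y : ℕ) : ℝ) ≤ N := by exact_mod_cast (σ y).is_le
  have h2 : (((N : ℝ) - σ x) * ((N - σ y) / N)) / N ≤ 1 := by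
    rw [div_le_one hN']
    have h3 : ((N : ℝ) - (σ y : ℕ)) / N ≤ 1 := by
      rw [div_le_one hN']; linarith [Nat.cast_nonneg (α := ℝ) (σ y : ℕ)]
    have h4 : (0 : ℝ) ≤ (N - (σ y : ℕ)) / N := div_nonneg (by linarith) hN'.le
    nlinarith [Nat.cast_nonneg (α := ℝ) (σ x : ℕ)]
  calc _ ≤ 1 * configWeight N (expo σ) := mul_le_mul_of_nonneg_right h2 (configWeight_nonneg _)
    _ ≤ _ := by rw [one_mul]; exact configWeight_le hN _

lemma numberOp_energy_le (hN : 1 ≤ N) (F : MvPolynomial ι ℝ) (x : ι) :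
    (star (spinVec N F) ⬝ᵥ numberOp N x *ᵥ spinVec N F).re ≤ fock (pderiv x F) (pderiv x F) := by
  have hN' : (0 : ℝ) < N := by exact_mod_cast hN
  rw [numberOp_eq, quadratic_conjTranspose_mul_self, funext (annihMat_mulVec_spinVec hN F x),
    vecNormSq_ofReal, Complex.ofReal_re]
  refine le_trans (le_of_eq ?_) (sum_config_le_fock (N := N) (pderiv x F)
    (fun σ => ((N : ℝ) - σ x) / N * configWeight N (expo σ)) fun σ => ?_)
  · refine Finset.sum_congr rfl fun σ _ => ?_
    have hσx : ((σ x : ℕ) : ℝ) ≤ N := by exact_mod_cast (σ x).is_le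
    rw [mul_pow, mul_pow, Real.sq_sqrt (configWeight_nonneg _), Real.sq_sqrt
      (div_nonneg (by linarith) hN'.le)]
    ring
  · have h3 : ((N : ℝ) - (σ x : ℕ)) / N ≤ 1 := by
      rw [div_le_one hN']; linarith [Nat.cast_nonneg (α := ℝ) (σ x : ℕ)]
    calc _ ≤ 1 * configWeight N (expo σ) := mul_le_mul_of_nonneg_right h3 (configWeight_nonneg _)
      _ ≤ _ := by rw [one_mul]; exact configWeight_le hN _

lemma systemHam_energy_le (hN : 1 ≤ N) {w : ι → ι → ℝ} {d : ι → ℝ} (h : Admissible w d)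
    (F : MvPolynomial ι ℝ) :
    (star (spinVec N F) ⬝ᵥ systemHam N w d *ᵥ spinVec N F).re ≤
      (N : ℝ) / 2 * (∑ x, ∑ y, w x y * fock (pderiv x F - pderiv y F) (pderiv x F - pderiv y F)) +
        ∑ x, d x * fock (pderiv x F) (pderiv x F) := by
  simp only [systemHam, add_mulVec, dotProduct_add, Complex.add_re, sum_mulVec, dotProduct_sum,
    Complex.re_sum, smul_mulVec, dotProduct_smul, smul_eq_mul, Complex.re_ofReal_mul]
  refine add_le_add ?_ (Finset.sum_le_sum fun x _ =>
    mul_le_mul_of_nonneg_left (numberOp_energy_le hN F x) (h.3 x))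
  rw [Finset.mul_sum]
  refine Finset.sum_le_sum fun x _ => ?_
  rw [Finset.mul_sum]
  refine Finset.sum_le_sum fun y _ => ?_
  by_cases hxy : x = y
  · subst hxy; simp [h.2]
  · rw [mul_left_comm]
    exact mul_le_mul_of_nonneg_left (bondOp_energy_le hN F hxy) (h.1 x y)

/-- The adjoint of `spinVec`. -/
def spinVecAdjoint (η : (ι → Fin (N + 1)) → ℝ) : MvPolynomial ι ℝ :=
  ∑ σ, monomial (expo σ) (Real.sqrt (configWeight N (expo σ)) * η σ / multiFact (expo σ))

lemma fock_spinVecAdjoint (η : (ι → Fin (N + 1)) → ℝ) (F : MvPolynomial ι ℝ) :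
    fock (spinVecAdjoint η) F =
      ∑ σ, η σ * (Real.sqrt (configWeight N (expo σ)) * coeff (expo σ) F) := by
  rw [spinVecAdjoint, LinearMap.map_sum₂]
  refine Finset.sum_congr rfl fun σ _ => ?_
  have := (multiFact_pos (expo σ)).ne'
  rw [fock_monomial_left]
  field_simp

lemma coeff_spinVecAdjoint (η : (ι → Fin (N + 1)) → ℝ) (σ : ι → Fin (N + 1)) :
    coeff (expo σ) (spinVecAdjoint η) =
      Real.sqrt (configWeight N (expo σ)) * η σ / multiFact (expo σ) := by
  rw [spinVecAdjoint, coeff_sum, Finset.sum_eq_single σ]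
  · rw [coeff_monomial, if_pos rfl]
  · intro τ _ hτ
    rw [coeff_monomial, if_neg fun h => hτ (expo_injective h)]
  · simp

lemma fock_spinVecAdjoint_self_le (hN : 1 ≤ N) (η : (ι → Fin (N + 1)) → ℝ) :
    fock (spinVecAdjoint η) (spinVecAdjoint η) ≤ ∑ σ, η σ ^ 2 := by
  rw [fock_spinVecAdjoint]
  refine Finset.sum_le_sum fun σ _ => ?_
  have h0 := multiFact_pos (expo σ)
  rw [coeff_spinVecAdjoint]
  have h1 : η σ * (Real.sqrt (configWeight N (expo σ)) *
      (Real.sqrt (configWeight N (expo σ)) * η σ / multiFact (expo σ))) =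
      (configWeight N (expo σ) / multiFact (expo σ)) * η σ ^ 2 := by
    rw [← Real.mul_self_sqrt (configWeight_nonneg (N := N) (expo σ))]
    field_simp
    rw [Real.sqrt_sq (Real.sqrt_nonneg _)]
  rw [h1]
  exact mul_le_of_le_one_left (sq_nonneg _) (div_le_one_of_le₀ (configWeight_le hN _) h0.le)

/-- The adjoint of a contraction is a contraction, so Bessel in Fock space applies to the adjoint
image of χ. Real and imaginary parts are treated separately because the Fock space is real. -/
lemma spinVec_bessel (hN : 1 ≤ N) {I : Type*} (s : Finset I) (Ψ : I → MvPolynomial ι ℝ)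
    (hΨ : ∀ i ∈ s, fock (Ψ i) (Ψ i) = 1) (hΨ' : ∀ i ∈ s, ∀ j ∈ s, i ≠ j → fock (Ψ i) (Ψ j) = 0)
    (χ : (ι → Fin (N + 1)) → ℂ) :
    ∑ i ∈ s, ‖star χ ⬝ᵥ spinVec N (Ψ i)‖ ^ 2 ≤ vecNormSq χ := by
  have h1 : ∀ i, ‖star χ ⬝ᵥ spinVec N (Ψ i)‖ ^ 2 =
      fock (spinVecAdjoint fun σ => (χ σ).re) (Ψ i) ^ 2 +
        fock (spinVecAdjoint fun σ => (χ σ).im) (Ψ i) ^ 2 := by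
    intro i
    rw [fock_spinVecAdjoint, fock_spinVecAdjoint, ← Complex.normSq_eq_norm_sq, Complex.normSq_apply,
      dotProduct, Complex.re_sum, Complex.im_sum, sq, sq]
    congr 1
    · congr 1 <;> refine Finset.sum_congr rfl fun σ _ => ?_ <;>
        simp [spinVec]
    · rw [← neg_mul_neg]
      congr 1 <;> rw [← Finset.sum_neg_distrib] <;> refine Finset.sum_congr rfl fun σ _ => ?_ <;>
        simp [spinVec]
  have h2 : vecNormSq χ = ∑ σ, (χ σ).re ^ 2 + ∑ σ, (χ σ).im ^ 2 := by
    rw [vecNormSq, ← Finset.sum_add_distrib]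
    refine Finset.sum_congr rfl fun σ _ => ?_
    rw [← Complex.normSq_eq_norm_sq, Complex.normSq_apply, sq, sq]
  simp only [h1, Finset.sum_add_distrib]
  rw [h2]
  exact add_le_add
    ((fock_bessel s Ψ hΨ hΨ' _).trans (fock_spinVecAdjoint_self_le hN _))
    ((fock_bessel s Ψ hΨ hΨ' _).trans (fock_spinVecAdjoint_self_le hN _))

end HolsteinPrimakoff

end Heisenberg2D

end

noncomputable section

namespace Heisenberg2D

open MvPolynomial Matrix
open scoped ComplexOrder

/-! ### Variational bound from occupation number states -/

section TrialStates

variable {ι μ : Type*} [Fintype ι] [DecidableEq ι] [Fintype μ] [DecidableEq μ] {N : ℕ}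

/-- The one-magnon energy of the mode `u`. -/
def modeEnergy (N : ℕ) (w : ι → ι → ℝ) (d : ι → ℝ) (u : ι → ℝ) : ℝ :=
  (N : ℝ) / 2 * (∑ x, ∑ y, w x y * (u x - u y) ^ 2) + ∑ x, d x * u x ^ 2

lemma modeEnergy_nonneg {w : ι → ι → ℝ} {d : ι → ℝ} (h : Admissible w d) (u : ι → ℝ) :
    0 ≤ modeEnergy N w d u :=
  add_nonneg (mul_nonneg (by positivity) (Finset.sum_nonneg fun x _ => Finset.sum_nonneg fun y _ =>
    mul_nonneg (h.1 x y) (sq_nonneg _))) (Finset.sum_nonneg fun x _ => mul_nonneg (h.3 x)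
    (sq_nonneg _))

/-- The normalized Fock state with occupation numbers `m`. -/
def fockState (φ : μ → ι → ℝ) (m : μ →₀ ℕ) : MvPolynomial ι ℝ :=
  (Real.sqrt (multiFact m))⁻¹ • modeMap φ (occ m)

lemma inv_sqrt_mul_self (m : μ →₀ ℕ) :
    (Real.sqrt (multiFact m))⁻¹ * ((Real.sqrt (multiFact m))⁻¹ * multiFact m) = 1 := by
  have h := multiFact_pos m
  have h2 := Real.sqrt_pos.mpr h
  nth_rw 3 [← Real.mul_self_sqrt h.le]
  field_simp

lemma fock_fockState_self {φ : μ → ι → ℝ} (hφ : OrthonormalModes φ) (m : μ →₀ ℕ) :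
    fock (fockState φ m) (fockState φ m) = 1 := by
  simp only [fockState, map_smul, LinearMap.smul_apply, fock_modeMap hφ, fock_occ_self, smul_eq_mul]
  exact inv_sqrt_mul_self m

lemma fock_fockState_of_ne {φ : μ → ι → ℝ} (hφ : OrthonormalModes φ) {m m' : μ →₀ ℕ}
    (h : m ≠ m') : fock (fockState φ m) (fockState φ m') = 0 := by
  simp [fockState, fock_modeMap hφ, fock_occ_of_ne h]

lemma fock_fockState_form {φ : μ → ι → ℝ} (hφ : OrthonormalModes φ) (m : μ →₀ ℕ) (c : ι → ℝ) :
    fock (∑ x, c x • pderiv x (fockState φ m)) (∑ x, c x • pderiv x (fockState φ m)) =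
      ∑ p, m p * (∑ x, c x * φ p x) ^ 2 := by
  have h1 : ∑ x, c x • pderiv x (fockState φ m) =
      (Real.sqrt (multiFact m))⁻¹ • ∑ x, c x • pderiv x (modeMap φ (occ m)) := by
    rw [Finset.smul_sum]
    refine Finset.sum_congr rfl fun x _ => ?_
    rw [fockState, Derivation.map_smul, smul_comm]
  rw [h1, map_smul, map_smul, LinearMap.smul_apply, fock_modeMap_form hφ, smul_eq_mul, smul_eq_mul]
  linear_combination (∑ p, m p * (∑ x, c x * φ p x) ^ 2) * inv_sqrt_mul_self m

lemma fock_pderiv_fockState {φ : μ → ι → ℝ} (hφ : OrthonormalModes φ) (m : μ →₀ ℕ) (x : ι) :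
    fock (pderiv x (fockState φ m)) (pderiv x (fockState φ m)) = ∑ p, m p * φ p x ^ 2 := by
  have := fock_fockState_form hφ m (Pi.single x 1)
  simpa [Pi.single_apply] using this

lemma fock_pderiv_sub_fockState {φ : μ → ι → ℝ} (hφ : OrthonormalModes φ) (m : μ →₀ ℕ) (x y : ι) :
    fock (pderiv x (fockState φ m) - pderiv y (fockState φ m))
      (pderiv x (fockState φ m) - pderiv y (fockState φ m)) =
      ∑ p, m p * (φ p x - φ p y) ^ 2 := by
  have := fock_fockState_form hφ m (Pi.single x 1 - Pi.single y 1)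
  simpa [Pi.single_apply, sub_smul, sub_mul, Finset.sum_sub_distrib] using this

/-- Off-diagonal terms between modes have zero expectation in occupation number states, so the modes
need only be orthonormal, not eigenvectors. -/
lemma fockState_energy_le {φ : μ → ι → ℝ} (hφ : OrthonormalModes φ) (hN : 1 ≤ N)
    {w : ι → ι → ℝ} {d : ι → ℝ} (h : Admissible w d) (m : μ →₀ ℕ) :
    (star (spinVec N (fockState φ m)) ⬝ᵥ systemHam N w d *ᵥ spinVec N (fockState φ m)).re ≤
      ∑ p, m p * modeEnergy N w d (φ p) := by
  refine (systemHam_energy_le hN h _).trans (le_of_eq ?_)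
  simp only [fock_pderiv_fockState hφ, fock_pderiv_sub_fockState hφ, modeEnergy, mul_add,
    Finset.sum_add_distrib, Finset.mul_sum]
  congr 1
  · rw [Finset.sum_congr rfl fun x _ => Finset.sum_comm, Finset.sum_comm]
    exact Finset.sum_congr rfl fun p _ => Finset.sum_congr rfl fun x _ =>
      Finset.sum_congr rfl fun y _ => by ring
  · rw [Finset.sum_comm]
    exact Finset.sum_congr rfl fun p _ => Finset.sum_congr rfl fun x _ => by ring

/-- The density at each site is at most κ times the particle number, and the two-body density at
most twice its square; summing over sites and dividing by 2N gives the loss. -/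
lemma le_vecNormSq_fockState {φ : μ → ι → ℝ} (hφ : OrthonormalModes φ) (hN : 1 ≤ N) {κ : ℝ}
    (hκ : ∀ p x, φ p x ^ 2 ≤ κ) (m : μ →₀ ℕ) :
    1 - Fintype.card ι * (κ * ∑ p, (m p : ℝ)) ^ 2 / N ≤ vecNormSq (spinVec N (fockState φ m)) := by
  have hN' : (0 : ℝ) < N := by exact_mod_cast hN
  refine le_trans ?_ (le_vecNormSq_spinVec hN _)
  rw [fock_fockState_self hφ]
  refine sub_le_sub_left ?_ _
  have h1 : ∀ x, fock (pderiv x (pderiv x (fockState φ m))) (pderiv x (pderiv x (fockState φ m))) ≤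
      2 * (κ * ∑ p, (m p : ℝ)) ^ 2 := by
    intro x
    simp only [fockState, Derivation.map_smul, map_smul, LinearMap.smul_apply, smul_eq_mul]
    have h2 := fock_pderiv_pderiv_modeMap_occ_le hφ m x
    have h3 : ∑ p, φ p x ^ 2 * (m p : ℝ) ≤ κ * ∑ p, (m p : ℝ) := by
      rw [Finset.mul_sum]
      exact Finset.sum_le_sum fun p _ => mul_le_mul_of_nonneg_right (hκ p x) (Nat.cast_nonneg _)
    have h4 : 0 ≤ ∑ p, φ p x ^ 2 * (m p : ℝ) :=
      Finset.sum_nonneg fun p _ => mul_nonneg (sq_nonneg _) (Nat.cast_nonneg _)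
    have h5 : 0 ≤ (Real.sqrt (multiFact m))⁻¹ := by positivity
    calc _ ≤ (Real.sqrt (multiFact m))⁻¹ * ((Real.sqrt (multiFact m))⁻¹ *
          (2 * (∑ p, φ p x ^ 2 * (m p : ℝ)) ^ 2 * multiFact m)) := by gcongr
      _ = 2 * (∑ p, φ p x ^ 2 * (m p : ℝ)) ^ 2 := by
          linear_combination (2 * (∑ p, φ p x ^ 2 * (m p : ℝ)) ^ 2) * inv_sqrt_mul_self m
      _ ≤ _ := by gcongr
  calc _ ≤ 1 / (2 * (N : ℝ)) * ∑ _x : ι, 2 * (κ * ∑ p, (m p : ℝ)) ^ 2 :=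
        mul_le_mul_of_nonneg_left (Finset.sum_le_sum fun x _ => h1 x) (by positivity)
    _ = _ := by
        rw [Finset.sum_const, Finset.card_univ, nsmul_eq_mul]
        field_simp

/-- The variational lower bound on the partition function from Holstein–Primakoff trial states. -/
theorem le_systemZ_of_modes {φ : μ → ι → ℝ} (hφ : OrthonormalModes φ) (hN : 1 ≤ N)
    {w : ι → ι → ℝ} {d : ι → ℝ} (h : Admissible w d) {κ : ℝ} (hκ : ∀ p x, φ p x ^ 2 ≤ κ)
    {β δ : ℝ} (hβ : 0 ≤ β) (hδ : δ < 1) (s : Finset (μ →₀ ℕ))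
    (hs : ∀ m ∈ s, Fintype.card ι * (κ * ∑ p, (m p : ℝ)) ^ 2 / N ≤ δ) :
    (1 - δ) * ∑ m ∈ s, Real.exp (-(β / (1 - δ)) * ∑ p, m p * modeEnergy N w d (φ p)) ≤
      systemZ N w d β := by
  refine le_trans ?_ (peierls (h.isHermitian β) s (fun m => spinVec N (fockState φ m))
    (spinVec_bessel hN s _ (fun m _ => fock_fockState_self hφ m)
      fun m _ m' _ hm => fock_fockState_of_ne hφ hm))
  rw [Finset.mul_sum]
  refine Finset.sum_le_sum fun m hm => ?_
  have h1 := (sub_le_sub_left (hs m hm) 1).trans (le_vecNormSq_fockState hφ hN hκ m)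
  have h2 : 0 < 1 - δ := by linarith
  have h3 := fockState_energy_le hφ hN h m
  have h4 : 0 ≤ ∑ p, m p * modeEnergy N w d (φ p) := Finset.sum_nonneg fun p _ =>
    mul_nonneg (Nat.cast_nonneg _) (modeEnergy_nonneg h _)
  rw [smul_mulVec, dotProduct_smul, smul_eq_mul, ← Complex.ofReal_neg, Complex.re_ofReal_mul]
  generalize (star (spinVec N (fockState φ m)) ⬝ᵥ
    systemHam N w d *ᵥ spinVec N (fockState φ m)).re = e at *
  generalize ∑ p, m p * modeEnergy N w d (φ p) = E at *
  generalize vecNormSq (spinVec N (fockState φ m)) = r at *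
  refine mul_le_mul h1 (Real.exp_le_exp.mpr ?_) (Real.exp_pos _).le (h2.le.trans h1)
  -- Normalizing the trial state divides its energy by a squared norm of at least 1 - δ; this is
  -- where the inverse temperature increases.
  have h5 : β * e / r ≤ β * E / (1 - δ) :=
    div_le_div₀ (mul_nonneg hβ h4) (mul_le_mul_of_nonneg_left h3 hβ) h2 h1
  calc -(β / (1 - δ)) * E = -(β * E / (1 - δ)) := by ring
    _ ≤ -(β * e / r) := neg_le_neg h5
    _ = -β * e / r := by ring

end TrialStates

end Heisenberg2D

end

noncomputable section

namespace Heisenberg2D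

/-! ### Dirichlet eigenfunctions of the box and their energies -/

section SineModes

lemma two_sin_mul_sum_cos (θ : ℝ) (n : ℕ) :
    2 * Real.sin (θ / 2) * ∑ i ∈ Finset.range n, Real.cos (i * θ) =
      Real.sin (n * θ - θ / 2) + Real.sin (θ / 2) := by
  induction n with
  | zero => simp
  | succ n ih =>
    rw [Finset.sum_range_succ, mul_add, ih]
    push_cast
    rw [show ((n : ℝ) + 1) * θ - θ / 2 = n * θ + θ / 2 by ring, Real.sin_add, Real.sin_sub]
    ring

lemma sum_cos_eq {n : ℕ} (hn : 1 ≤ n) (r : ℤ) (hr : r ≠ 0) (h1 : -(2 * n : ℤ) < r)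
    (h2 : r < 2 * n) :
    ∑ i ∈ Finset.range n, Real.cos (i * (Real.pi * r / n)) = (1 - Real.cos (Real.pi * r)) / 2 := by
  have hn' : (0 : ℝ) < n := by exact_mod_cast hn
  set θ := Real.pi * r / n with hθ
  have hs : Real.sin (θ / 2) ≠ 0 := by
    rw [Ne, Real.sin_eq_zero_iff]
    -- A zero of the sine would make r a multiple of 2n, impossible for 0 < |r| < 2n.
    rintro ⟨j, hj⟩
    have h3 : (j : ℝ) * (2 * n) = r := by
      have := Real.pi_ne_zero
      rw [hθ] at hj
      field_simp at hj
      linarith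
    have h4 : j * (2 * n) = r := by exact_mod_cast h3
    have hn'' : (1 : ℤ) ≤ n := by exact_mod_cast hn
    rcases lt_trichotomy j 0 with hj | hj | hj
    · nlinarith
    · subst hj; simp at h4; exact hr h4.symm
    · nlinarith
  have h := two_sin_mul_sum_cos θ n
  have h5 : Real.sin (n * θ - θ / 2) = -Real.cos (Real.pi * r) * Real.sin (θ / 2) := by
    have : (n : ℝ) * θ = r * Real.pi := by rw [hθ]; field_simp
    rw [this, Real.sin_sub, Real.sin_int_mul_pi, mul_comm (r : ℝ)]
    ring
  rw [h5] at h
  have h6 : Real.sin (θ / 2) * (2 * ∑ i ∈ Finset.range n, Real.cos (i * θ)) =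
      Real.sin (θ / 2) * (1 - Real.cos (Real.pi * r)) := by linarith
  have := mul_left_cancel₀ hs h6
  linarith

/-- The Dirichlet eigenfunctions of the interval `0, …, n`. -/
def sineMode (n k : ℕ) (a : ℤ) : ℝ := Real.sqrt (2 / n) * Real.sin (a * (Real.pi * k / n))

lemma sineMode_zero (n k : ℕ) : sineMode n k 0 = 0 := by simp [sineMode]

lemma sineMode_end {n : ℕ} (hn : 1 ≤ n) (k : ℕ) : sineMode n k n = 0 := by
  have hn' : (n : ℝ) ≠ 0 := by positivity
  rw [sineMode, Int.cast_natCast, mul_div_cancel₀ _ hn', mul_comm Real.pi, Real.sin_nat_mul_pi,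
    mul_zero]

lemma sineMode_sq_le (n k : ℕ) (a : ℤ) : sineMode n k a ^ 2 ≤ 2 / n := by
  rw [sineMode, mul_pow, Real.sq_sqrt (by positivity)]
  exact mul_le_of_le_one_right (by positivity) (Real.sin_sq_le_one _)

lemma sum_sineMode {n : ℕ} (hn : 1 ≤ n) {j k : ℕ} (hj : 1 ≤ j) (hj' : j < n) (hk : 1 ≤ k)
    (hk' : k < n) :
    ∑ i ∈ Finset.range n, sineMode n j i * sineMode n k i = if j = k then 1 else 0 := by
  have hn' : (0 : ℝ) < n := by exact_mod_cast hn
  have h1 : ∀ i : ℕ, sineMode n j i * sineMode n k i =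
      1 / n * (Real.cos (i * (Real.pi * ((j : ℤ) - k : ℤ) / n)) -
        Real.cos (i * (Real.pi * ((j : ℤ) + k : ℤ) / n))) := by
    intro i
    have hsq : Real.sqrt (2 / n) * Real.sqrt (2 / n) = 2 / n := Real.mul_self_sqrt (by positivity)
    have e1 : (i : ℝ) * (Real.pi * (((j : ℤ) - k : ℤ) : ℝ) / n) =
        i * (Real.pi * j / n) - i * (Real.pi * k / n) := by push_cast; ring
    have e2 : (i : ℝ) * (Real.pi * (((j : ℤ) + k : ℤ) : ℝ) / n) =
        i * (Real.pi * j / n) + i * (Real.pi * k / n) := by push_cast; ring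
    rw [e1, e2, Real.cos_sub, Real.cos_add, sineMode, sineMode]
    push_cast
    linear_combination Real.sin (i * (Real.pi * j / n)) * Real.sin (i * (Real.pi * k / n)) * hsq
  simp only [h1]
  rw [← Finset.mul_sum, Finset.sum_sub_distrib,
    sum_cos_eq hn ((j : ℤ) + k) (by omega) (by omega) (by omega)]
  -- The integers j + k and j - k have the same parity, so for j ≠ k the two cosine sums are equal
  -- and cancel.
  have h2 : Real.cos (Real.pi * ((j : ℤ) + k : ℤ)) = Real.cos (Real.pi * ((j : ℤ) - k : ℤ)) := by
    rw [← Real.cos_add_nat_mul_two_pi (Real.pi * ((j : ℤ) - k : ℤ)) k]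
    congr 1
    push_cast
    ring
  split_ifs with hjk
  · subst hjk
    rw [h2]
    simp
    field_simp
  · rw [sum_cos_eq hn ((j : ℤ) - k) (by omega) (by omega) (by omega), h2, sub_self, mul_zero]

lemma sineMode_add (n k : ℕ) (a : ℤ) :
    sineMode n k (a + 1) + sineMode n k (a - 1) =
      2 * Real.cos (Real.pi * k / n) * sineMode n k a := by
  simp only [sineMode]
  push_cast
  rw [add_mul, sub_mul, one_mul, Real.sin_add, Real.sin_sub]
  ring

/-- Summation by parts: each squared difference is (2 - 2 cos) s_i² plus an increment of s_i² - s_i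
s_{i-1}, and this quantity vanishes at both ends. -/
lemma sum_sineMode_diff {n : ℕ} (hn : 1 ≤ n) {k : ℕ} (hk : 1 ≤ k) (hk' : k < n) :
    ∑ i ∈ Finset.range n, (sineMode n k (i + 1) - sineMode n k i) ^ 2 =
      2 - 2 * Real.cos (Real.pi * k / n) := by
  set s := sineMode n k
  have h1 : ∀ i : ℕ, (s (i + 1) - s i) ^ 2 =
      (2 - 2 * Real.cos (Real.pi * k / n)) * (s i * s i) +
        ((s (i + 1 : ℕ) ^ 2 - s (i + 1 : ℕ) * s ((i + 1 : ℕ) - 1)) - (s i ^ 2 - s i * s (i - 1))) := by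
    intro i
    have := sineMode_add n k i
    push_cast
    rw [add_sub_cancel_right]
    linear_combination (-(s i)) * this
  simp only [h1]
  rw [Finset.sum_add_distrib, ← Finset.mul_sum, sum_sineMode hn hk hk' hk hk', if_pos rfl,
    Finset.sum_range_sub (fun i : ℕ => s i ^ 2 - s i * s (i - 1))]
  rw [show s (n : ℕ) = 0 from sineMode_end hn k, show s ((0 : ℕ) : ℤ) = 0 from sineMode_zero n k]
  ring

lemma sum_Icc_int (ℓ : ℕ) (f : ℤ → ℝ) :
    ∑ a ∈ Finset.Icc (1 : ℤ) ℓ, f a = ∑ i ∈ Finset.range ℓ, f (i + 1) := by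
  symm
  refine Finset.sum_bij (fun i _ => (i : ℤ) + 1) (fun i hi => ?_) (fun i _ j _ h => ?_)
    (fun a ha => ?_) (fun _ _ => rfl)
  · rw [Finset.mem_range] at hi; rw [Finset.mem_Icc]; omega
  · omega
  · rw [Finset.mem_Icc] at ha
    exact ⟨(a - 1).toNat, by rw [Finset.mem_range]; omega, by omega⟩

lemma sum_sineMode_Icc {ℓ j k : ℕ} (hj : 1 ≤ j) (hj' : j ≤ ℓ) (hk : 1 ≤ k) (hk' : k ≤ ℓ) :
    ∑ a ∈ Finset.Icc (1 : ℤ) ℓ, sineMode (ℓ + 1) j a * sineMode (ℓ + 1) k a =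
      if j = k then 1 else 0 := by
  rw [sum_Icc_int, ← sum_sineMode (n := ℓ + 1) (by omega) hj (by omega) hk (by omega),
    Finset.sum_range_succ']
  simp [sineMode_zero]

/-- The Dirichlet energy of a function on an interval, with the boundary bonds written as fields. -/
lemma sum_sineMode_energy {ℓ k : ℕ} (hk : 1 ≤ k) (hk' : k ≤ ℓ) :
    ∑ a ∈ Finset.Icc (1 : ℤ) ℓ,
      ((if a + 1 ≤ ℓ then (sineMode (ℓ + 1) k a - sineMode (ℓ + 1) k (a + 1)) ^ 2 else 0) +
        ((if a % (ℓ + 1) = 1 then 1 else 0) + (if (a + 1) % (ℓ + 1) = 0 then 1 else 0)) *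
          sineMode (ℓ + 1) k a ^ 2) = 2 - 2 * Real.cos (Real.pi * k / (ℓ + 1 : ℕ)) := by
  have h1 : ∀ a ∈ Finset.Icc (1 : ℤ) ℓ,
      ((if a + 1 ≤ ℓ then (sineMode (ℓ + 1) k a - sineMode (ℓ + 1) k (a + 1)) ^ 2 else 0) +
        ((if a % (ℓ + 1) = 1 then 1 else 0) + (if (a + 1) % (ℓ + 1) = 0 then 1 else 0)) *
          sineMode (ℓ + 1) k a ^ 2) =
      (sineMode (ℓ + 1) k (a + 1) - sineMode (ℓ + 1) k a) ^ 2 +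
        if a = 1 then sineMode (ℓ + 1) k 1 ^ 2 else 0 := by
    intro a ha
    rw [Finset.mem_Icc] at ha
    have e1 : a % ((ℓ : ℤ) + 1) = a := Int.emod_eq_of_lt (by omega) (by omega)
    rw [e1]
    have e3 : (if a = 1 then sineMode (ℓ + 1) k 1 ^ 2 else 0) =
        (if a = 1 then (1 : ℝ) else 0) * sineMode (ℓ + 1) k a ^ 2 := by
      split_ifs with h
      · rw [h, one_mul]
      · rw [zero_mul]
    rw [e3]
    by_cases h : a + 1 ≤ ℓ
    · have e2 : (a + 1) % ((ℓ : ℤ) + 1) = a + 1 := Int.emod_eq_of_lt (by omega) (by omega)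
      rw [if_pos h, e2, if_neg (by omega : ¬ a + 1 = 0)]
      ring
    · have ha' : a = ℓ := by omega
      have e4 : sineMode (ℓ + 1) k (a + 1) = 0 := by
        rw [ha']
        exact_mod_cast sineMode_end (n := ℓ + 1) (by omega) k
      rw [if_neg h, e4, ha', Int.emod_self, if_pos rfl]
      ring
  rw [Finset.sum_congr rfl h1, Finset.sum_add_distrib, Finset.sum_ite_eq', if_pos (by
    rw [Finset.mem_Icc]; omega), ← sum_sineMode_diff (n := ℓ + 1) (by omega) hk (by omega),
    Finset.sum_range_succ', sum_Icc_int]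
  simp [sineMode_zero]

/-- Products of sines, the one-magnon modes of a square with Dirichlet boundary conditions. -/
def boxMode (ℓ : ℕ) (p : Fin ℓ × Fin ℓ) (x : square ℓ) : ℝ :=
  sineMode (ℓ + 1) (p.1 + 1) (x : ℤ × ℤ).1 * sineMode (ℓ + 1) (p.2 + 1) (x : ℤ × ℤ).2

lemma boxMode_orthonormal (ℓ : ℕ) : OrthonormalModes (boxMode ℓ) := by
  intro p q
  have h1 := sum_sineMode_Icc (ℓ := ℓ) (j := p.1 + 1) (k := q.1 + 1) (by omega) (by omega)
    (by omega) (by omega)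
  have h2 := sum_sineMode_Icc (ℓ := ℓ) (j := p.2 + 1) (k := q.2 + 1) (by omega) (by omega)
    (by omega) (by omega)
  simp only [boxMode]
  rw [Finset.sum_coe_sort (square ℓ) (fun x => sineMode (ℓ + 1) (p.1 + 1) x.1 *
    sineMode (ℓ + 1) (p.2 + 1) x.2 * (sineMode (ℓ + 1) (q.1 + 1) x.1 *
    sineMode (ℓ + 1) (q.2 + 1) x.2)), square, Finset.sum_product]
  calc _ = (∑ a ∈ Finset.Icc (1 : ℤ) ℓ, sineMode (ℓ + 1) (p.1 + 1) a *
        sineMode (ℓ + 1) (q.1 + 1) a) * ∑ b ∈ Finset.Icc (1 : ℤ) ℓ,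
        sineMode (ℓ + 1) (p.2 + 1) b * sineMode (ℓ + 1) (q.2 + 1) b := by
        rw [Finset.sum_mul_sum]
        exact Finset.sum_congr rfl fun a _ => Finset.sum_congr rfl fun b _ => by ring
    _ = _ := by
        rw [h1, h2]
        simp only [Prod.ext_iff, Fin.ext_iff, add_left_inj]
        by_cases ha : (p.1 : ℕ) = q.1 <;> by_cases hb : (p.2 : ℕ) = q.2 <;> simp [ha, hb]

lemma boxMode_sq_le (ℓ : ℕ) (p : Fin ℓ × Fin ℓ) (x : square ℓ) :
    boxMode ℓ p x ^ 2 ≤ 4 / ((ℓ : ℝ) + 1) ^ 2 := by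
  rw [boxMode, mul_pow]
  calc _ ≤ (2 / ((ℓ + 1 : ℕ) : ℝ)) * (2 / ((ℓ + 1 : ℕ) : ℝ)) :=
        mul_le_mul (sineMode_sq_le _ _ _) (sineMode_sq_le _ _ _) (sq_nonneg _) (by positivity)
    _ = _ := by push_cast; field_simp; norm_num

/-- The dispersion relation `2 - 2 cos (π k / (ℓ + 1))`. -/
def dispersion (ℓ k : ℕ) : ℝ := 2 - 2 * Real.cos (Real.pi * k / (ℓ + 1 : ℕ))

lemma sum_latticeBond_mul (s : Finset (ℤ × ℤ)) (x : ℤ × ℤ) (g : ℤ × ℤ → ℝ) :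
    ∑ y ∈ s, latticeBond x y * g y =
      (if x + (1, 0) ∈ s then g (x + (1, 0)) else 0) +
        (if x + (0, 1) ∈ s then g (x + (0, 1)) else 0) := by
  have : ∀ y, latticeBond x y * g y = (if y = x + (1, 0) then g y else 0) +
      (if y = x + (0, 1) then g y else 0) := by
    intro y
    unfold latticeBond
    by_cases h : y = x + (1, 0)
    · subst h; simp
    · simp [h]
  simp only [this, Finset.sum_add_distrib, Finset.sum_ite_eq']

lemma sum_product_add (s t : Finset ℤ) (A S T B : ℤ → ℝ) :
    ∑ x ∈ s ×ˢ t, (A x.1 * T x.2 + S x.1 * B x.2) =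
      (∑ a ∈ s, A a) * (∑ b ∈ t, T b) + (∑ a ∈ s, S a) * ∑ b ∈ t, B b := by
  rw [Finset.sum_add_distrib, Finset.sum_mul_sum, Finset.sum_mul_sum, Finset.sum_product,
    Finset.sum_product]

/-- The wall fields are bonds to sites where the sine vanishes. With them included the form
separates: an interval energy in one direction times a normalized mode in the other. -/
lemma boxMode_energy (N ℓ : ℕ) (p : Fin ℓ × Fin ℓ) :
    modeEnergy N (fun x y : square ℓ => latticeBond x y) (fun x => dirichletField N ℓ x)
      (boxMode ℓ p) = (N : ℝ) / 2 * (dispersion ℓ (p.1 + 1) + dispersion ℓ (p.2 + 1)) := by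
  set s := sineMode (ℓ + 1) (p.1 + 1) with hs
  set t := sineMode (ℓ + 1) (p.2 + 1) with ht
  set g : ℤ × ℤ → ℝ := fun x => s x.1 * t x.2 with hg
  have h1 := sum_sineMode_Icc (ℓ := ℓ) (j := p.1 + 1) (k := p.1 + 1) (by omega) (by omega)
    (by omega) (by omega)
  have h2 := sum_sineMode_Icc (ℓ := ℓ) (j := p.2 + 1) (k := p.2 + 1) (by omega) (by omega)
    (by omega) (by omega)
  have h3 := sum_sineMode_energy (ℓ := ℓ) (k := p.1 + 1) (by omega) (by omega)
  have h4 := sum_sineMode_energy (ℓ := ℓ) (k := p.2 + 1) (by omega) (by omega)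
  rw [if_pos rfl, ← hs] at h1
  rw [if_pos rfl, ← ht] at h2
  rw [← hs] at h3
  rw [← ht] at h4
  have e0 : modeEnergy N (fun x y : square ℓ => latticeBond x y) (fun x => dirichletField N ℓ x)
      (boxMode ℓ p) = (N : ℝ) / 2 * (∑ x ∈ square ℓ, ∑ y ∈ square ℓ,
        latticeBond x y * (g x - g y) ^ 2) + ∑ x ∈ square ℓ, dirichletField N ℓ x * g x ^ 2 := by
    rw [modeEnergy, ← Finset.sum_coe_sort (square ℓ), ← Finset.sum_coe_sort (square ℓ)]
    congr 2
    refine Finset.sum_congr rfl fun x _ => ?_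
    rw [← Finset.sum_coe_sort (square ℓ)]
    rfl
  rw [e0, dispersion, dispersion, ← h3, ← h4, Finset.mul_sum, ← Finset.sum_add_distrib]
  have e1 : ∀ x ∈ square ℓ, (N : ℝ) / 2 * (∑ y ∈ square ℓ, latticeBond x y * (g x - g y) ^ 2) +
      dirichletField N ℓ x * g x ^ 2 = (N : ℝ) / 2 *
      (((if x.1 + 1 ≤ ℓ then (s x.1 - s (x.1 + 1)) ^ 2 else 0) +
        ((if x.1 % (ℓ + 1) = 1 then 1 else 0) + (if (x.1 + 1) % (ℓ + 1) = 0 then 1 else 0)) *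
          s x.1 ^ 2) * (t x.2 * t x.2) +
      (s x.1 * s x.1) * ((if x.2 + 1 ≤ ℓ then (t x.2 - t (x.2 + 1)) ^ 2 else 0) +
        ((if x.2 % (ℓ + 1) = 1 then 1 else 0) + (if (x.2 + 1) % (ℓ + 1) = 0 then 1 else 0)) *
          t x.2 ^ 2)) := by
    intro x hx
    rw [mem_square] at hx
    rw [sum_latticeBond_mul, dirichletField]
    have m1 : x + (1, 0) ∈ square ℓ ↔ x.1 + 1 ≤ ℓ := by
      rw [mem_square]; simp only [Prod.fst_add, Prod.snd_add]; omega
    have m2 : x + (0, 1) ∈ square ℓ ↔ x.2 + 1 ≤ ℓ := by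
      rw [mem_square]; simp only [Prod.fst_add, Prod.snd_add]; omega
    simp only [m1, m2, hg, Prod.fst_add, Prod.snd_add, add_zero]
    have n1 : (if x.1 + 1 ≤ (ℓ : ℤ) then (s x.1 * t x.2 - s (x.1 + 1) * t x.2) ^ 2 else 0) =
        (if x.1 + 1 ≤ (ℓ : ℤ) then (s x.1 - s (x.1 + 1)) ^ 2 else 0) * (t x.2 * t x.2) := by
      split_ifs <;> ring
    have n2 : (if x.2 + 1 ≤ (ℓ : ℤ) then (s x.1 * t x.2 - s x.1 * t (x.2 + 1)) ^ 2 else 0) =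
        (s x.1 * s x.1) * (if x.2 + 1 ≤ (ℓ : ℤ) then (t x.2 - t (x.2 + 1)) ^ 2 else 0) := by
      split_ifs <;> ring
    rw [n1, n2]
    ring
  rw [Finset.sum_congr rfl e1, ← Finset.mul_sum, square]
  congr 1
  refine (sum_product_add _ _
    (fun a => (if a + 1 ≤ (ℓ : ℤ) then (s a - s (a + 1)) ^ 2 else 0) +
      ((if a % (ℓ + 1) = 1 then 1 else 0) + (if (a + 1) % (ℓ + 1) = 0 then 1 else 0)) * s a ^ 2)
    (fun a => s a * s a) (fun b => t b * t b)
    (fun b => (if b + 1 ≤ (ℓ : ℤ) then (t b - t (b + 1)) ^ 2 else 0) +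
      ((if b % (ℓ + 1) = 1 then 1 else 0) + (if (b + 1) % (ℓ + 1) = 0 then 1 else 0)) *
        t b ^ 2)).trans ?_
  rw [h1, h2, mul_one, one_mul]

/-- The variational lower bound for a square with Dirichlet boundary conditions. -/
theorem le_regionZ_square {N : ℕ} (hN : 1 ≤ N) (ℓ : ℕ) {β δ : ℝ} (hβ : 0 ≤ β) (hδ : δ < 1)
    (s : Finset (Fin ℓ × Fin ℓ →₀ ℕ))
    (hs : ∀ m ∈ s, 16 * (∑ p, (m p : ℝ)) ^ 2 / ((ℓ : ℝ) + 1) ^ 2 ≤ δ) :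
    (1 - δ) * ∑ m ∈ s, Real.exp (-(β / (1 - δ)) *
      ∑ p : Fin ℓ × Fin ℓ, m p * ((N : ℝ) / 2 * (dispersion ℓ (p.1 + 1) + dispersion ℓ (p.2 + 1)))) ≤
      regionZ N (square ℓ) latticeBond (dirichletField N ℓ) β := by
  have hadm := (latticeBond_admissible (dirichletField_nonneg N ℓ)).comp
    (fun x : square ℓ => (x : ℤ × ℤ))
  have := le_systemZ_of_modes (boxMode_orthonormal ℓ) hN hadm (boxMode_sq_le ℓ) hβ hδ s (fun m hm => ?_)
  · simp only [boxMode_energy] at this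
    exact this
  · refine le_trans ?_ (hs m hm)
    rw [Fintype.card_coe, card_square]
    push_cast
    have hN' : (1 : ℝ) ≤ N := by exact_mod_cast hN
    generalize ∑ p, (m p : ℝ) = r
    have h1 : (ℓ : ℝ) ^ 2 ≤ ((ℓ : ℝ) + 1) ^ 2 := by gcongr; linarith
    have h2 : (0 : ℝ) < ((ℓ : ℝ) + 1) ^ 2 := by positivity
    -- The gain 1/N is given away; the resulting bound no longer depends on the spin except through
    -- βN/2.
    calc (ℓ : ℝ) ^ 2 * (4 / ((ℓ : ℝ) + 1) ^ 2 * r) ^ 2 / N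
        ≤ (ℓ : ℝ) ^ 2 * (4 / ((ℓ : ℝ) + 1) ^ 2 * r) ^ 2 := div_le_self (by positivity) hN'
      _ ≤ ((ℓ : ℝ) + 1) ^ 2 * (4 / ((ℓ : ℝ) + 1) ^ 2 * r) ^ 2 := by gcongr
      _ = _ := by field_simp; ring

end SineModes

end Heisenberg2D

end

noncomputable section

namespace Heisenberg2D

/-! ### Ideal Bose gas with a cap on the particle number -/

section BosePartition

lemma sum_mul_geom_eq (x : ℝ) (M : ℕ) :
    (1 - x) * ∑ j ∈ Finset.range M, (j : ℝ) * x ^ j + M * x ^ M =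
      x * ∑ j ∈ Finset.range M, x ^ j := by
  induction M with
  | zero => simp
  | succ M ih =>
    rw [Finset.sum_range_succ, Finset.sum_range_succ, mul_add x, ← ih]
    push_cast
    ring

lemma sum_mul_geom_le {x : ℝ} (hx : 0 ≤ x) (hx' : x < 1) (M : ℕ) :
    ∑ j ∈ Finset.range M, (j : ℝ) * x ^ j ≤ x / (1 - x) * ∑ j ∈ Finset.range M, x ^ j := by
  have h := sum_mul_geom_eq x M
  have h1 : 0 < 1 - x := by linarith
  have h2 : 0 ≤ (M : ℝ) * x ^ M := by positivity
  rw [div_mul_eq_mul_div, le_div_iff₀ h1, ← h]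
  linarith

variable {ι : Type*} [Fintype ι] [DecidableEq ι]

/-- The mean total occupation number in the ideal Bose gas with truncated occupations. -/
lemma sum_prod_mul_total_le {x : ι → ℝ} (hx : ∀ p, 0 ≤ x p) (hx' : ∀ p, x p < 1) (M : ℕ) :
    ∑ m ∈ Fintype.piFinset (fun _ : ι => Finset.range M), (∏ p, x p ^ m p) * ∑ p, (m p : ℝ) ≤
      (∑ p, x p / (1 - x p)) * ∏ p, ∑ j ∈ Finset.range M, x p ^ j := by
  have key : ∀ p, ∑ m ∈ Fintype.piFinset (fun _ : ι => Finset.range M),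
      (∏ q, x q ^ m q) * (m p : ℝ) ≤
        x p / (1 - x p) * ∏ q, ∑ j ∈ Finset.range M, x q ^ j := by
    intro p
    calc _ = ∑ m ∈ Fintype.piFinset (fun _ : ι => Finset.range M),
          ∏ q, ((if q = p then (m q : ℝ) else 1) * x q ^ m q) := by
          refine Finset.sum_congr rfl fun m _ => ?_
          rw [Finset.prod_mul_distrib, Finset.prod_ite_eq' Finset.univ p,
            if_pos (Finset.mem_univ _), mul_comm]
      _ = ∏ q, ∑ j ∈ Finset.range M, (if q = p then (j : ℝ) else 1) * x q ^ j :=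
          (Finset.prod_univ_sum (fun _ => Finset.range M)
            fun q (j : ℕ) => (if q = p then (j : ℝ) else 1) * x q ^ j).symm
      _ ≤ ∏ q, ((if q = p then x q / (1 - x q) else 1) * ∑ j ∈ Finset.range M, x q ^ j) := by
          refine Finset.prod_le_prod (fun q _ => Finset.sum_nonneg fun j _ => ?_) fun q _ => ?_
          · have := hx q
            split_ifs <;> positivity
          · split_ifs with h
            · exact sum_mul_geom_le (hx q) (hx' q) M
            · simp
      _ = _ := by
          rw [Finset.prod_mul_distrib, Finset.prod_ite_eq' Finset.univ p,
            if_pos (Finset.mem_univ _)]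
  simp only [Finset.mul_sum]
  rw [Finset.sum_comm, Finset.sum_mul]
  exact Finset.sum_le_sum fun p _ => by simpa only using key p

/-- At least half of the weight of an ideal Bose gas is carried by total occupation numbers up to
twice the mean. -/
theorem bose_partition_le {x : ι → ℝ} (hx : ∀ p, 0 ≤ x p) (hx' : ∀ p, x p < 1) {K c : ℝ}
    (hK : 0 < K) (hxK : 2 * ∑ p, x p / (1 - x p) ≤ K)
    (hc : ∀ s : Finset (ι →₀ ℕ), (∀ m ∈ s, ∑ p, (m p : ℝ) ≤ K) → ∑ m ∈ s, ∏ p, x p ^ m p ≤ c) :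
    1 / 2 * ∏ p, (1 - x p)⁻¹ ≤ c := by
  -- Occupations below M give finite sums; since `c` bounds all finite families, M can tend to
  -- infinity at the end.
  have hM : ∀ M : ℕ, 1 / 2 * ∏ p, ∑ j ∈ Finset.range M, x p ^ j ≤ c := by
    intro M
    set A := Fintype.piFinset (fun _ : ι => Finset.range M)
    set P := ∏ p, ∑ j ∈ Finset.range M, x p ^ j with hP
    have hP0 : 0 ≤ P := Finset.prod_nonneg fun p _ => Finset.sum_nonneg fun j _ =>
      pow_nonneg (hx p) _
    have hw : ∀ m : ι → ℕ, 0 ≤ ∏ p, x p ^ m p := fun m =>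
      Finset.prod_nonneg fun p _ => pow_nonneg (hx p) _
    have hsum : ∑ m ∈ A, ∏ p, x p ^ m p = P :=
      (Finset.prod_univ_sum _ fun q j => x q ^ j).symm
    have h1 : ∑ m ∈ A with ∑ p, (m p : ℝ) ≤ K, ∏ p, x p ^ m p ≤ c := by
      have := hc ((A.filter fun m => ∑ p, (m p : ℝ) ≤ K).map
        (Finsupp.equivFunOnFinite (α := ι) (M := ℕ)).symm.toEmbedding) (by
          intro m hm
          rw [Finset.mem_map] at hm
          obtain ⟨m', hm', rfl⟩ := hm
          exact (Finset.mem_filter.1 hm').2)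
      rw [Finset.sum_map] at this
      exact this
    -- Markov's inequality, K being at least twice the mean.
    have h2 : ∑ m ∈ A with ¬ ∑ p, (m p : ℝ) ≤ K, ∏ p, x p ^ m p ≤ P / 2 := by
      calc _ ≤ ∑ m ∈ A with ¬ ∑ p, (m p : ℝ) ≤ K, (∏ p, x p ^ m p) * (∑ p, (m p : ℝ)) / K := by
            refine Finset.sum_le_sum fun m hm => ?_
            rw [Finset.mem_filter, not_le] at hm
            rw [le_div_iff₀ hK]
            exact mul_le_mul_of_nonneg_left hm.2.le (hw m)
        _ ≤ ∑ m ∈ A, (∏ p, x p ^ m p) * (∑ p, (m p : ℝ)) / K := by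
            refine Finset.sum_le_sum_of_subset_of_nonneg (Finset.filter_subset _ _) fun m _ _ => ?_
            have := hw m
            positivity
        _ = (∑ m ∈ A, (∏ p, x p ^ m p) * (∑ p, (m p : ℝ))) / K := by rw [Finset.sum_div]
        _ ≤ (K / 2 * P) / K := by
            refine div_le_div_of_nonneg_right ?_ hK.le
            refine (sum_prod_mul_total_le hx hx' M).trans ?_
            exact mul_le_mul_of_nonneg_right (by linarith) hP0
        _ = _ := by field_simp
    have h3 := Finset.sum_filter_add_sum_filter_not A (fun m => ∑ p, (m p : ℝ) ≤ K)
      fun m => ∏ p, x p ^ m p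
    linarith
  have hlim : Tendsto (fun M : ℕ => 1 / 2 * ∏ p, ∑ j ∈ Finset.range M, x p ^ j) atTop
      (𝓝 (1 / 2 * ∏ p, (1 - x p)⁻¹)) :=
    (tendsto_finsetProd _ fun p _ =>
      (hasSum_geometric_of_lt_one (hx p) (hx' p)).tendsto_sum_nat).const_mul _
  exact le_of_tendsto' hlim hM

end BosePartition

/-! ### Mean boson number and the two-dimensional logarithm -/

section OccupationNumber

lemma dispersion_le (ℓ k : ℕ) : dispersion ℓ k ≤ (Real.pi / ((ℓ : ℝ) + 1)) ^ 2 * (k : ℝ) ^ 2 := by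
  have := Real.one_sub_sq_div_two_le_cos (x := Real.pi * k / (ℓ + 1 : ℕ))
  rw [dispersion, ← mul_pow]
  have e : Real.pi / ((ℓ : ℝ) + 1) * k = Real.pi * k / (ℓ + 1 : ℕ) := by push_cast; ring
  rw [e]; linarith

lemma le_dispersion {ℓ k : ℕ} (hk : k ≤ ℓ) :
    4 / ((ℓ : ℝ) + 1) ^ 2 * (k : ℝ) ^ 2 ≤ dispersion ℓ k := by
  have hk' : (k : ℝ) ≤ ℓ := by exact_mod_cast hk
  have h1 : |Real.pi * k / (ℓ + 1 : ℕ)| ≤ Real.pi := by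
    rw [abs_of_nonneg (by positivity), div_le_iff₀ (by positivity)]
    push_cast
    exact mul_le_mul_of_nonneg_left (by linarith) Real.pi_pos.le
  have := Real.cos_le_one_sub_mul_cos_sq h1
  rw [dispersion]
  have e : 2 / Real.pi ^ 2 * (Real.pi * k / (ℓ + 1 : ℕ)) ^ 2 =
      2 / ((ℓ : ℝ) + 1) ^ 2 * (k : ℝ) ^ 2 := by
    have := Real.pi_ne_zero
    push_cast
    field_simp
  rw [e] at this
  linarith [show 4 / ((ℓ : ℝ) + 1) ^ 2 * (k : ℝ) ^ 2 = 2 * (2 / ((ℓ : ℝ) + 1) ^ 2 * (k : ℝ) ^ 2) by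
    ring]

/-- From (a + i)(a + i + 1) ≤ (a + i + 1)² ≤ 2(a² + (i + 1)²), the terms are dominated by a
telescoping sum. -/
lemma sum_inv_sq_add_sq_le (ℓ : ℕ) {a : ℝ} (ha : 0 < a) :
    ∑ i ∈ Finset.range ℓ, 1 / (a ^ 2 + ((i : ℝ) + 1) ^ 2) ≤ 2 / a := by
  have h : ∀ i ∈ Finset.range ℓ, 1 / (a ^ 2 + ((i : ℝ) + 1) ^ 2) ≤
      2 / (a + i) - 2 / (a + (i + 1 : ℕ)) := by
    intro i _
    push_cast
    have hi : (0 : ℝ) ≤ i := by positivity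
    rw [div_sub_div _ _ (by positivity) (by positivity),
      div_le_div_iff₀ (by positivity) (by positivity)]
    nlinarith [sq_nonneg (a - (i + 1))]
  refine (Finset.sum_le_sum h).trans ?_
  rw [Finset.sum_range_sub' (fun i : ℕ => 2 / (a + (i : ℝ)))]
  have : (0 : ℝ) ≤ 2 / (a + ℓ) := by positivity
  simp only [Nat.cast_zero, add_zero]
  linarith

lemma sum_inv_sq_add_sq_le_log (ℓ : ℕ) :
    ∑ p : Fin ℓ × Fin ℓ, 1 / (((p.1 : ℕ) + 1 : ℝ) ^ 2 + ((p.2 : ℕ) + 1 : ℝ) ^ 2) ≤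
      2 * (1 + Real.log (ℓ + 1)) := by
  rw [Fintype.sum_prod_type]
  calc _ ≤ ∑ i : Fin ℓ, 2 / (((i : ℕ) : ℝ) + 1) := by
        refine Finset.sum_le_sum fun i _ => ?_
        rw [Fin.sum_univ_eq_sum_range (fun j : ℕ => 1 / (((i : ℕ) + 1 : ℝ) ^ 2 + ((j : ℝ) + 1) ^ 2))]
        exact sum_inv_sq_add_sq_le ℓ (by positivity)
    _ = 2 * (harmonic ℓ : ℝ) := by
        rw [Fin.sum_univ_eq_sum_range (fun j : ℕ => 2 / ((j : ℝ) + 1)), harmonic, Rat.cast_sum,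
          Finset.mul_sum]
        refine Finset.sum_congr rfl fun i _ => ?_
        push_cast
        ring
    _ ≤ _ := by
        refine mul_le_mul_of_nonneg_left ?_ (by norm_num)
        refine (harmonic_le_one_add_log ℓ).trans ?_
        rcases Nat.eq_zero_or_pos ℓ with rfl | h
        · simp
        · gcongr
          linarith

/-- The Bose factor is 1/(e^y - 1), and e^y ≥ 1 + y. -/
lemma bose_factor_le {y : ℝ} (hy : 0 < y) :
    Real.exp (-y) / (1 - Real.exp (-y)) ≤ 1 / y := by
  have h1 : Real.exp (-y) < 1 := Real.exp_lt_one_iff.2 (by linarith)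
  have h2 := Real.add_one_le_exp y
  have h3 : Real.exp (-y) * Real.exp y = 1 := by rw [← Real.exp_add]; simp
  rw [div_le_div_iff₀ (by linarith) hy]
  nlinarith [Real.exp_pos (-y)]

/-- The mean number of bosons in a square with Dirichlet boundary conditions. -/
lemma sum_bose_factor_le (ℓ : ℕ) {b : ℝ} (hb : 0 < b) :
    ∑ p : Fin ℓ × Fin ℓ,
      Real.exp (-(b * (dispersion ℓ (p.1 + 1) + dispersion ℓ (p.2 + 1)))) /
        (1 - Real.exp (-(b * (dispersion ℓ (p.1 + 1) + dispersion ℓ (p.2 + 1))))) ≤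
      ((ℓ : ℝ) + 1) ^ 2 * (1 + Real.log (ℓ + 1)) / (2 * b) := by
  have hn : (0 : ℝ) < (ℓ : ℝ) + 1 := by positivity
  calc _ ≤ ∑ p : Fin ℓ × Fin ℓ, ((ℓ : ℝ) + 1) ^ 2 / (4 * b) *
        (1 / (((p.1 : ℕ) + 1 : ℝ) ^ 2 + ((p.2 : ℕ) + 1 : ℝ) ^ 2)) := by
        refine Finset.sum_le_sum fun p _ => ?_
        have h1 := le_dispersion (ℓ := ℓ) (k := p.1 + 1) (by omega)
        have h2 := le_dispersion (ℓ := ℓ) (k := p.2 + 1) (by omega)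
        push_cast at h1 h2
        have h3 : b * (4 / ((ℓ : ℝ) + 1) ^ 2 *
            (((p.1 : ℕ) + 1 : ℝ) ^ 2 + ((p.2 : ℕ) + 1 : ℝ) ^ 2)) ≤
            b * (dispersion ℓ (p.1 + 1) + dispersion ℓ (p.2 + 1)) :=
          mul_le_mul_of_nonneg_left (by linarith) hb.le
        have h4 : 0 < b * (4 / ((ℓ : ℝ) + 1) ^ 2 *
            (((p.1 : ℕ) + 1 : ℝ) ^ 2 + ((p.2 : ℕ) + 1 : ℝ) ^ 2)) := by positivity
        refine (bose_factor_le (h4.trans_le h3)).trans ((one_div_le_one_div_of_le h4 h3).trans ?_)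
        refine le_of_eq ?_
        field_simp
    _ = ((ℓ : ℝ) + 1) ^ 2 / (4 * b) * ∑ p : Fin ℓ × Fin ℓ,
        (1 / (((p.1 : ℕ) + 1 : ℝ) ^ 2 + ((p.2 : ℕ) + 1 : ℝ) ^ 2)) := by rw [Finset.mul_sum]
    _ ≤ ((ℓ : ℝ) + 1) ^ 2 / (4 * b) * (2 * (1 + Real.log (ℓ + 1))) :=
        mul_le_mul_of_nonneg_left (sum_inv_sq_add_sq_le_log ℓ) (by positivity)
    _ = _ := by field_simp; ring

end OccupationNumber

/-! ### Ideal gas partition function by Gaussian sums -/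

section LogPartition

lemma sum_inv_mul_sqrt_le (J : ℕ) :
    ∑ j ∈ Finset.range J, 1 / (((j : ℝ) + 1) * Real.sqrt ((j : ℝ) + 1)) ≤ 3 := by
  have h : ∀ J : ℕ, ∑ j ∈ Finset.range (J + 1), 1 / (((j : ℝ) + 1) * Real.sqrt ((j : ℝ) + 1)) ≤
      3 - 2 / Real.sqrt ((J : ℝ) + 1) := by
    intro J
    induction J with
    | zero => norm_num
    | succ J ih =>
      rw [Finset.sum_range_succ]
      push_cast
      set a := Real.sqrt ((J : ℝ) + 1) with ha
      set c := Real.sqrt ((J : ℝ) + 1 + 1) with hc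
      have ha2 : a ^ 2 = (J : ℝ) + 1 := Real.sq_sqrt (by positivity)
      have hc2 : c ^ 2 = (J : ℝ) + 1 + 1 := Real.sq_sqrt (by positivity)
      have ha0 : 0 < a := Real.sqrt_pos.2 (by positivity)
      have hc0 : 0 < c := Real.sqrt_pos.2 (by positivity)
      have hac : a ≤ c := Real.sqrt_le_sqrt (by linarith)
      have h1 : 1 / (((J : ℝ) + 1 + 1) * c) ≤ 2 / a - 2 / c := by
        rw [← hc2, div_sub_div _ _ ha0.ne' hc0.ne',
          div_le_div_iff₀ (by positivity) (by positivity)]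
        have h2 : (c - a) * (c + a) = 1 := by nlinarith
        have h3 : 0 ≤ c - a := by linarith
        have h4 : a * c ≤ c ^ 2 := by nlinarith
        have h5 : 1 ≤ (c - a) * (2 * c) := by nlinarith
        calc 1 * (a * c) ≤ ((c - a) * (2 * c)) * c ^ 2 :=
              mul_le_mul h5 h4 (by positivity) (by positivity)
          _ = _ := by ring
      linarith
  rcases J with _ | J
  · norm_num
  · have h0 : 0 ≤ 2 / Real.sqrt ((J : ℝ) + 1) := by positivity
    linarith [h J]

lemma integral_gaussian_tail_le {s a : ℝ} (hs : 0 < s) (ha : 0 < a) :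
    ∫ x in Set.Ioi a, Real.exp (-s * x ^ 2) ≤ 1 / (s * a) := by
  have h1 : ∫ x in Set.Ioi a, Real.exp (-(s * a) * x) = -Real.exp (-(s * a) * a) / (-(s * a)) :=
    integral_exp_mul_Ioi (by nlinarith [mul_pos hs ha]) a
  calc _ ≤ ∫ x in Set.Ioi a, Real.exp (-(s * a) * x) := by
        refine MeasureTheory.setIntegral_mono_on (integrable_exp_neg_mul_sq hs).integrableOn
          (integrableOn_exp_mul_Ioi (by nlinarith [mul_pos hs ha]) a) measurableSet_Ioi
          fun x hx => ?_
        rw [Set.mem_Ioi] at hx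
        refine Real.exp_le_exp.2 ?_
        nlinarith [mul_pos hs (sub_pos.2 hx), mul_pos (mul_pos hs (sub_pos.2 hx)) (ha.trans hx)]
    _ = Real.exp (-(s * a) * a) / (s * a) := by rw [h1, neg_div_neg_eq]
    _ ≤ _ := by
        refine div_le_div_of_nonneg_right ?_ (by positivity)
        rw [Real.exp_le_one_iff]
        nlinarith [mul_pos (mul_pos hs ha) ha]

/-- A Gaussian sum is close to the Gaussian integral. -/
lemma le_sum_gaussian {s : ℝ} (hs : 0 < s) (ℓ : ℕ) (h : 1 ≤ s * ((ℓ : ℝ) + 1)) :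
    Real.sqrt (Real.pi / s) / 2 - 2 ≤
      ∑ i ∈ Finset.range ℓ, Real.exp (-s * ((i : ℝ) + 1) ^ 2) := by
  set f : ℝ → ℝ := fun x => Real.exp (-s * x ^ 2) with hf
  have h1 : AntitoneOn f (Set.Icc 0 (0 + ((ℓ + 1 : ℕ) : ℝ))) := by
    intro x hx y _ hxy
    refine Real.exp_le_exp.2 ?_
    nlinarith [mul_nonneg hs.le (mul_nonneg (sub_nonneg.2 hxy) (add_nonneg hx.1 (hx.1.trans hxy)))]
  have h2 := h1.integral_le_sum
  rw [Finset.sum_range_succ'] at h2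
  simp only [zero_add] at h2
  have h3 : f ((0 : ℕ) : ℝ) = 1 := by simp [hf]
  -- Monotone comparison with the integral includes the point 0, where the Gaussian is 1; that 1 and
  -- a tail of at most 1 make up the constant 2.
  rw [h3] at h2
  have hint : MeasureTheory.Integrable f := integrable_exp_neg_mul_sq hs
  have h4 : (∫ x in (0 : ℝ)..((ℓ + 1 : ℕ) : ℝ), f x) + ∫ x in Set.Ioi ((ℓ + 1 : ℕ) : ℝ), f x =
      Real.sqrt (Real.pi / s) / 2 := by
    rw [intervalIntegral.integral_interval_add_Ioi hint.integrableOn hint.integrableOn]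
    exact integral_gaussian_Ioi s
  have h5 : ∫ x in Set.Ioi ((ℓ + 1 : ℕ) : ℝ), f x ≤ 1 := by
    refine (integral_gaussian_tail_le hs (by positivity)).trans ?_
    push_cast
    rw [div_le_one (by positivity)]
    exact h
  have h6 : ∑ i ∈ Finset.range ℓ, Real.exp (-s * ((i : ℝ) + 1) ^ 2) =
      ∑ i ∈ Finset.range ℓ, f ((i + 1 : ℕ) : ℝ) :=
    Finset.sum_congr rfl fun i _ => by simp only [hf]; push_cast; rfl
  rw [h6]
  linarith

lemma le_sq_sum_gaussian {s : ℝ} (hs : 0 < s) (ℓ : ℕ) (h : 1 ≤ s * ((ℓ : ℝ) + 1)) :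
    Real.pi / (4 * s) - 2 * Real.sqrt (Real.pi / s) ≤
      (∑ i ∈ Finset.range ℓ, Real.exp (-s * ((i : ℝ) + 1) ^ 2)) ^ 2 := by
  have h1 := le_sum_gaussian hs ℓ h
  have h0 : 0 ≤ ∑ i ∈ Finset.range ℓ, Real.exp (-s * ((i : ℝ) + 1) ^ 2) :=
    Finset.sum_nonneg fun i _ => (Real.exp_pos _).le
  generalize ∑ i ∈ Finset.range ℓ, Real.exp (-s * ((i : ℝ) + 1) ^ 2) = g at h0 h1
  have h2 : Real.sqrt (Real.pi / s) ^ 2 = Real.pi / s :=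
    Real.sq_sqrt (div_nonneg Real.pi_pos.le hs.le)
  have h3 := Real.sqrt_nonneg (Real.pi / s)
  rw [show Real.pi / (4 * s) = Real.sqrt (Real.pi / s) ^ 2 / 4 by rw [h2]; field_simp]
  generalize Real.sqrt (Real.pi / s) = a at h1 h3
  -- For a ≥ 4 the bound g ≥ a/2 - 2 can be squared; otherwise a²/4 - 2a ≤ 0.
  by_cases ha : 4 ≤ a
  · nlinarith
  · nlinarith [sq_nonneg g]

/-- A lower bound on the logarithm of the grand-canonical partition function of an ideal Bose gas
on a square. -/
theorem le_sum_neg_log {t : ℝ} (ht : 0 < t) (ℓ : ℕ) (h : 1 ≤ t * ((ℓ : ℝ) + 1))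
    {x : Fin ℓ × Fin ℓ → ℝ} (hx' : ∀ p, x p < 1)
    (hx : ∀ p, Real.exp (-t * (((p.1 : ℕ) + 1 : ℝ) ^ 2 + ((p.2 : ℕ) + 1 : ℝ) ^ 2)) ≤ x p) :
    Real.pi ^ 3 / (24 * t) - 6 * Real.sqrt (Real.pi / t) ≤ ∑ p, -Real.log (1 - x p) := by
  have hx0 : ∀ p, 0 ≤ x p := fun p => (Real.exp_pos _).le.trans (hx p)
  -- Expand -log(1 - x) as ∑ x^j/j and stop at J terms. The j-th term contains the square of a
  -- Gaussian sum with parameter tj, of leading order π/(4tj), so the main terms add up to ζ(2) and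
  -- the errors to a convergent sum of j^(-3/2).
  have hJ : ∀ J : ℕ, Real.pi / (4 * t) * (∑ j ∈ Finset.range J, 1 / ((j : ℝ) + 1) ^ 2) -
      6 * Real.sqrt (Real.pi / t) ≤ ∑ p, -Real.log (1 - x p) := by
    intro J
    have h1 : ∀ p, ∑ j ∈ Finset.range J, x p ^ (j + 1) / ((j : ℝ) + 1) ≤ -Real.log (1 - x p) :=
      fun p => sum_le_hasSum _ (fun j _ => by have := hx0 p; positivity)
        (Real.hasSum_pow_div_log_of_abs_lt_one (by rw [abs_of_nonneg (hx0 p)]; exact hx' p))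
    refine le_trans ?_ (Finset.sum_le_sum fun p _ => h1 p)
    rw [Finset.sum_comm]
    have h2 : ∀ j ∈ Finset.range J, Real.pi / (4 * t) * (1 / ((j : ℝ) + 1) ^ 2) -
        2 * Real.sqrt (Real.pi / t) * (1 / (((j : ℝ) + 1) * Real.sqrt ((j : ℝ) + 1))) ≤
        ∑ p, x p ^ (j + 1) / ((j : ℝ) + 1) := by
      intro j _
      have hj : (0 : ℝ) < (j : ℝ) + 1 := by positivity
      have hj1 : (1 : ℝ) ≤ (j : ℝ) + 1 := by linarith [show (0 : ℝ) ≤ j by positivity]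
      have h3 := le_sq_sum_gaussian (s := t * ((j : ℝ) + 1)) (by positivity) ℓ (by
        refine h.trans ?_
        rw [mul_right_comm]
        exact le_mul_of_one_le_right (by positivity) hj1)
      rw [sq, Finset.sum_mul_sum, ← Fin.sum_univ_eq_sum_range (fun i : ℕ => ∑ k ∈ Finset.range ℓ,
        Real.exp (-(t * ((j : ℝ) + 1)) * ((i : ℝ) + 1) ^ 2) *
          Real.exp (-(t * ((j : ℝ) + 1)) * ((k : ℝ) + 1) ^ 2))] at h3
      have h4 : ∀ i : Fin ℓ, ∑ k ∈ Finset.range ℓ,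
          Real.exp (-(t * ((j : ℝ) + 1)) * (((i : ℕ) : ℝ) + 1) ^ 2) *
          Real.exp (-(t * ((j : ℝ) + 1)) * ((k : ℝ) + 1) ^ 2) ≤ ∑ k : Fin ℓ, x (i, k) ^ (j + 1) := by
        intro i
        rw [← Fin.sum_univ_eq_sum_range (fun k : ℕ =>
          Real.exp (-(t * ((j : ℝ) + 1)) * (((i : ℕ) : ℝ) + 1) ^ 2) *
          Real.exp (-(t * ((j : ℝ) + 1)) * ((k : ℝ) + 1) ^ 2))]
        refine Finset.sum_le_sum fun k _ => ?_
        refine le_trans (le_of_eq ?_) (pow_le_pow_left₀ (Real.exp_pos _).le (hx (i, k)) (j + 1))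
        rw [← Real.exp_add, ← Real.exp_nat_mul]
        congr 1
        push_cast
        ring
      have h5 := h3.trans (Finset.sum_le_sum fun i _ => h4 i)
      rw [← Fintype.sum_prod_type (fun p => x p ^ (j + 1))] at h5
      rw [← Finset.sum_div, le_div_iff₀ hj]
      refine le_trans (le_of_eq ?_) h5
      have h6 : Real.sqrt (Real.pi / (t * ((j : ℝ) + 1))) =
          Real.sqrt (Real.pi / t) / Real.sqrt ((j : ℝ) + 1) := by
        rw [← Real.sqrt_div' _ hj.le, div_div]
      have h7 : Real.sqrt ((j : ℝ) + 1) ≠ 0 := (Real.sqrt_pos.2 hj).ne'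
      rw [h6]
      field_simp
    refine le_trans ?_ (Finset.sum_le_sum h2)
    rw [Finset.sum_sub_distrib, ← Finset.mul_sum, ← Finset.mul_sum]
    have := mul_le_mul_of_nonneg_left (sum_inv_mul_sqrt_le J)
      (by positivity : 0 ≤ 2 * Real.sqrt (Real.pi / t))
    linarith
  have hz : HasSum (fun j : ℕ => 1 / ((j : ℝ) + 1) ^ 2) (Real.pi ^ 2 / 6) := by
    have := (hasSum_nat_add_iff' 1).2 hasSum_zeta_two
    simpa using this
  have hlim := (hz.tendsto_sum_nat.const_mul (Real.pi / (4 * t))).sub_const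
    (6 * Real.sqrt (Real.pi / t))
  have := le_of_tendsto' hlim hJ
  refine le_trans (le_of_eq ?_) this
  field_simp
  ring

end LogPartition

end Heisenberg2D

end

noncomputable section

namespace Heisenberg2D

/-! ### Choice of the box size and conclusion -/

section FreeEnergyBound

/-- A lower bound on the logarithm of the partition function of a square with Dirichlet boundary
conditions. -/
theorem le_log_regionZ {N : ℕ} (hN : 1 ≤ N) (ℓ : ℕ) {β b δ : ℝ} (hb : 0 < b)
    (hβb : β * ((N : ℝ) / 2) = b) (hδ0 : 0 ≤ δ) (hδ : δ ≤ 1 / 2) (hℓb : (ℓ : ℝ) + 1 ≤ b)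
    (hδb : 16 * ((ℓ : ℝ) + 1) ^ 2 * (1 + Real.log (ℓ + 1)) ^ 2 / b ^ 2 ≤ δ) :
    Real.pi * (1 - δ) / (24 * b) * ((ℓ : ℝ) + 1) ^ 2 - 6 * (((ℓ : ℝ) + 1) / Real.sqrt b) -
      Real.log 4 ≤ Real.log (regionZ N (square ℓ) latticeBond (dirichletField N ℓ) β) := by
  obtain ⟨n, hn⟩ : ∃ n : ℝ, n = (ℓ : ℝ) + 1 := ⟨_, rfl⟩
  rw [← hn] at hℓb hδb ⊢
  have hn0 : 0 < n := by rw [hn]; positivity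
  have hn1 : 1 ≤ n := by rw [hn]; linarith [show (0 : ℝ) ≤ ℓ by positivity]
  have hN0 : (0 : ℝ) < N := by exact_mod_cast hN
  have hβ : 0 < β := by
    by_contra h
    have : β * ((N : ℝ) / 2) ≤ 0 := mul_nonpos_of_nonpos_of_nonneg (not_lt.1 h) (by positivity)
    linarith
  have hδ1 : 0 < 1 - δ := by linarith
  have hlog : 0 ≤ Real.log n := Real.log_nonneg hn1
  -- The effective value of βS after normalization of the trial states.
  obtain ⟨γ, hγ⟩ : ∃ γ, γ = b / (1 - δ) := ⟨_, rfl⟩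
  have hγb : b ≤ γ := by rw [hγ, le_div_iff₀ hδ1]; nlinarith
  have hγ0 : 0 < γ := hb.trans_le hγb
  have hpi := Real.pi_pos
  obtain ⟨x, hx⟩ : ∃ x : Fin ℓ × Fin ℓ → ℝ, ∀ p, x p =
    Real.exp (-(γ * (dispersion ℓ (p.1 + 1) + dispersion ℓ (p.2 + 1)))) := ⟨_, fun _ => rfl⟩
  have hx0 : ∀ p, 0 ≤ x p := fun p => by rw [hx]; exact (Real.exp_pos _).le
  have hd : ∀ k : Fin ℓ, 0 < dispersion ℓ (k + 1) := fun k =>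
    lt_of_lt_of_le (by positivity) (le_dispersion (ℓ := ℓ) (k := k + 1) (by omega))
  have hx1 : ∀ p, x p < 1 := fun p => by
    rw [hx]
    refine Real.exp_lt_one_iff.2 (neg_neg_of_pos (mul_pos hγ0 (add_pos (hd _) (hd _))))
  obtain ⟨Z, hZ⟩ : ∃ Z, regionZ N (square ℓ) latticeBond (dirichletField N ℓ) β = Z := ⟨_, rfl⟩
  rw [hZ]
  have h1 : 1 / 2 * ∏ p, (1 - x p)⁻¹ ≤ Z / (1 - δ) := by
    -- The cap is K = n²(1 + log n)/b, at least twice the mean number; the hypothesis on δ is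
    -- 16K²/n² ≤ δ.
    have hK' : 0 < n ^ 2 * (1 + Real.log n) := mul_pos (pow_pos hn0 2) (by linarith)
    have hK : 0 < n ^ 2 * (1 + Real.log n) / b := div_pos hK' hb
    refine bose_partition_le hx0 hx1 hK ?_
      (fun s hs => ?_)
    · have h2 := sum_bose_factor_le ℓ hγ0
      simp only [← hx, ← hn] at h2
      calc _ ≤ 2 * (n ^ 2 * (1 + Real.log n) / (2 * γ)) :=
            mul_le_mul_of_nonneg_left h2 (by norm_num)
        _ = n ^ 2 * (1 + Real.log n) / γ := by field_simp
        _ ≤ _ := div_le_div_of_nonneg_left hK'.le hb hγb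
    · rw [le_div_iff₀ hδ1, mul_comm]
      have h3 := le_regionZ_square hN ℓ hβ.le (by linarith : δ < 1) s (fun m hm => ?_)
      · rw [hZ] at h3
        refine le_trans (le_of_eq (congrArg ((1 - δ) * ·) ?_)) h3
        refine Finset.sum_congr rfl fun m _ => ?_
        rw [Finset.mul_sum, Real.exp_sum]
        refine Finset.prod_congr rfl fun p _ => ?_
        rw [hx, ← Real.exp_nat_mul, hγ, ← hβb]
        exact congrArg Real.exp (by ring)
      · refine le_trans ?_ hδb
        rw [← hn]
        calc 16 * (∑ p, (m p : ℝ)) ^ 2 / n ^ 2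
            ≤ 16 * (n ^ 2 * (1 + Real.log n) / b) ^ 2 / n ^ 2 := by
              refine div_le_div_of_nonneg_right (mul_le_mul_of_nonneg_left
                (pow_le_pow_left₀ ?_ (hs m hm) 2) (by norm_num)) (pow_pos hn0 2).le
              exact Finset.sum_nonneg fun p _ => Nat.cast_nonneg _
          _ = _ := by field_simp
  have hprod : 0 < ∏ p, (1 - x p)⁻¹ :=
    Finset.prod_pos fun p _ => inv_pos.2 (by linarith [hx1 p])
  -- One factor 1/2 comes from the cap on the particle number, the other from 1 - δ ≥ 1/2.
  have h2 : (∏ p, (1 - x p)⁻¹) / 4 ≤ Z := by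
    rw [le_div_iff₀ hδ1] at h1
    nlinarith
  have h3 : ∑ p, -Real.log (1 - x p) - Real.log 4 ≤ Real.log Z := by
    have h4 := Real.log_le_log (div_pos hprod (by norm_num)) h2
    rw [Real.log_div hprod.ne' (by norm_num), Real.log_prod (fun p _ =>
      (inv_pos.2 (by linarith [hx1 p] : 0 < 1 - x p)).ne')] at h4
    simpa only [Real.log_inv] using h4
  obtain ⟨t, ht⟩ : ∃ t, t = γ * (Real.pi / n) ^ 2 := ⟨_, rfl⟩
  have ht0 : 0 < t := by rw [ht]; positivity
  have h5 := le_sum_neg_log ht0 ℓ (by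
      rw [← hn, ht, show γ * (Real.pi / n) ^ 2 * n = γ * Real.pi ^ 2 / n by field_simp,
        le_div_iff₀ hn0, one_mul]
      have : 1 ≤ Real.pi ^ 2 := one_le_pow₀ (by linarith [Real.pi_gt_three])
      nlinarith) hx1 (fun p => by
    rw [hx]
    refine Real.exp_le_exp.2 ?_
    have e1 := dispersion_le ℓ (p.1 + 1)
    have e2 := dispersion_le ℓ (p.2 + 1)
    push_cast at e1 e2
    rw [← hn] at e1 e2
    rw [ht, neg_mul, neg_le_neg_iff, mul_assoc]
    refine mul_le_mul_of_nonneg_left ?_ hγ0.le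
    rw [mul_add]
    exact add_le_add e1 e2)
  have h6 : Real.pi ^ 3 / (24 * t) = Real.pi * (1 - δ) / (24 * b) * n ^ 2 := by
    rw [ht, hγ]
    field_simp
  have h7 : Real.sqrt (Real.pi / t) ≤ n / Real.sqrt b := by
    have e : n / Real.sqrt b = Real.sqrt (n ^ 2 / b) := by
      rw [Real.sqrt_div (sq_nonneg n), Real.sqrt_sq hn0.le]
    rw [e]
    refine Real.sqrt_le_sqrt ?_
    rw [ht, show Real.pi / (γ * (Real.pi / n) ^ 2) = n ^ 2 / (γ * Real.pi) by field_simp]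
    refine div_le_div_of_nonneg_left (by positivity) hb ?_
    nlinarith [Real.pi_gt_three]
  rw [h6] at h5
  linarith

lemma C₂_eq : C₂ = -Real.pi / 24 := by
  have h : (riemannZeta 2).re = Real.pi ^ 2 / 6 := by
    rw [riemannZeta_two]
    rw [← Complex.ofReal_re (Real.pi ^ 2 / 6)]
    push_cast
    rfl
  have := Real.pi_ne_zero
  rw [C₂, h]
  field_simp
  norm_num

lemma ofReal_C₂ : (C₂ : ℂ) = -riemannZeta 2 / (4 * (Real.pi : ℂ)) := by
  have : (Real.pi : ℂ) ≠ 0 := by exact_mod_cast Real.pi_ne_zero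
  rw [C₂_eq, riemannZeta_two]
  push_cast
  field_simp
  norm_num

/-- The relative error of the leading low-temperature term. -/
def relError (b : ℝ) : ℝ := b ^ (-(1 / 3) : ℝ) * Real.log b ^ (2 / 3 : ℝ)

lemma relError_pow_three {b : ℝ} (hb : 1 < b) : relError b ^ 3 = Real.log b ^ 2 / b := by
  have h0 : 0 < b := by linarith
  rw [relError, mul_pow, ← Real.rpow_natCast, ← Real.rpow_mul h0.le, ← Real.rpow_natCast,
    ← Real.rpow_mul (Real.log_nonneg hb.le)]
  norm_num
  rw [Real.rpow_neg_one]
  ring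

lemma eventually_relError :
    ∀ᶠ b : ℝ in atTop, 64 ≤ b ∧ 1 ≤ Real.log b ∧ relError b ≤ 1 / 512 := by
  have h1 : (fun b : ℝ => Real.log b ^ 2) =o[atTop] (id : ℝ → ℝ) := Real.isLittleO_pow_log_id_atTop
  have h2 := h1.bound (show (0 : ℝ) < (1 / 512) ^ 3 by norm_num)
  filter_upwards [h2, eventually_ge_atTop 64,
    Real.tendsto_log_atTop.eventually_ge_atTop 1] with b hb hb64 hlog
  refine ⟨hb64, hlog, ?_⟩
  rw [Real.norm_of_nonneg (by positivity), id, Real.norm_of_nonneg (by linarith)] at hb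
  have h3 : relError b ^ 3 ≤ (1 / 512) ^ 3 := by
    rw [relError_pow_three (by linarith), div_le_iff₀ (by linarith)]
    exact hb
  exact le_of_pow_le_pow_left₀ (by norm_num) (by norm_num) h3

/-- The upper bound on the free energy for large `β S`. -/
theorem freeEnergy_le_of_relError {N : ℕ} (hN : 1 ≤ N) {β b : ℝ} (hβ : 0 < β)
    (hβb : β * ((N : ℝ) / 2) = b) (hb : 64 ≤ b) (hlog : 1 ≤ Real.log b)
    (hr : relError b ≤ 1 / 512) :
    freeEnergy N β ≤ -(Real.pi / 24) / (β * b) * (1 - 320 * relError b) := by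
  set r := relError b with hr'
  have hb0 : 0 < b := by linarith
  have hr0 : 0 < r := mul_pos (Real.rpow_pos_of_pos hb0 _) (Real.rpow_pos_of_pos (by linarith) _)
  have hr3 : r ^ 3 = Real.log b ^ 2 / b := relError_pow_three (by linarith)
  set u := Real.sqrt b with hu
  have hu2 : u ^ 2 = b := Real.sq_sqrt hb0.le
  have hu0 : 0 < u := Real.sqrt_pos.2 hb0
  have hu1 : 1 ≤ u := by
    rw [hu, Real.one_le_sqrt]; linarith
  -- A box of side about √b / r balances the errors: the boundary term is √b/n ≈ r, and the norm
  -- loss n² (log b)²/b² is of order r³/r² = r.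
  set q := u / r with hq
  have hq1 : 1 ≤ q := by rw [hq, le_div_iff₀ hr0]; linarith
  obtain ⟨ℓ, hℓ1, hℓ2⟩ : ∃ ℓ : ℕ, q ≤ (ℓ : ℝ) + 1 ∧ (ℓ : ℝ) + 1 ≤ 2 * q :=
    ⟨⌊q⌋₊, (Nat.lt_floor_add_one q).le, by
      have := Nat.floor_le (by linarith : 0 ≤ q)
      linarith⟩
  set n : ℝ := (ℓ : ℝ) + 1 with hn
  have hn0 : 0 < n := by positivity
  -- The sixth power of u r is b (log b)⁴ ≥ 64 = 4³, which is why b ≥ 64 is required; it gives 2q ≤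
  -- b.
  have hur : 2 ≤ u * r := by
    have h1 : (4 : ℝ) ^ 3 ≤ ((u * r) ^ 2) ^ 3 := by
      have : ((u * r) ^ 2) ^ 3 = b * Real.log b ^ 4 := by
        calc ((u * r) ^ 2) ^ 3 = (u ^ 2) ^ 3 * (r ^ 3) ^ 2 := by ring
          _ = _ := by rw [hu2, hr3]; field_simp
      rw [this]
      have h2 : 1 ≤ Real.log b ^ 4 := one_le_pow₀ hlog
      nlinarith
    have h2 : (4 : ℝ) ≤ (u * r) ^ 2 := le_of_pow_le_pow_left₀ (by norm_num) (by positivity) h1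
    nlinarith [mul_pos hu0 hr0]
  have hnb : n ≤ b := by
    refine hℓ2.trans ?_
    rw [hq, ← mul_div_assoc, div_le_iff₀ hr0, ← hu2]
    nlinarith
  have hlogn : 1 + Real.log n ≤ 2 * Real.log b := by
    have := Real.log_le_log hn0 hnb
    linarith
  have hlogn0 : 0 ≤ Real.log n := Real.log_nonneg (hq1.trans hℓ1)
  -- The constant is 16 · 2² · 2², from n ≤ 2q and 1 + log n ≤ 2 log b. Then δ ≤ 1/2 is the
  -- condition r ≤ 1/512.
  have hδb : 16 * n ^ 2 * (1 + Real.log n) ^ 2 / b ^ 2 ≤ 256 * r := by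
    calc 16 * n ^ 2 * (1 + Real.log n) ^ 2 / b ^ 2
        ≤ 16 * (2 * q) ^ 2 * (2 * Real.log b) ^ 2 / b ^ 2 := by gcongr
      _ = 256 * u ^ 2 * (Real.log b ^ 2 / b) / (r ^ 2 * b) := by
          rw [hq]; field_simp; ring
      _ = 256 * r := by rw [hu2, ← hr3]; field_simp
  have h1 := le_log_regionZ hN ℓ hb0 hβb (by positivity) (by linarith : 256 * r ≤ 1 / 2) hnb hδb
  refine (freeEnergy_le N hβ ℓ).trans ?_
  rw [← hn] at h1 ⊢
  generalize Real.log (regionZ N (square ℓ) latticeBond (dirichletField N ℓ) β) = Z at h1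
  have h2 : n / u ≤ r / b * n ^ 2 := by
    rw [div_le_iff₀ hu0, div_mul_eq_mul_div, div_mul_eq_mul_div, le_div_iff₀ hb0, ← hu2]
    rw [hq, div_le_iff₀ hr0] at hℓ1
    have := mul_le_mul_of_nonneg_left hℓ1 (mul_pos hn0 hu0).le
    nlinarith
  have h3 : Real.log 4 ≤ 2 * (r / b * n ^ 2) := by
    have h4 : Real.log 4 ≤ 2 := by
      rw [show (4 : ℝ) = 2 ^ 2 by norm_num, Real.log_pow]
      have := Real.log_two_lt_d9
      push_cast
      linarith
    have h5 : 1 ≤ r / b * n ^ 2 := by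
      refine le_trans ?_ h2
      rw [le_div_iff₀ hu0, one_mul]
      refine le_trans ?_ hℓ1
      rw [hq, le_div_iff₀ hr0]
      nlinarith
    linarith
  have h6 : Real.pi / (24 * b) * (1 - 320 * r) ≤ Z / n ^ 2 := by
    rw [le_div_iff₀ (by positivity)]
    refine le_trans ?_ h1
    -- In units of r n²/b the boundary terms cost 6 + 2 = 8, and raising 256 to 320 releases 64π/24
    -- ≥ 8.
    have h7 : Real.pi * (1 - 256 * r) / (24 * b) * n ^ 2 -
        Real.pi / (24 * b) * (1 - 320 * r) * n ^ 2 = Real.pi * (64 / 24) * (r / b * n ^ 2) := by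
      field_simp
      ring
    have h8 : 0 ≤ r / b * n ^ 2 := by positivity
    nlinarith [Real.pi_gt_three]
  have h9 : -(Real.pi / 24) / (β * b) * (1 - 320 * r) =
      -(1 / β) * (Real.pi / (24 * b) * (1 - 320 * r)) := by
    field_simp
  rw [h9, neg_mul, neg_mul, neg_le_neg_iff]
  exact mul_le_mul_of_nonneg_left h6 (by positivity)

end FreeEnergyBound

end Heisenberg2D

end

theorem propositionA1 :
    ((Heisenberg2D.C₂ : ℂ) = -riemannZeta 2 / (4 * (Real.pi : ℂ)) ∧
      Heisenberg2D.C₂ = -Real.pi / 24) ∧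
    (∀ (N : ℕ) (β : ℝ), 1 ≤ N → 0 < β →
      Tendsto (fun L : ℕ => Heisenberg2D.finiteFreeEnergy N (Heisenberg2D.square L) β) atTop
        (𝓝 (Heisenberg2D.freeEnergy N β))) ∧
    ∃ C : ℝ, 0 < C ∧ ∃ R : ℝ, 1 < R ∧
      ∀ (N : ℕ) (S β : ℝ), 1 ≤ N → S = (N : ℝ) / 2 → 0 < β → R ≤ β * S →
        Heisenberg2D.freeEnergy N β ≤
          Heisenberg2D.C₂ * S⁻¹ * (β ^ 2)⁻¹ *
            (1 - C * ((β * S) ^ (-(1 / 3) : ℝ) * Real.log (β * S) ^ (2 / 3 : ℝ))) := by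
  refine ⟨⟨Heisenberg2D.ofReal_C₂, Heisenberg2D.C₂_eq⟩,
    fun N β _ hβ => Heisenberg2D.tendsto_finiteFreeEnergy N hβ.le, 320, by norm_num, ?_⟩
  obtain ⟨R, hR⟩ := eventually_atTop.1 Heisenberg2D.eventually_relError
  -- The maximum with 2 only secures R > 1.
  refine ⟨max R 2, lt_max_of_lt_right (by norm_num), fun N S β hN hS hβ hRb => ?_⟩
  subst hS
  obtain ⟨h1, h2, h3⟩ := hR _ ((le_max_left _ _).trans hRb)
  have h4 := Heisenberg2D.freeEnergy_le_of_relError hN hβ rfl h1 h2 h3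
  have hN0 : (N : ℝ) ≠ 0 := by
    have : N ≠ 0 := by omega
    exact_mod_cast this
  refine h4.trans (le_of_eq ?_)
  rw [Heisenberg2D.C₂_eq, Heisenberg2D.relError]
  congr 1
  field_simp
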